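/- Let $\sigma>0$ and $P\ge 0$. Consider the channel with real input $X$ and output $Y\in\{1,-1\}$, where $Y=1$ if $X+Z\in\mathcal D$ and $Y=-1$ otherwise; here $Z$ is Gaussian with mean zero and variance $\sigma^2$, independent of $X$, and the quantization region $\mathcal D\subset\mathbb R$ is a Borel set. Let $$C(P)=\sup I(X;Y),$$ where the supremum is over all Borel sets $\mathcal D\subset\mathbb R$ and all distributions of $X$ on $\mathbb R$ with $\mathsf E[X^2]\le P$. Call a distribution $\mu$ on $\mathbb R$ with $\int x^2\,d\mu(x)\le P$ capacity-achieving if, for some Borel set $\mathcal D$, the input $X\sim\mu$ gives $I(X;Y)=C(P)$. Then a capacity-achieving input distribution exists, and every capacity-achieving input distribution is discrete with at most three mass points: it is of the form $\sum_{\ell=1}^3 p_\ell\,\delta_{\xi_\ell}$ with $\xi_\ell\in\mathbb R$, $0\le p_\ell\le 1$ and $p_1+p_2+p_3=1$, where $$\sum_{\ell=1}^3 p_\ell\,\xi_\ell=0\qquad\text{and}\qquad\sum_{\ell=1}^3 p_\ell\,\xi_\ell^2=P.$$ -/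

import Mathlib

open MeasureTheory ProbabilityTheory
open scoped NNReal ENNReal

namespace OneBitChannel

noncomputable section

/-- The one-bit quantizer with quantization region `D`: it outputs `1` on `D` and `-1` off `D`. -/
def quantizer (D : Set ℝ) (y : ℝ) : ℤ :=
  open Classical in if y ∈ D then 1 else -1

/-- The joint law of `(X, Y)`, where `X` has law `μ`, the noise `Z` is independent of `X` and
Gaussian with mean zero and variance `σ ^ 2`, and `Y` is the quantized value of `X + Z`. -/
def jointLaw (σ : ℝ≥0) (D : Set ℝ) (μ : Measure ℝ) : Measure (ℝ × ℤ) :=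
  (μ.prod (gaussianReal 0 (σ ^ 2))).map fun w => (w.1, quantizer D (w.1 + w.2))

/-- The mutual information of a pair with the given joint law, in nats: the relative entropy of
the joint law with respect to the product of its marginals. -/
def mutualInfo {α β : Type*} [MeasurableSpace α] [MeasurableSpace β] (ρ : Measure (α × β)) :
    ℝ≥0∞ :=
  InformationTheory.klDiv ρ (ρ.fst.prod ρ.snd)

/-- `μ` is a probability distribution on the reals with second moment at most `P`. -/
structure IsAdmissibleInput (P : ℝ) (μ : Measure ℝ) : Prop where
  isProbabilityMeasure : IsProbabilityMeasure μ
  power_le : ∫⁻ x, ENNReal.ofReal (x ^ 2) ∂μ ≤ ENNReal.ofReal P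

/-- The capacity under the average-power constraint `P`: the supremum of `I(X; Y)` over all Borel
quantization regions and all admissible input distributions. -/
def capacity (σ : ℝ≥0) (P : ℝ) : ℝ≥0∞ :=
  ⨆ (D : Set ℝ) (_ : MeasurableSet D) (μ : Measure ℝ) (_ : IsAdmissibleInput P μ),
    mutualInfo (jointLaw σ D μ)

/-- `μ` is an admissible input distribution which, with a suitable Borel quantization region,
attains the capacity. -/
def IsCapacityAchieving (σ : ℝ≥0) (P : ℝ) (μ : Measure ℝ) : Prop :=
  IsAdmissibleInput P μ ∧
    ∃ D : Set ℝ, MeasurableSet D ∧ mutualInfo (jointLaw σ D μ) = capacity σ P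

end

end OneBitChannel

/-!
Conditionally on `X = x`, a region `D` and its relaxation to a soft test `ψ : ℝ → [0, 1]` produce
the output `1` with probability `response ψ x`, the mean of `ψ` under a unit Gaussian centred at
`x`; scaling reduces the general noise level to this one. The information is convex in `ψ`, so a
test replaced by the region on which its smoothed score is positive loses nothing. Hence weak
compactness of soft tests in `L²` and tightness of the admissible inputs give an optimal pair.

At an optimal pair, amplifying and centring the input show `E X² = P` and `E X = 0`. Reweighting
the input by a bounded density that changes neither the output law nor the first two moments leaves
the information constant, because it is affine in such a perturbation. So either the input lives on
the roots of a quadratic polynomial, or the output entropy slope is quadratic on the support; in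
the latter case the Gaussian kernel, being variation diminishing, forces `D` to be a half-line, a
bounded interval or a complement of one, up to a null set.

The Karush–Kuhn–Tucker conditions for the input then confine the support to the points where a
function of the response touches a quadratic. For a half-line these are counted by Rolle's theorem
and the monotonicity of the Fisher information of a quantized Gaussian location. For an interval,
comparing the contact equations with the quadratic form of the score leaves three solutions.
-/

namespace OneBitChannel

open Filter Set Real InformationTheory
open scoped Topology BoundedContinuousFunction

noncomputable section

/-! ### Binary-output channels -/

/-- The derivative `H' (p) = log ((1 - p) / p)` of the binary entropy function on `(0, 1)`. -/
def entropySlope (p : ℝ) : ℝ := log (1 - p) - log p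

/-- The relative entropy of the Bernoulli law of parameter `p` with respect to that of parameter
`q`, as the Bregman divergence of `-H`. The value is the relative entropy only if `p = 0` when
`q = 0` and `p = 1` when `q = 1`. -/
def binaryDivergence (p q : ℝ) : ℝ := binEntropy q - binEntropy p + entropySlope q * (p - q)

/-- The mutual information, in nats, of an input with law `μ` and the output of the binary channel
that outputs `1` with probability `f x` when the input is `x`. -/
def info {α : Type*} [MeasurableSpace α] (μ : Measure α) (f : α → ℝ) : ℝ :=
  binEntropy (∫ x, f x ∂μ) - ∫ x, binEntropy (f x) ∂μ

/-- A randomized decision rule: `f x` is the probability of deciding for a positive output when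
observing `x`. -/
structure IsSoftTest {α : Type*} [MeasurableSpace α] (f : α → ℝ) : Prop where
  measurable : Measurable f
  nonneg : ∀ x, 0 ≤ f x
  le_one : ∀ x, f x ≤ 1

namespace IsSoftTest

variable {α : Type*} [MeasurableSpace α] {f : α → ℝ} {μ : Measure α}

lemma const {q : ℝ} (h0 : 0 ≤ q) (h1 : q ≤ 1) : IsSoftTest fun _ : α ↦ q :=
  ⟨measurable_const, fun _ ↦ h0, fun _ ↦ h1⟩

lemma one_sub (hf : IsSoftTest f) : IsSoftTest fun x ↦ 1 - f x where
  measurable := measurable_const.sub hf.measurable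
  nonneg x := sub_nonneg.2 (hf.le_one x)
  le_one x := by linarith [hf.nonneg x]

lemma norm_le_one (hf : IsSoftTest f) (x : α) : ‖f x‖ ≤ 1 := by
  rw [Real.norm_eq_abs, abs_of_nonneg (hf.nonneg x)]
  exact hf.le_one x

lemma integrable_mul (hf : IsSoftTest f) {u : α → ℝ} (hu : Integrable u μ) :
    Integrable (fun x ↦ f x * u x) μ :=
  hu.bdd_mul (c := 1) hf.measurable.aestronglyMeasurable (ae_of_all _ hf.norm_le_one)

lemma integral_nonneg (hf : IsSoftTest f) : 0 ≤ ∫ x, f x ∂μ :=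
  MeasureTheory.integral_nonneg hf.nonneg

lemma info_le_log_two (hf : IsSoftTest f) : info μ f ≤ log 2 := by
  have hcond : 0 ≤ ∫ x, binEntropy (f x) ∂μ :=
    MeasureTheory.integral_nonneg fun x ↦ binEntropy_nonneg (hf.nonneg x) (hf.le_one x)
  exact (sub_le_self _ hcond).trans binEntropy_le_log_two

section IsFiniteMeasure

variable [IsFiniteMeasure μ]

lemma integrable (hf : IsSoftTest f) : Integrable f μ :=
  .of_bound hf.measurable.aestronglyMeasurable 1 (ae_of_all _ hf.norm_le_one)

lemma integrable_binEntropy (hf : IsSoftTest f) : Integrable (fun x ↦ binEntropy (f x)) μ :=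
  .of_bound (binEntropy_continuous.measurable.comp hf.measurable).aestronglyMeasurable (log 2)
    (ae_of_all _ fun x ↦ by
      rw [Real.norm_eq_abs, abs_of_nonneg (binEntropy_nonneg (hf.nonneg x) (hf.le_one x))]
      exact binEntropy_le_log_two)

lemma integrable_binaryDivergence (hf : IsSoftTest f) (q : ℝ) :
    Integrable (fun x ↦ binaryDivergence (f x) q) μ :=
  ((integrable_const _).sub hf.integrable_binEntropy).add
    ((hf.integrable.sub (integrable_const _)).const_mul _)

lemma ae_eq_zero_of_integral_eq_zero (hf : IsSoftTest f) :
    ∀ᵐ x ∂μ, ∫ x, f x ∂μ = 0 → f x = 0 := by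
  by_cases h : ∫ x, f x ∂μ = 0
  · exact ((integral_eq_zero_iff_of_nonneg hf.nonneg hf.integrable).1 h).mono fun _ hx _ ↦ hx
  · exact ae_of_all _ fun _ h' ↦ absurd h' h

end IsFiniteMeasure

variable [IsProbabilityMeasure μ]

lemma integral_one_sub (hf : IsSoftTest f) : ∫ x, (1 - f x) ∂μ = 1 - ∫ x, f x ∂μ := by
  rw [integral_sub (integrable_const _) hf.integrable, integral_const, probReal_univ, one_smul]

lemma integral_le_one (hf : IsSoftTest f) : ∫ x, f x ∂μ ≤ 1 :=
  sub_nonneg.1 (hf.integral_one_sub (μ := μ) ▸ hf.one_sub.integral_nonneg)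

lemma ae_eq_one_of_integral_eq_one (hf : IsSoftTest f) :
    ∀ᵐ x ∂μ, ∫ x, f x ∂μ = 1 → f x = 1 := by
  filter_upwards [hf.one_sub.ae_eq_zero_of_integral_eq_zero (μ := μ)] with x hx h
  rw [hf.integral_one_sub, h] at hx
  linarith [hx (sub_self 1)]

lemma integral_pos (hf : IsSoftTest f) (h : ∀ x, 0 < f x) : 0 < ∫ x, f x ∂μ := by
  refine hf.integral_nonneg.lt_of_ne' fun h0 ↦ ?_
  obtain ⟨x, hx⟩ := (hf.ae_eq_zero_of_integral_eq_zero (μ := μ)).exists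
  exact (h x).ne' (hx h0)

lemma integral_lt_one (hf : IsSoftTest f) (h : ∀ x, f x < 1) : ∫ x, f x ∂μ < 1 :=
  sub_pos.1 (hf.integral_one_sub (μ := μ) ▸ hf.one_sub.integral_pos fun x ↦ sub_pos.2 (h x))

lemma info_nonneg (hf : IsSoftTest f) : 0 ≤ info μ f :=
  sub_nonneg.2 <| strictConcave_binEntropy.concaveOn.le_map_integral
    binEntropy_continuous.continuousOn isClosed_Icc
    (ae_of_all _ fun x ↦ ⟨hf.nonneg x, hf.le_one x⟩) hf.integrable hf.integrable_binEntropy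

lemma integral_binaryDivergence (hf : IsSoftTest f) (q : ℝ) :
    ∫ x, binaryDivergence (f x) q ∂μ =
      binEntropy q - ∫ x, binEntropy (f x) ∂μ + entropySlope q * (∫ x, f x ∂μ - q) := by
  have hentropy : Integrable (fun x ↦ binEntropy q - binEntropy (f x)) μ :=
    (integrable_const _).sub hf.integrable_binEntropy
  have hlinear : Integrable (fun x ↦ f x - q) μ := hf.integrable.sub (integrable_const _)
  simp only [binaryDivergence]
  rw [integral_add hentropy (hlinear.const_mul _),
    integral_sub (integrable_const _) hf.integrable_binEntropy, integral_const_mul,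
    integral_sub hf.integrable (integrable_const _)]
  simp only [integral_const, probReal_univ, one_smul]

lemma integral_binaryDivergence_integral (hf : IsSoftTest f) :
    ∫ x, binaryDivergence (f x) (∫ x, f x ∂μ) ∂μ = info μ f := by
  rw [hf.integral_binaryDivergence, info, sub_self, mul_zero, add_zero]

end IsSoftTest

lemma neg_le_binaryDivergence {p q : ℝ} (hp0 : 0 ≤ p) (hp1 : p ≤ 1) (hq0 : 0 ≤ q) (hq1 : q ≤ 1) :
    -(log 2 + |entropySlope q|) ≤ binaryDivergence p q := by
  have hdiff : |entropySlope q * (p - q)| ≤ |entropySlope q| := by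
    rw [abs_mul]
    exact mul_le_of_le_one_right (abs_nonneg _) (abs_le.2 ⟨by linarith, by linarith⟩)
  have := (abs_le.1 hdiff).1
  rw [binaryDivergence]
  linarith [binEntropy_nonneg hq0 hq1, binEntropy_le_log_two (p := p)]

/-! ### Mutual information of a binary-output channel -/

lemma binaryDivergence_eq_klFun {p q : ℝ} (h0 : q = 0 → p = 0) (h1 : q = 1 → p = 1) :
    binaryDivergence p q = q * klFun (p / q) + (1 - q) * klFun ((1 - p) / (1 - q)) := by
  have hmul_klFun (a b : ℝ) (hab : b = 0 → a = 0) :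
      b * klFun (a / b) = a * log a - a * log b + b - a := by
    rcases eq_or_ne b 0 with rfl | hb
    · simp [hab rfl]
    rcases eq_or_ne a 0 with rfl | ha
    · simp [klFun_apply]
    · rw [klFun_apply, log_div ha hb]
      field_simp
  rw [hmul_klFun p q h0, hmul_klFun (1 - p) (1 - q) fun h ↦ by rw [h1 (by linarith), sub_self],
    binaryDivergence, entropySlope, binEntropy, binEntropy, log_inv, log_inv, log_inv, log_inv]
  ring

/-- The joint law of an input with law `μ` and the output of the binary channel that outputs `1`
with probability `f x` and `-1` with probability `1 - f x` when the input is `x`. -/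
def channelLaw {α : Type*} [MeasurableSpace α] (μ : Measure α) (f : α → ℝ) : Measure (α × ℤ) :=
  (μ.withDensity fun x ↦ ENNReal.ofReal (f x)).map (fun x ↦ (x, 1)) +
    (μ.withDensity fun x ↦ ENNReal.ofReal (1 - f x)).map (fun x ↦ (x, -1))

section ChannelLaw

variable {α : Type*} [MeasurableSpace α] {μ : Measure α} {f g : α → ℝ}

lemma lintegral_channelLaw (hf : Measurable f) {F : α × ℤ → ℝ≥0∞} (hF : Measurable F) :
    ∫⁻ w, F w ∂channelLaw μ f =
      ∫⁻ x, (ENNReal.ofReal (f x) * F (x, 1) + ENNReal.ofReal (1 - f x) * F (x, -1)) ∂μ := by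
  have hsection (k : ℤ) : Measurable fun x ↦ F (x, k) := by fun_prop
  rw [channelLaw, lintegral_add_measure, lintegral_map hF measurable_prodMk_right,
    lintegral_map hF measurable_prodMk_right,
    lintegral_withDensity_eq_lintegral_mul _ (by fun_prop) (hsection 1),
    lintegral_withDensity_eq_lintegral_mul _ (by fun_prop) (hsection (-1)),
    ← lintegral_add_left (Measurable.mul (by fun_prop) (hsection 1))]
  rfl

lemma IsSoftTest.ofReal_add_ofReal_one_sub (hf : IsSoftTest f) (x : α) :
    ENNReal.ofReal (f x) + ENNReal.ofReal (1 - f x) = 1 := by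
  rw [← ENNReal.ofReal_add (hf.nonneg x) (hf.one_sub.nonneg x), add_sub_cancel, ENNReal.ofReal_one]

lemma fst_channelLaw (hf : IsSoftTest f) : (channelLaw μ f).fst = μ := by
  refine Measure.ext_of_lintegral _ fun F hF ↦ ?_
  rw [Measure.fst, lintegral_map hF measurable_fst,
    lintegral_channelLaw hf.measurable (F := fun w ↦ F w.1) (by fun_prop)]
  simp only [← add_mul, hf.ofReal_add_ofReal_one_sub, one_mul]

lemma isFiniteMeasure_channelLaw [IsFiniteMeasure μ] (hf : IsSoftTest f) :
    IsFiniteMeasure (channelLaw μ f) := by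
  refine ⟨?_⟩
  rw [← Measure.fst_univ, fst_channelLaw hf]
  exact measure_lt_top μ univ

lemma snd_channelLaw [IsProbabilityMeasure μ] (hf : IsSoftTest f) :
    (channelLaw μ f).snd = ENNReal.ofReal (∫ x, f x ∂μ) • Measure.dirac 1 +
      ENNReal.ofReal (1 - ∫ x, f x ∂μ) • Measure.dirac (-1) := by
  refine Measure.ext_of_lintegral _ fun F hF ↦ ?_
  have hfm := hf.measurable
  rw [Measure.snd, lintegral_map hF measurable_snd,
    lintegral_channelLaw hfm (F := fun w ↦ F w.2) (by fun_prop), lintegral_add_left (by fun_prop)]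
  dsimp only
  rw [lintegral_mul_const _ (by fun_prop), lintegral_mul_const _ (by fun_prop),
    ← ofReal_integral_eq_lintegral_ofReal hf.integrable (ae_of_all _ hf.nonneg),
    ← ofReal_integral_eq_lintegral_ofReal hf.one_sub.integrable (ae_of_all _ hf.one_sub.nonneg),
    hf.integral_one_sub, lintegral_add_measure, lintegral_smul_measure, lintegral_smul_measure,
    lintegral_dirac, lintegral_dirac, smul_eq_mul, smul_eq_mul]

lemma fst_prod_snd_channelLaw [IsProbabilityMeasure μ] (hf : IsSoftTest f) :
    (channelLaw μ f).fst.prod (channelLaw μ f).snd = channelLaw μ fun _ ↦ ∫ x, f x ∂μ := by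
  refine Measure.ext_of_lintegral _ fun F hF ↦ ?_
  rw [fst_channelLaw hf, snd_channelLaw hf, lintegral_prod _ hF.aemeasurable,
    lintegral_channelLaw measurable_const hF]
  refine lintegral_congr fun x ↦ ?_
  rw [lintegral_add_measure, lintegral_smul_measure, lintegral_smul_measure, lintegral_dirac,
    lintegral_dirac, smul_eq_mul, smul_eq_mul]

/-- The likelihood ratio between the binary channels `f` and `g`, as a function of the input and
the output. -/
def likelihoodRatio (f g : α → ℝ) (w : α × ℤ) : ℝ≥0∞ :=
  if w.2 = 1 then ENNReal.ofReal (f w.1 / g w.1) else ENNReal.ofReal ((1 - f w.1) / (1 - g w.1))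

lemma measurable_likelihoodRatio (hf : Measurable f) (hg : Measurable g) :
    Measurable (likelihoodRatio f g) :=
  Measurable.ite (measurable_snd (measurableSet_singleton 1)) (by fun_prop) (by fun_prop)

lemma channelLaw_eq_withDensity (hf : Measurable f) (hg : IsSoftTest g)
    (h0 : ∀ᵐ x ∂μ, g x = 0 → f x = 0) (h1 : ∀ᵐ x ∂μ, g x = 1 → f x = 1) :
    channelLaw μ f = (channelLaw μ g).withDensity (likelihoodRatio f g) := by
  have hcancel {a b : ℝ} (hb : 0 ≤ b) (hab : b = 0 → a = 0) :
      ENNReal.ofReal a = ENNReal.ofReal b * ENNReal.ofReal (a / b) := by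
    rw [← ENNReal.ofReal_mul hb, mul_div_cancel_of_imp' hab]
  have hr := measurable_likelihoodRatio hf hg.measurable
  refine Measure.ext_of_lintegral _ fun F hF ↦ ?_
  rw [lintegral_withDensity_eq_lintegral_mul _ hr hF, lintegral_channelLaw hf hF,
    lintegral_channelLaw hg.measurable (hr.mul hF)]
  refine lintegral_congr_ae ?_
  filter_upwards [h0, h1] with x hx0 hx1
  rw [hcancel (hg.nonneg x) hx0, hcancel (a := 1 - f x) (hg.one_sub.nonneg x)
    fun h ↦ by rw [hx1 (by linarith), sub_self], mul_assoc, mul_assoc]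
  rfl

lemma klDiv_channelLaw [IsFiniteMeasure μ] (hf : IsSoftTest f) (hg : IsSoftTest g)
    (h0 : ∀ᵐ x ∂μ, g x = 0 → f x = 0) (h1 : ∀ᵐ x ∂μ, g x = 1 → f x = 1) :
    klDiv (channelLaw μ f) (channelLaw μ g) =
      ∫⁻ x, ENNReal.ofReal (binaryDivergence (f x) (g x)) ∂μ := by
  have := isFiniteMeasure_channelLaw (μ := μ) hf
  have := isFiniteMeasure_channelLaw (μ := μ) hg
  have hr := measurable_likelihoodRatio hf.measurable hg.measurable
  have hdensity := channelLaw_eq_withDensity hf.measurable hg h0 h1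
  have hac : channelLaw μ f ≪ channelLaw μ g :=
    hdensity ▸ withDensity_absolutelyContinuous _ _
  have hrnDeriv : (channelLaw μ f).rnDeriv (channelLaw μ g) =ᵐ[channelLaw μ g]
      likelihoodRatio f g := hdensity ▸ Measure.rnDeriv_withDensity (channelLaw μ g) hr
  rw [klDiv_eq_lintegral_klFun_of_ac hac, lintegral_congr_ae
      (hrnDeriv.mono fun w hw ↦ congrArg (fun r ↦ ENNReal.ofReal (klFun r.toReal)) hw),
    lintegral_channelLaw hg.measurable (by fun_prop)]
  refine lintegral_congr_ae ?_
  filter_upwards [h0, h1] with x hx0 hx1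
  have hpos : 0 ≤ f x / g x := div_nonneg (hf.nonneg x) (hg.nonneg x)
  have hneg : 0 ≤ (1 - f x) / (1 - g x) := div_nonneg (hf.one_sub.nonneg x) (hg.one_sub.nonneg x)
  rw [binaryDivergence_eq_klFun hx0 hx1,
    ENNReal.ofReal_add (mul_nonneg (hg.nonneg x) (klFun_nonneg hpos))
      (mul_nonneg (hg.one_sub.nonneg x) (klFun_nonneg hneg)),
    ENNReal.ofReal_mul (hg.nonneg x), ENNReal.ofReal_mul (hg.one_sub.nonneg x)]
  simp only [likelihoodRatio, reduceIte, reduceCtorEq, ENNReal.toReal_ofReal hpos,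
    ENNReal.toReal_ofReal hneg]

lemma mutualInfo_channelLaw [IsProbabilityMeasure μ] (hf : IsSoftTest f) :
    mutualInfo (channelLaw μ f) = ENNReal.ofReal (info μ f) := by
  have h0 := hf.ae_eq_zero_of_integral_eq_zero (μ := μ)
  have h1 := hf.ae_eq_one_of_integral_eq_one (μ := μ)
  rw [mutualInfo, fst_prod_snd_channelLaw hf,
    klDiv_channelLaw hf (.const hf.integral_nonneg hf.integral_le_one) h0 h1,
    ← hf.integral_binaryDivergence_integral, ofReal_integral_eq_lintegral_ofReal
      (hf.integrable_binaryDivergence _)]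
  filter_upwards [h0, h1] with x hx0 hx1
  rw [binaryDivergence_eq_klFun hx0 hx1]
  exact add_nonneg
    (mul_nonneg hf.integral_nonneg (klFun_nonneg (div_nonneg (hf.nonneg x) hf.integral_nonneg)))
    (mul_nonneg (sub_nonneg.2 hf.integral_le_one)
      (klFun_nonneg (div_nonneg (hf.one_sub.nonneg x) (sub_nonneg.2 hf.integral_le_one))))

end ChannelLaw

/-- The probability that the quantizer with region `D` outputs `1` on input `x`. -/
def crossover (σ : ℝ≥0) (D : Set ℝ) (x : ℝ) : ℝ := (gaussianReal 0 (σ ^ 2)).real {z | x + z ∈ D}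

section Crossover

variable {D : Set ℝ}

lemma isSoftTest_crossover (σ : ℝ≥0) (hD : MeasurableSet D) : IsSoftTest (crossover σ D) where
  measurable := (measurable_measure_prodMk_left
    ((measurable_fst.add measurable_snd) hD)).ennreal_toReal
  nonneg _ := measureReal_nonneg
  le_one _ := measureReal_le_one

lemma measurable_quantizer (hD : MeasurableSet D) : Measurable (quantizer D) :=
  Measurable.ite hD measurable_const measurable_const

lemma jointLaw_eq_channelLaw (σ : ℝ≥0) (hD : MeasurableSet D) (μ : Measure ℝ) [SFinite μ] :
    jointLaw σ D μ = channelLaw μ (crossover σ D) := by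
  refine Measure.ext_of_lintegral _ fun F hF ↦ ?_
  have hT : Measurable fun w : ℝ × ℝ ↦ (w.1, quantizer D (w.1 + w.2)) :=
    measurable_fst.prodMk ((measurable_quantizer hD).comp (measurable_fst.add measurable_snd))
  rw [lintegral_channelLaw (isSoftTest_crossover σ hD).measurable hF, jointLaw,
    lintegral_map hF hT, lintegral_prod _ (by fun_prop)]
  refine lintegral_congr fun x ↦ ?_
  have hA : MeasurableSet {z : ℝ | x + z ∈ D} := measurable_const_add x hD
  have hcompl : 1 - crossover σ D x = (gaussianReal 0 (σ ^ 2)).real {z : ℝ | x + z ∈ D}ᶜ := by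
    rw [probReal_compl_eq_one_sub hA, crossover]
  rw [hcompl, crossover, ofReal_measureReal, ofReal_measureReal, ← lintegral_add_compl _ hA,
    setLIntegral_congr_fun (g := fun _ ↦ F (x, 1)) hA
      (fun z (hz : x + z ∈ D) ↦ by simp only [quantizer, if_pos hz]),
    setLIntegral_congr_fun (g := fun _ ↦ F (x, -1)) hA.compl
      (fun z (hz : x + z ∉ D) ↦ by simp only [quantizer, if_neg hz]),
    setLIntegral_const, setLIntegral_const, mul_comm, mul_comm (F (x, -1))]

lemma mutualInfo_jointLaw (σ : ℝ≥0) (hD : MeasurableSet D) (μ : Measure ℝ)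
    [IsProbabilityMeasure μ] :
    mutualInfo (jointLaw σ D μ) = ENNReal.ofReal (info μ (crossover σ D)) := by
  rw [jointLaw_eq_channelLaw σ hD, mutualInfo_channelLaw (isSoftTest_crossover σ hD)]

end Crossover

/-! ### The standard Gaussian density -/

/-- The standard normal density. -/
def gaussPDF (y : ℝ) : ℝ := gaussianPDFReal 0 1 y

lemma gaussPDF_eq (y : ℝ) : gaussPDF y = (√(2 * π))⁻¹ * exp (-y ^ 2 / 2) := by
  simp [gaussPDF, gaussianPDFReal]

lemma gaussPDF_pos (y : ℝ) : 0 < gaussPDF y := gaussianPDFReal_pos 0 1 y one_ne_zero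

lemma gaussPDF_nonneg (y : ℝ) : 0 ≤ gaussPDF y := (gaussPDF_pos y).le

lemma gaussPDF_neg (y : ℝ) : gaussPDF (-y) = gaussPDF y := by simp [gaussPDF_eq]

lemma gaussianPDFReal_eq_gaussPDF (x y : ℝ) : gaussianPDFReal x 1 y = gaussPDF (y - x) := by
  simp [gaussPDF, gaussianPDFReal]

lemma hasDerivAt_gaussPDF (y : ℝ) : HasDerivAt gaussPDF (-y * gaussPDF y) y := by
  have : gaussPDF = fun y ↦ (√(2 * π))⁻¹ * exp (-y ^ 2 / 2) := funext gaussPDF_eq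
  rw [gaussPDF_eq, this]
  have h : HasDerivAt (fun y : ℝ ↦ -y ^ 2 / 2) (-y) y :=
    ((hasDerivAt_pow 2 y).fun_neg.div_const 2).congr_deriv (by norm_num; ring)
  exact (h.exp.const_mul _).congr_deriv (by ring)

@[fun_prop]
lemma continuous_gaussPDF : Continuous gaussPDF :=
  continuous_iff_continuousAt.2 fun y ↦ (hasDerivAt_gaussPDF y).continuousAt

lemma integrable_gaussPDF : Integrable gaussPDF := integrable_gaussianPDFReal 0 1

lemma integral_gaussPDF : ∫ y, gaussPDF y = 1 := integral_gaussianPDFReal_eq_one 0 one_ne_zero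

lemma integrable_gaussPDF_sub (x : ℝ) : Integrable fun y ↦ gaussPDF (y - x) :=
  integrable_gaussPDF.comp_sub_right x

lemma integral_gaussPDF_sub (x : ℝ) : ∫ y, gaussPDF (y - x) = 1 := by
  rw [integral_sub_right_eq_self gaussPDF x, integral_gaussPDF]

lemma gaussPDF_le_one (y : ℝ) : gaussPDF y ≤ 1 := by
  rw [gaussPDF_eq]
  have hsqrt : 1 ≤ √(2 * π) := Real.one_le_sqrt.2 (by linarith [pi_gt_three])
  have hexp : exp (-y ^ 2 / 2) ≤ 1 := exp_le_one_iff.2 (by nlinarith [sq_nonneg y])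
  exact mul_le_one₀ (inv_le_one_of_one_le₀ hsqrt) (exp_pos _).le hexp

lemma gaussPDF_sub (y x : ℝ) : gaussPDF (y - x) = gaussPDF y * exp (x * y - x ^ 2 / 2) := by
  rw [gaussPDF_eq, gaussPDF_eq, mul_assoc, ← exp_add]
  congr 2
  ring

lemma gaussPDF_sub_eq_mul (y z x : ℝ) :
    gaussPDF (y - x) = exp ((z ^ 2 - y ^ 2) / 2) * exp (x * (y - z)) * gaussPDF (z - x) := by
  rw [gaussPDF_eq, gaussPDF_eq, mul_left_comm, ← exp_add, ← exp_add]
  congr 2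
  ring

lemma gaussPDF_sub_le {δ : ℝ} (hδ : |δ| ≤ 1) (y : ℝ) :
    gaussPDF (y - δ) ≤ exp (1 / 2) * (gaussPDF (y - 1) + gaussPDF (y - -1)) := by
  have hδ' := abs_le.1 hδ
  have hexp (x : ℝ) : exp (1 / 2) * (gaussPDF y * exp x) = gaussPDF y * exp (x + 1 / 2) := by
    rw [exp_add]
    ring
  rw [mul_add, gaussPDF_sub, gaussPDF_sub, gaussPDF_sub, hexp, hexp, ← mul_add]
  refine mul_le_mul_of_nonneg_left ?_ (gaussPDF_nonneg y)
  rcases le_total 0 y with hy | hy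
  · refine le_add_of_le_of_nonneg (exp_le_exp.2 ?_) (exp_pos _).le
    nlinarith [sq_nonneg δ]
  · refine le_add_of_nonneg_of_le (exp_pos _).le (exp_le_exp.2 ?_)
    nlinarith [sq_nonneg δ]

lemma tendsto_integral_abs_gaussPDF_sub_sub :
    Tendsto (fun δ ↦ ∫ y, |gaussPDF (y - δ) - gaussPDF y|) (𝓝 0) (𝓝 0) := by
  have hbound : Integrable fun y ↦
      exp (1 / 2) * (gaussPDF (y - 1) + gaussPDF (y - -1)) + gaussPDF y :=
    (((integrable_gaussPDF_sub 1).add (integrable_gaussPDF_sub (-1))).const_mul _).add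
      integrable_gaussPDF
  have hlim (y : ℝ) : Tendsto (fun δ ↦ |gaussPDF (y - δ) - gaussPDF y|) (𝓝 0) (𝓝 0) :=
    (show Continuous fun δ ↦ |gaussPDF (y - δ) - gaussPDF y| by fun_prop).tendsto' _ _ (by simp)
  have hdominated : ∀ᶠ δ in 𝓝 (0 : ℝ), ∀ᵐ y, ‖|gaussPDF (y - δ) - gaussPDF y|‖ ≤
      exp (1 / 2) * (gaussPDF (y - 1) + gaussPDF (y - -1)) + gaussPDF y := by
    filter_upwards [Metric.closedBall_mem_nhds (0 : ℝ) one_pos] with δ hδ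
    refine ae_of_all _ fun y ↦ ?_
    rw [norm_abs_eq_norm]
    refine (norm_sub_le _ _).trans ?_
    rw [Real.norm_of_nonneg (gaussPDF_nonneg _), Real.norm_of_nonneg (gaussPDF_nonneg _)]
    exact add_le_add_left (gaussPDF_sub_le (by simpa using hδ) y) _
  simpa using tendsto_integral_filter_of_dominated_convergence _
    (Eventually.of_forall fun δ ↦ by fun_prop) hdominated hbound (ae_of_all _ hlim)

/-! ### The response of a Gaussian observation to a test -/

/-- The probability of a positive output on input `x` when the receiver decides for a positive
output with probability `ψ y` on observing `y`, in standard Gaussian noise. -/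
def response (ψ : ℝ → ℝ) (x : ℝ) : ℝ := ∫ y, ψ y * gaussPDF (y - x)

lemma response_eq_integral_gaussianReal (ψ : ℝ → ℝ) (x : ℝ) :
    response ψ x = ∫ y, ψ y ∂(gaussianReal x 1) := by
  rw [integral_gaussianReal_eq_integral_smul one_ne_zero, response]
  simp only [gaussianPDFReal_eq_gaussPDF, smul_eq_mul, mul_comm]

lemma response_eq_integral_exp (ψ : ℝ → ℝ) (x : ℝ) :
    response ψ x = ∫ y, ψ y * exp (x * y - x ^ 2 / 2) ∂(gaussianReal 0 1) := by
  rw [integral_gaussianReal_eq_integral_smul one_ne_zero, response]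
  simp only [gaussianPDFReal_eq_gaussPDF, sub_zero, gaussPDF_sub, smul_eq_mul, mul_left_comm]

lemma response_congr {ψ ψ' : ℝ → ℝ} (h : ψ =ᵐ[volume] ψ') : response ψ = response ψ' :=
  funext fun x ↦ integral_congr_ae (h.mul (EventuallyEq.refl _ fun y ↦ gaussPDF (y - x)))

namespace IsSoftTest

variable {ψ : ℝ → ℝ}

lemma response_one_sub (hψ : IsSoftTest ψ) (x : ℝ) :
    response (fun y ↦ 1 - ψ y) x = 1 - response ψ x := by
  simp only [response, sub_mul, one_mul]
  rw [integral_sub (integrable_gaussPDF_sub x) (hψ.integrable_mul (integrable_gaussPDF_sub x)),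
    integral_gaussPDF_sub]

lemma response_nonneg (hψ : IsSoftTest ψ) (x : ℝ) : 0 ≤ response ψ x :=
  MeasureTheory.integral_nonneg fun y ↦ mul_nonneg (hψ.nonneg y) (gaussPDF_nonneg _)

lemma response_le_one (hψ : IsSoftTest ψ) (x : ℝ) : response ψ x ≤ 1 := by
  linarith [hψ.one_sub.response_nonneg x, hψ.response_one_sub x]

lemma abs_response_sub_le (hψ : IsSoftTest ψ) (x x' : ℝ) :
    |response ψ x - response ψ x'| ≤ ∫ y, |gaussPDF (y - (x - x')) - gaussPDF y| := by
  have hx := integrable_gaussPDF_sub x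
  have hx' := integrable_gaussPDF_sub x'
  have htranslate : ∫ y, |gaussPDF (y - x) - gaussPDF (y - x')| =
      ∫ y, |gaussPDF (y - (x - x')) - gaussPDF y| := by
    rw [← integral_sub_right_eq_self (fun y ↦ |gaussPDF (y - (x - x')) - gaussPDF y|) x']
    simp only [sub_sub, add_sub_cancel]
  rw [← htranslate, response, response,
    ← integral_sub (hψ.integrable_mul hx) (hψ.integrable_mul hx')]
  refine (abs_integral_le_integral_abs).trans (integral_mono
    ((hψ.integrable_mul hx).sub (hψ.integrable_mul hx')).abs (hx.sub hx').abs fun y ↦ ?_)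
  simp only [← mul_sub, abs_mul]
  exact mul_le_of_le_one_left (abs_nonneg _) (hψ.norm_le_one y)

end IsSoftTest

lemma uniformEquicontinuous_response {ι : Type*} {ψ : ι → ℝ → ℝ} (hψ : ∀ i, IsSoftTest (ψ i)) :
    UniformEquicontinuous fun i ↦ response (ψ i) := by
  refine Metric.uniformEquicontinuous_of_continuity_modulus _
    tendsto_integral_abs_gaussPDF_sub_sub _ fun x x' i ↦ ?_
  rcases le_total x' x with h | h
  · rw [Real.dist_eq, Real.dist_eq, abs_of_nonneg (sub_nonneg.2 h)]
    exact (hψ i).abs_response_sub_le x x'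
  · rw [dist_comm, dist_comm x, Real.dist_eq, Real.dist_eq, abs_of_nonneg (sub_nonneg.2 h)]
    exact (hψ i).abs_response_sub_le x' x

namespace IsSoftTest

variable {ψ : ℝ → ℝ}

lemma continuous_response (hψ : IsSoftTest ψ) : Continuous (response ψ) :=
  ((uniformEquicontinuous_response fun _ : Unit ↦ hψ).uniformContinuous ()).continuous

lemma isSoftTest_response (hψ : IsSoftTest ψ) : IsSoftTest (response ψ) :=
  ⟨hψ.continuous_response.measurable, hψ.response_nonneg, hψ.response_le_one⟩

lemma exists_mul_exp_le_response (hψ : IsSoftTest ψ) (h : ¬ ψ =ᵐ[volume] 0) :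
    ∃ c > 0, ∀ x, c * exp (-x ^ 2) ≤ response ψ x := by
  have hint : Integrable fun y ↦ ψ y * exp (-1 * y ^ 2) :=
    hψ.integrable_mul (integrable_exp_neg_mul_sq one_pos)
  have hnonneg : 0 ≤ fun y ↦ ψ y * exp (-1 * y ^ 2) :=
    fun y ↦ mul_nonneg (hψ.nonneg y) (exp_pos _).le
  have hpos : 0 < ∫ y, ψ y * exp (-1 * y ^ 2) := by
    refine (MeasureTheory.integral_nonneg hnonneg).lt_of_ne' fun h0 ↦ h ?_
    filter_upwards [(integral_eq_zero_iff_of_nonneg hnonneg hint).1 h0] with y hy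
    exact (mul_eq_zero_iff_right (exp_pos _).ne').1 hy
  have hsqrt : 0 < (√(2 * π))⁻¹ := by positivity
  refine ⟨(√(2 * π))⁻¹ * ∫ y, ψ y * exp (-1 * y ^ 2), mul_pos hsqrt hpos, fun x ↦ ?_⟩
  rw [mul_assoc, ← integral_mul_const, ← integral_const_mul]
  refine integral_mono ((hint.mul_const _).const_mul _)
    (hψ.integrable_mul (integrable_gaussPDF_sub x)) fun y ↦ ?_
  dsimp only
  rw [gaussPDF_eq, mul_assoc, mul_left_comm, ← exp_add]
  refine mul_le_mul_of_nonneg_left (mul_le_mul_of_nonneg_left ?_ hsqrt.le) (hψ.nonneg y)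
  exact exp_le_exp.2 (by nlinarith [sq_nonneg (x + y)])

end IsSoftTest

/-- A soft test that is almost surely constant neither `0` nor `1`. -/
structure IsProperTest (ψ : ℝ → ℝ) : Prop extends IsSoftTest ψ where
  not_zero : ¬ ψ =ᵐ[volume] 0
  not_one : ¬ ψ =ᵐ[volume] 1

namespace IsProperTest

variable {ψ : ℝ → ℝ} {μ : Measure ℝ}

lemma one_sub (hψ : IsProperTest ψ) : IsProperTest fun y ↦ 1 - ψ y where
  toIsSoftTest := hψ.toIsSoftTest.one_sub
  not_zero h := hψ.not_one (h.mono fun _ hy ↦ (sub_eq_zero.1 hy).symm)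
  not_one h := hψ.not_zero (h.mono fun _ hy ↦ sub_eq_self.1 hy)

lemma response_pos (hψ : IsProperTest ψ) (x : ℝ) : 0 < response ψ x := by
  obtain ⟨c, hc, hle⟩ := hψ.toIsSoftTest.exists_mul_exp_le_response hψ.not_zero
  exact (mul_pos hc (exp_pos _)).trans_le (hle x)

lemma response_lt_one (hψ : IsProperTest ψ) (x : ℝ) : response ψ x < 1 := by
  linarith [hψ.one_sub.response_pos x, hψ.toIsSoftTest.response_one_sub x]

lemma integral_response_pos (hψ : IsProperTest ψ) [IsProbabilityMeasure μ] :
    0 < ∫ x, response ψ x ∂μ :=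
  hψ.toIsSoftTest.isSoftTest_response.integral_pos hψ.response_pos

lemma integral_response_lt_one (hψ : IsProperTest ψ) [IsProbabilityMeasure μ] :
    ∫ x, response ψ x ∂μ < 1 :=
  hψ.toIsSoftTest.isSoftTest_response.integral_lt_one hψ.response_lt_one

lemma integrable_log_response (hψ : IsProperTest ψ) [IsFiniteMeasure μ]
    (hμ : Integrable (fun x ↦ x ^ 2) μ) : Integrable (fun x ↦ log (response ψ x)) μ := by
  obtain ⟨c, hc, hle⟩ := hψ.toIsSoftTest.exists_mul_exp_le_response hψ.not_zero
  refine Integrable.mono' ((integrable_const |log c|).add hμ)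
    (hψ.toIsSoftTest.continuous_response.measurable.log.aestronglyMeasurable)
    (ae_of_all _ fun x ↦ ?_)
  have hlog := log_le_log (mul_pos hc (exp_pos _)) (hle x)
  rw [log_mul hc.ne' (exp_pos _).ne', log_exp] at hlog
  rw [Real.norm_eq_abs, abs_of_nonpos (log_nonpos (hψ.response_pos x).le (hψ.response_lt_one x).le),
    Pi.add_apply]
  linarith [neg_abs_le (log c)]

lemma integrable_log_one_sub_response (hψ : IsProperTest ψ) [IsFiniteMeasure μ]
    (hμ : Integrable (fun x ↦ x ^ 2) μ) : Integrable (fun x ↦ log (1 - response ψ x)) μ := by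
  simpa only [hψ.toIsSoftTest.response_one_sub] using hψ.one_sub.integrable_log_response hμ

end IsProperTest

lemma IsSoftTest.isProperTest_of_info_pos {ψ : ℝ → ℝ} {μ : Measure ℝ} [IsProbabilityMeasure μ]
    (hψ : IsSoftTest ψ) (h : 0 < info μ (response ψ)) : IsProperTest ψ where
  toIsSoftTest := hψ
  not_zero h0 := by
    rw [response_congr h0] at h
    simp [info, response] at h
  not_one h1 := by
    rw [response_congr h1] at h
    simp [info, response, integral_gaussPDF_sub] at h

/-! ### Mutual information as a convex functional of the channel -/

/-- The derivative of `binaryDivergence p q` in `p` at `p = f x`, where `q` is the average of `f`: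
the log-likelihood ratio of the two outputs on input `x`, relative to that of the output law. -/
def score {α : Type*} [MeasurableSpace α] (μ : Measure α) (f : α → ℝ) (x : α) : ℝ :=
  entropySlope (∫ x, f x ∂μ) - entropySlope (f x)

lemma mul_log_sub_mul_log_le {a b c e : ℝ} (ha : 0 ≤ a) (hb : 0 < b) (hc : 0 ≤ c) (he : 0 < e)
    (hca : c = 0 → a = 0) :
    a * log c - a * log e + a - b * c / e ≤ a * log a - a * log b := by
  rcases ha.eq_or_lt with rfl | ha
  · have : 0 ≤ b * c / e := by positivity
    simpa using this
  have hc : 0 < c := hc.lt_of_ne fun h ↦ ha.ne' (hca h.symm)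
  have hlog := log_le_sub_one_of_pos (x := b * c / (e * a)) (by positivity)
  rw [log_div (by positivity) (by positivity), log_mul hb.ne' hc.ne', log_mul he.ne' ha.ne'] at hlog
  have hmul := mul_le_mul_of_nonneg_left hlog ha.le
  have hcancel : a * (b * c / (e * a) - 1) = b * c / e - a := by field_simp
  linarith

/-- Joint convexity of the divergence, in first-order form. -/
lemma binaryDivergence_add_tangent_le {p q p' q' : ℝ} (hp0 : 0 < p) (hp1 : p < 1) (hq0 : 0 < q)
    (hq1 : q < 1) (hp0' : 0 ≤ p') (hp1' : p' ≤ 1) (hq0' : 0 ≤ q') (hq1' : q' ≤ 1)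
    (h0 : q' = 0 → p' = 0) (h1 : q' = 1 → p' = 1) :
    binaryDivergence p q + (p' - p) * (entropySlope q - entropySlope p) +
      (q - p) * ((q' - q) / (q * (1 - q))) ≤ binaryDivergence p' q' := by
  have hpos := mul_log_sub_mul_log_le hp0' hp0 hq0' hq0 h0
  have hneg := mul_log_sub_mul_log_le (sub_nonneg.2 hp1') (sub_pos.2 hp1) (sub_nonneg.2 hq1')
    (sub_pos.2 hq1) fun h ↦ by rw [h1 (by linarith), sub_self]
  have hlinear : (q - p) * ((q' - q) / (q * (1 - q))) =
      1 - p * q' / q - (1 - p) * (1 - q') / (1 - q) := by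
    have := (sub_pos.2 hq1).ne'
    field_simp
    ring
  simp only [hlinear, binaryDivergence, entropySlope, binEntropy, log_inv]
  linarith

/-- Mutual information lies above its tangents as a functional of the channel. -/
lemma info_add_integral_mul_score_le {α : Type*} [MeasurableSpace α] {μ : Measure α}
    [IsProbabilityMeasure μ] {f f' : α → ℝ} (hf : IsSoftTest f) (hf0 : ∀ x, 0 < f x)
    (hf1 : ∀ x, f x < 1) (hscore : Integrable (score μ f) μ) (hf' : IsSoftTest f') :
    info μ f + ∫ x, (f' x - f x) * score μ f x ∂μ ≤ info μ f' := by
  set q := ∫ x, f x ∂μ with hq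
  set q' := ∫ x, f' x ∂μ
  have hdivergence := hf.integrable_binaryDivergence (μ := μ) q
  have hfirst : Integrable (fun x ↦ (f' x - f x) * score μ f x) μ := by
    simp only [sub_mul]
    exact (hf'.integrable_mul hscore).sub (hf.integrable_mul hscore)
  have hsecond : Integrable (fun x ↦ q - f x) μ := (integrable_const q).sub hf.integrable
  calc info μ f + ∫ x, (f' x - f x) * score μ f x ∂μ
      = ∫ x, (binaryDivergence (f x) q + (f' x - f x) * score μ f x +
          (q - f x) * ((q' - q) / (q * (1 - q)))) ∂μ := by
        rw [integral_add (hdivergence.fun_add hfirst) (hsecond.mul_const _),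
          integral_add hdivergence hfirst, hf.integral_binaryDivergence_integral,
          integral_mul_const, integral_sub (integrable_const q) hf.integrable, integral_const,
          probReal_univ, one_smul, ← hq, sub_self, zero_mul, add_zero]
    _ ≤ ∫ x, binaryDivergence (f' x) q' ∂μ := by
        refine integral_mono_ae ((hdivergence.add hfirst).add (hsecond.mul_const _))
          (hf'.integrable_binaryDivergence q') ?_
        filter_upwards [hf'.ae_eq_zero_of_integral_eq_zero (μ := μ),
          hf'.ae_eq_one_of_integral_eq_one (μ := μ)] with x hx0 hx1
        exact binaryDivergence_add_tangent_le (hf0 x) (hf1 x) (hf.integral_pos hf0)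
          (hf.integral_lt_one hf1) (hf'.nonneg x) (hf'.le_one x) hf'.integral_nonneg
          hf'.integral_le_one hx0 hx1
    _ = info μ f' := hf'.integral_binaryDivergence_integral

lemma IsProperTest.integrable_score {ψ : ℝ → ℝ} (hψ : IsProperTest ψ) {μ : Measure ℝ}
    [IsProbabilityMeasure μ] (hμ : Integrable (fun x ↦ x ^ 2) μ) :
    Integrable (score μ (response ψ)) μ :=
  (integrable_const _).sub
    ((hψ.integrable_log_one_sub_response hμ).sub (hψ.integrable_log_response hμ))

/-! ### Optimal tests are deterministic -/

/-- The deterministic test that accepts exactly on the quantization region `D`. -/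
def hardTest (D : Set ℝ) : ℝ → ℝ := D.indicator fun _ ↦ 1

lemma hardTest_of_mem {D : Set ℝ} {y : ℝ} (hy : y ∈ D) : hardTest D y = 1 :=
  indicator_of_mem hy _

lemma hardTest_of_notMem {D : Set ℝ} {y : ℝ} (hy : y ∉ D) : hardTest D y = 0 :=
  indicator_of_notMem hy _

lemma isSoftTest_hardTest {D : Set ℝ} (hD : MeasurableSet D) : IsSoftTest (hardTest D) where
  measurable := measurable_const.indicator hD
  nonneg := indicator_nonneg fun _ _ ↦ zero_le_one
  le_one := indicator_le_self' fun _ _ ↦ zero_le_one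

lemma hardTest_compl (D : Set ℝ) : hardTest Dᶜ = fun y ↦ 1 - hardTest D y := by
  ext y
  by_cases hy : y ∈ D <;> simp [hardTest, hy]

lemma IsProperTest.volume_ne_zero {D : Set ℝ} (hD : IsProperTest (hardTest D)) :
    volume D ≠ 0 := fun h ↦ hD.not_zero <| by
  filter_upwards [measure_eq_zero_iff_ae_notMem.1 h] with y hy using hardTest_of_notMem hy

lemma IsProperTest.volume_compl_ne_zero {D : Set ℝ} (hD : IsProperTest (hardTest D)) :
    volume Dᶜ ≠ 0 :=
  IsProperTest.volume_ne_zero (hardTest_compl D ▸ hD.one_sub)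

/-- The score averaged over the inputs, weighted by the likelihood of the observation `y`: the
derivative of the information with respect to the value of the test at `y`. -/
def smoothedScore (μ : Measure ℝ) (f : ℝ → ℝ) (y : ℝ) : ℝ :=
  ∫ x, score μ f x * gaussPDF (y - x) ∂μ

section GaussianSmoothing

variable {μ : Measure ℝ} {s : ℝ → ℝ}

lemma integrable_mul_gaussPDF_sub (hs : Integrable s μ) (y : ℝ) :
    Integrable (fun x ↦ s x * gaussPDF (y - x)) μ := by
  refine hs.mul_bdd (c := 1) (by fun_prop) (ae_of_all _ fun x ↦ ?_)
  rw [norm_eq_abs, abs_of_pos (gaussPDF_pos _)]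
  exact gaussPDF_le_one _

lemma continuous_integral_mul_gaussPDF_sub (hs : Integrable s μ) :
    Continuous fun y ↦ ∫ x, s x * gaussPDF (y - x) ∂μ := by
  refine continuous_of_dominated (fun y ↦ (integrable_mul_gaussPDF_sub hs y).aestronglyMeasurable)
    (bound := fun x ↦ |s x|) (fun y ↦ ae_of_all _ fun x ↦ ?_) hs.abs
    (ae_of_all _ fun x ↦ by fun_prop)
  rw [norm_eq_abs, abs_mul, abs_of_pos (gaussPDF_pos _)]
  exact mul_le_of_le_one_right (abs_nonneg _) (gaussPDF_le_one _)

lemma integrable_prod_mul_gaussPDF (hs : Integrable s μ) :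
    Integrable (fun w : ℝ × ℝ ↦ s w.1 * gaussPDF (w.2 - w.1)) (μ.prod volume) := by
  have hmeas : AEStronglyMeasurable (fun w : ℝ × ℝ ↦ s w.1 * gaussPDF (w.2 - w.1))
      (μ.prod volume) :=
    hs.aestronglyMeasurable.comp_fst.mul
      (continuous_gaussPDF.comp (continuous_snd.sub continuous_fst)).aestronglyMeasurable
  have hmass : (fun x ↦ ∫ y, ‖s x * gaussPDF (y - x)‖) = fun x ↦ ‖s x‖ := by
    ext x
    simp only [norm_mul, integral_const_mul, norm_eq_abs, abs_of_pos (gaussPDF_pos _),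
      integral_gaussPDF_sub, mul_one]
  exact (integrable_prod_iff hmeas).2
    ⟨ae_of_all _ fun x ↦ (integrable_gaussPDF_sub x).const_mul (s x), hmass ▸ hs.norm⟩

variable [SFinite μ]

lemma integrable_integral_mul_gaussPDF_sub (hs : Integrable s μ) :
    Integrable fun y ↦ ∫ x, s x * gaussPDF (y - x) ∂μ :=
  (integrable_prod_mul_gaussPDF hs).integral_prod_right

lemma IsSoftTest.integral_response_mul {ψ : ℝ → ℝ} (hψ : IsSoftTest ψ) (hs : Integrable s μ) :
    ∫ x, response ψ x * s x ∂μ = ∫ y, ψ y * ∫ x, s x * gaussPDF (y - x) ∂μ := by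
  have h : Integrable (fun w : ℝ × ℝ ↦ ψ w.2 * (s w.1 * gaussPDF (w.2 - w.1))) (μ.prod volume) :=
    (integrable_prod_mul_gaussPDF hs).bdd_mul (c := 1)
      (hψ.measurable.comp measurable_snd).aestronglyMeasurable
      (ae_of_all _ fun w ↦ hψ.norm_le_one w.2)
  simp only [← integral_const_mul]
  rw [← integral_integral_swap (f := fun x y ↦ ψ y * (s x * gaussPDF (y - x))) h]
  refine integral_congr_ae (ae_of_all _ fun x ↦ ?_)
  simp only [response, ← integral_mul_const]
  exact integral_congr_ae (ae_of_all _ fun y ↦ by ring)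

end GaussianSmoothing

lemma hardTest_sub_mul_nonneg {ψ : ℝ → ℝ} (hψ : IsSoftTest ψ) (g : ℝ → ℝ) (y : ℝ) :
    0 ≤ (hardTest {y | 0 < g y} y - ψ y) * g y := by
  by_cases hy : 0 < g y
  · rw [hardTest_of_mem (D := {y | 0 < g y}) hy]
    exact mul_nonneg (sub_nonneg.2 (hψ.le_one y)) hy.le
  · rw [hardTest_of_notMem (D := {y | 0 < g y}) hy, zero_sub]
    exact mul_nonneg_of_nonpos_of_nonpos (neg_nonpos.2 (hψ.nonneg y)) (not_lt.1 hy)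

namespace IsProperTest

variable {μ : Measure ℝ} [IsProbabilityMeasure μ] {ψ ψ' : ℝ → ℝ}

lemma integrable_smoothedScore (hψ : IsProperTest ψ) (hμ : Integrable (fun x ↦ x ^ 2) μ) :
    Integrable (smoothedScore μ (response ψ)) :=
  integrable_integral_mul_gaussPDF_sub (hψ.integrable_score hμ)

lemma continuous_smoothedScore (hψ : IsProperTest ψ) (hμ : Integrable (fun x ↦ x ^ 2) μ) :
    Continuous (smoothedScore μ (response ψ)) :=
  continuous_integral_mul_gaussPDF_sub (hψ.integrable_score hμ)

lemma measurableSet_smoothedScore_pos (hψ : IsProperTest ψ) (hμ : Integrable (fun x ↦ x ^ 2) μ) :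
    MeasurableSet {y | 0 < smoothedScore μ (response ψ) y} :=
  (isOpen_lt continuous_const (hψ.continuous_smoothedScore hμ)).measurableSet

lemma info_response_add_le (hψ : IsProperTest ψ) (hμ : Integrable (fun x ↦ x ^ 2) μ)
    (hψ' : IsSoftTest ψ') :
    info μ (response ψ) + ∫ y, (ψ' y - ψ y) * smoothedScore μ (response ψ) y ≤
      info μ (response ψ') := by
  have hs := hψ.integrable_score hμ
  have hg := hψ.integrable_smoothedScore hμ
  have hf := hψ.isSoftTest_response
  have h := info_add_integral_mul_score_le hf hψ.response_pos hψ.response_lt_one hs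
    hψ'.isSoftTest_response
  simp only [sub_mul] at h ⊢
  rw [integral_sub (hψ'.isSoftTest_response.integrable_mul hs) (hf.integrable_mul hs),
    hψ'.integral_response_mul hs, hψ.integral_response_mul hs] at h
  rwa [integral_sub (hψ'.integrable_mul hg) (hψ.integrable_mul hg)]

lemma info_le_info_hardTest (hψ : IsProperTest ψ) (hμ : Integrable (fun x ↦ x ^ 2) μ) :
    info μ (response ψ) ≤
      info μ (response (hardTest {y | 0 < smoothedScore μ (response ψ) y})) :=
  (le_add_of_nonneg_right (integral_nonneg (hardTest_sub_mul_nonneg hψ.toIsSoftTest _))).trans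
    (hψ.info_response_add_le hμ (isSoftTest_hardTest (hψ.measurableSet_smoothedScore_pos hμ)))

lemma ae_eq_zero_of_info_hardTest_le (hψ : IsProperTest ψ) (hμ : Integrable (fun x ↦ x ^ 2) μ)
    (hle : info μ (response (hardTest {y | 0 < smoothedScore μ (response ψ) y})) ≤
      info μ (response ψ)) :
    ∀ᵐ y, (hardTest {y | 0 < smoothedScore μ (response ψ) y} y - ψ y) *
      smoothedScore μ (response ψ) y = 0 := by
  have hD := isSoftTest_hardTest (hψ.measurableSet_smoothedScore_pos hμ)
  have hnonneg := hardTest_sub_mul_nonneg hψ.toIsSoftTest (smoothedScore μ (response ψ))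
  have hg := hψ.integrable_smoothedScore hμ
  have hint : Integrable fun y ↦ (hardTest {y | 0 < smoothedScore μ (response ψ) y} y - ψ y) *
      smoothedScore μ (response ψ) y := by
    simp only [sub_mul]
    exact (hD.integrable_mul hg).sub (hψ.integrable_mul hg)
  refine (integral_eq_zero_iff_of_nonneg hnonneg hint).1 (le_antisymm ?_ (integral_nonneg hnonneg))
  linarith [hψ.info_response_add_le hμ hD]

lemma exists_info_lt_info_hardTest (hψ : IsProperTest ψ) (hμ : Integrable (fun x ↦ x ^ 2) μ)
    (h0 : ∀ y, 0 < ψ y) (h1 : ∀ y, ψ y < 1) (hpos : 0 < info μ (response ψ)) :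
    ∃ D, MeasurableSet D ∧ info μ (response ψ) < info μ (response (hardTest D)) := by
  refine ⟨_, hψ.measurableSet_smoothedScore_pos hμ, lt_of_not_ge fun hle ↦ ?_⟩
  have hzero : ∀ᵐ y, smoothedScore μ (response ψ) y = 0 := by
    filter_upwards [hψ.ae_eq_zero_of_info_hardTest_le hμ hle] with y hy
    refine (mul_eq_zero.1 hy).resolve_left (sub_ne_zero.2 ?_)
    by_cases hy' : 0 < smoothedScore μ (response ψ) y
    · rw [hardTest_of_mem (D := {y | 0 < smoothedScore μ (response ψ) y}) hy']
      exact (h1 y).ne'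
    · rw [hardTest_of_notMem (D := {y | 0 < smoothedScore μ (response ψ) y}) hy']
      exact (h0 y).ne
  -- The information is convex with vanishing derivative at `ψ`, so `ψ` is a global minimum.
  have hle_empty := hψ.info_response_add_le hμ (isSoftTest_hardTest MeasurableSet.empty)
  have hint : ∫ y, (hardTest ∅ y - ψ y) * smoothedScore μ (response ψ) y = 0 :=
    integral_eq_zero_of_ae (by filter_upwards [hzero] with y hy; simp [hy])
  have hempty : info μ (response (hardTest ∅)) = 0 := by simp [info, response, hardTest]
  rw [hint, hempty, add_zero] at hle_empty
  exact hpos.not_ge hle_empty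

end IsProperTest

/-! ### Scaling and amplification -/

lemma crossover_eq_gaussianReal (σ : ℝ≥0) {D : Set ℝ} (hD : MeasurableSet D) (x : ℝ) :
    crossover σ D x = (gaussianReal x (σ ^ 2)).real D := by
  have h := gaussianReal_map_const_add (μ := 0) (v := σ ^ 2) x
  rw [zero_add] at h
  rw [crossover, ← h, map_measureReal_apply (measurable_const_add x) hD]
  rfl

lemma response_hardTest {D : Set ℝ} (hD : MeasurableSet D) (x : ℝ) :
    response (hardTest D) x = (gaussianReal x 1).real D := by
  rw [response_eq_integral_gaussianReal, hardTest, integral_indicator_const _ hD, smul_eq_mul,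
    mul_one]

lemma crossover_eq_response {σ : ℝ≥0} (hσ : σ ≠ 0) {D : Set ℝ} (hD : MeasurableSet D) (x : ℝ) :
    crossover σ D x = response (hardTest {y | (σ : ℝ) * y ∈ D}) (x / σ) := by
  have hpreimage : MeasurableSet {y : ℝ | (σ : ℝ) * y ∈ D} := (measurable_const_mul (σ : ℝ)) hD
  have hmap : gaussianReal x (σ ^ 2) = (gaussianReal (x / σ) 1).map ((σ : ℝ) * ·) := by
    rw [gaussianReal_map_const_mul, mul_div_cancel₀ x (NNReal.coe_ne_zero.2 hσ)]
    congr 1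
    ext
    simp
  rw [response_hardTest hpreimage, crossover_eq_gaussianReal _ hD, hmap,
    map_measureReal_apply (measurable_const_mul _) hD]
  rfl

lemma integral_crossover_gaussianReal (x : ℝ) (v τ : ℝ≥0) {D : Set ℝ} (hD : MeasurableSet D) :
    ∫ u, crossover τ D u ∂(gaussianReal x v) = (gaussianReal x (v + τ ^ 2)).real D := by
  have hconv := gaussianReal_conv_gaussianReal (m₁ := x) (m₂ := 0) (v₁ := v) (v₂ := τ ^ 2)
  have hpreimage : MeasurableSet ((fun w : ℝ × ℝ ↦ w.1 + w.2) ⁻¹' D) :=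
    (measurable_fst.add measurable_snd) hD
  rw [add_zero] at hconv
  rw [← hconv, measureReal_def, Measure.conv, Measure.map_apply (by fun_prop) hD,
    Measure.prod_apply hpreimage, ← integral_toReal
      (measurable_measure_prodMk_left hpreimage).aemeasurable
      (ae_of_all _ fun _ ↦ measure_lt_top _ _)]
  rfl

lemma crossover_pos {τ : ℝ≥0} (hτ : τ ≠ 0) {D : Set ℝ} (hD : MeasurableSet D)
    (h : volume D ≠ 0) (u : ℝ) : 0 < crossover τ D u := by
  rw [crossover_eq_gaussianReal _ hD]
  refine ENNReal.toReal_pos (fun h' ↦ h ?_) (measure_ne_top _ _)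
  exact gaussianReal_absolutelyContinuous' u (pow_ne_zero 2 hτ) h'

lemma crossover_lt_one {τ : ℝ≥0} (hτ : τ ≠ 0) {D : Set ℝ} (hD : MeasurableSet D)
    (h : volume Dᶜ ≠ 0) (u : ℝ) : crossover τ D u < 1 := by
  have hpos := crossover_pos hτ hD.compl h u
  rw [crossover_eq_gaussianReal _ hD.compl, probReal_compl_eq_one_sub hD,
    ← crossover_eq_gaussianReal _ hD] at hpos
  exact sub_pos.1 hpos

lemma response_crossover_div {s : ℝ} (hs : s ≠ 0) {τ : ℝ≥0} (hτ : (s ^ 2)⁻¹ + (τ : ℝ) ^ 2 = 1)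
    {D : Set ℝ} (hD : MeasurableSet D) (x : ℝ) :
    response (fun y ↦ crossover τ D (y / s)) (s * x) = response (hardTest D) x := by
  have hmap := gaussianReal_map_div_const (μ := s * x) (v := 1) s
  rw [mul_div_cancel_left₀ _ hs] at hmap
  rw [response_eq_integral_gaussianReal, response_hardTest hD,
    ← integral_map (φ := fun y ↦ y / s) (f := crossover τ D) (by fun_prop)
      (isSoftTest_crossover τ hD).measurable.aestronglyMeasurable,
    hmap, integral_crossover_gaussianReal _ _ _ hD]
  congr 2
  ext
  push_cast
  rw [one_div]
  exact hτ

lemma info_map {α β : Type*} [MeasurableSpace α] [MeasurableSpace β] {μ : Measure α} {T : α → β}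
    {f : β → ℝ} (hT : Measurable T) (hf : Measurable f) :
    info (μ.map T) f = info μ fun x ↦ f (T x) := by
  rw [info, info, integral_map hT.aemeasurable hf.aestronglyMeasurable,
    integral_map hT.aemeasurable (by fun_prop)]

lemma integrable_sq_map_mul {μ : Measure ℝ} (hμ : Integrable (fun x ↦ x ^ 2) μ) (s : ℝ) :
    Integrable (fun x ↦ x ^ 2) (μ.map (s * ·)) := by
  rw [integrable_map_measure (by fun_prop) (by fun_prop)]
  simp only [Function.comp_def, mul_pow]
  exact hμ.const_mul _

-- A quieter channel can be degraded by extra noise to the original one, but the degraded test is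
-- nowhere deterministic, so a hard test beats it.
lemma exists_info_lt_info_map_mul {μ : Measure ℝ} [IsProbabilityMeasure μ]
    (hμ : Integrable (fun x ↦ x ^ 2) μ) {D : Set ℝ} (hD : MeasurableSet D)
    (hpos : 0 < info μ (response (hardTest D))) {s : ℝ} (hs : 1 < s) :
    ∃ D', MeasurableSet D' ∧
      info μ (response (hardTest D)) < info (μ.map (s * ·)) (response (hardTest D')) := by
  have hs0 : s ≠ 0 := (one_pos.trans hs).ne'
  have hproper := (isSoftTest_hardTest hD).isProperTest_of_info_pos hpos
  have hnoise : 0 < 1 - (s ^ 2)⁻¹ := sub_pos.2 (inv_lt_one_of_one_lt₀ (one_lt_pow₀ hs two_ne_zero))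
  let τ : ℝ≥0 := ⟨√(1 - (s ^ 2)⁻¹), sqrt_nonneg _⟩
  have hτ : τ ≠ 0 := NNReal.coe_ne_zero.1 (sqrt_pos.2 hnoise).ne'
  have hτs : (s ^ 2)⁻¹ + (τ : ℝ) ^ 2 = 1 := by
    rw [show (τ : ℝ) ^ 2 = 1 - (s ^ 2)⁻¹ from sq_sqrt hnoise.le, add_sub_cancel]
  let ψ : ℝ → ℝ := fun y ↦ crossover τ D (y / s)
  have hψ : IsSoftTest ψ :=
    have hc := isSoftTest_crossover τ hD
    ⟨hc.measurable.comp (measurable_id.div_const s), fun _ ↦ hc.nonneg _, fun _ ↦ hc.le_one _⟩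
  have : IsProbabilityMeasure (μ.map (s * ·)) := Measure.isProbabilityMeasure_map (by fun_prop)
  have hinfo : info (μ.map (s * ·)) (response ψ) = info μ (response (hardTest D)) := by
    rw [info_map (measurable_const_mul s) hψ.continuous_response.measurable]
    simp only [ψ, response_crossover_div hs0 hτs hD]
  rw [← hinfo] at hpos ⊢
  exact (hψ.isProperTest_of_info_pos hpos).exists_info_lt_info_hardTest
    (integrable_sq_map_mul hμ s) (fun y ↦ crossover_pos hτ hD hproper.volume_ne_zero _)
    (fun y ↦ crossover_lt_one hτ hD hproper.volume_compl_ne_zero _) hpos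

/-! ### Admissible inputs and optimal pairs -/

section Admissible

variable {P : ℝ} {μ : Measure ℝ}

lemma IsAdmissibleInput.integrable_sq (h : IsAdmissibleInput P μ) :
    Integrable (fun x ↦ x ^ 2) μ :=
  (lintegral_ofReal_ne_top_iff_integrable (by fun_prop) (ae_of_all _ fun x ↦ sq_nonneg x)).1
    (h.power_le.trans_lt ENNReal.ofReal_lt_top).ne

lemma IsAdmissibleInput.integral_sq_le (h : IsAdmissibleInput P μ) (hP : 0 ≤ P) :
    ∫ x, x ^ 2 ∂μ ≤ P := by
  have hle := h.power_le
  rw [← ofReal_integral_eq_lintegral_ofReal h.integrable_sq (ae_of_all _ fun x ↦ sq_nonneg x)]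
    at hle
  exact (ENNReal.ofReal_le_ofReal_iff hP).1 hle

lemma isAdmissibleInput_of_integral_sq_le [IsProbabilityMeasure μ]
    (hμ : Integrable (fun x ↦ x ^ 2) μ) (h : ∫ x, x ^ 2 ∂μ ≤ P) : IsAdmissibleInput P μ where
  isProbabilityMeasure := inferInstance
  power_le := by
    rw [← ofReal_integral_eq_lintegral_ofReal hμ (ae_of_all _ fun x ↦ sq_nonneg x)]
    exact ENNReal.ofReal_le_ofReal h

lemma IsAdmissibleInput.map_mul (h : IsAdmissibleInput P μ) (c : ℝ) :
    IsAdmissibleInput (c ^ 2 * P) (μ.map (c * ·)) where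
  isProbabilityMeasure :=
    have := h.isProbabilityMeasure
    Measure.isProbabilityMeasure_map (by fun_prop)
  power_le := by
    rw [lintegral_map (by fun_prop) (by fun_prop), ENNReal.ofReal_mul (sq_nonneg c)]
    simp only [mul_pow, ENNReal.ofReal_mul (sq_nonneg c)]
    rw [lintegral_const_mul _ (by fun_prop)]
    exact mul_le_mul_right h.power_le _

lemma memLp_two_id (hμ : Integrable (fun x ↦ x ^ 2) μ) : MemLp (fun x ↦ x) 2 μ :=
  (memLp_two_iff_integrable_sq aestronglyMeasurable_id).2 hμ

lemma integrable_id_of_integrable_sq [IsFiniteMeasure μ] (hμ : Integrable (fun x ↦ x ^ 2) μ) :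
    Integrable (fun x ↦ x) μ :=
  (memLp_two_id hμ).integrable one_le_two

lemma isAdmissibleInput_map_sub [IsProbabilityMeasure μ] (hμ : Integrable (fun x ↦ x ^ 2) μ)
    {m : ℝ} (h : ∫ x, (x - m) ^ 2 ∂μ ≤ P) : IsAdmissibleInput P (μ.map (· - m)) := by
  have : IsProbabilityMeasure (μ.map (· - m)) := Measure.isProbabilityMeasure_map (by fun_prop)
  refine isAdmissibleInput_of_integral_sq_le ?_ ?_
  · rw [integrable_map_measure (by fun_prop) (by fun_prop)]
    exact ((memLp_two_id hμ).sub (memLp_const m)).integrable_sq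
  · rwa [integral_map (by fun_prop) (by fun_prop)]

lemma integral_sub_integral_sq [IsProbabilityMeasure μ] (hμ : Integrable (fun x ↦ x ^ 2) μ) :
    ∫ x, (x - ∫ y, y ∂μ) ^ 2 ∂μ = ∫ x, x ^ 2 ∂μ - (∫ x, x ∂μ) ^ 2 := by
  rw [← variance_eq_integral aemeasurable_id', variance_eq_sub (memLp_two_id hμ)]
  rfl

lemma integral_two_point {p : ℝ} (hp0 : 0 ≤ p) (hp1 : p ≤ 1) (a b : ℝ) (u : ℝ → ℝ) :
    ∫ x, u x ∂(ENNReal.ofReal p • Measure.dirac a + ENNReal.ofReal (1 - p) • Measure.dirac b) =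
      p * u a + (1 - p) * u b := by
  have hu (c : ℝ) : Integrable u (Measure.dirac c) := integrable_dirac enorm_lt_top
  rw [integral_add_measure ((hu a).smul_measure ENNReal.ofReal_ne_top)
    ((hu b).smul_measure ENNReal.ofReal_ne_top), integral_smul_measure, integral_smul_measure,
    integral_dirac, integral_dirac, ENNReal.toReal_ofReal hp0,
    ENNReal.toReal_ofReal (sub_nonneg.2 hp1), smul_eq_mul, smul_eq_mul]

lemma isAdmissibleInput_two_point {p : ℝ} (hp0 : 0 ≤ p) (hp1 : p ≤ 1) {a b : ℝ}
    (h : p * a ^ 2 + (1 - p) * b ^ 2 ≤ P) :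
    IsAdmissibleInput P
      (ENNReal.ofReal p • Measure.dirac a + ENNReal.ofReal (1 - p) • Measure.dirac b) where
  isProbabilityMeasure := ⟨by
    simp only [Measure.coe_add, Measure.coe_smul, Pi.add_apply, Pi.smul_apply, measure_univ,
      smul_eq_mul, mul_one]
    rw [← ENNReal.ofReal_add hp0 (sub_nonneg.2 hp1), add_sub_cancel, ENNReal.ofReal_one]⟩
  power_le := by
    rw [lintegral_add_measure, lintegral_smul_measure, lintegral_smul_measure, lintegral_dirac,
      lintegral_dirac, smul_eq_mul, smul_eq_mul, ← ENNReal.ofReal_mul hp0,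
      ← ENNReal.ofReal_mul (sub_nonneg.2 hp1), ← ENNReal.ofReal_add (by positivity)
        (mul_nonneg (sub_nonneg.2 hp1) (sq_nonneg _))]
    exact ENNReal.ofReal_le_ofReal h

end Admissible

lemma response_hardTest_preimage_add (D : Set ℝ) (m x : ℝ) :
    response (hardTest {y | y + m ∈ D}) (x - m) = response (hardTest D) x := by
  simp only [response]
  rw [← integral_add_right_eq_self (fun y ↦ hardTest D y * gaussPDF (y - x)) m]
  refine integral_congr_ae (ae_of_all _ fun y ↦ ?_)
  simp only [sub_sub_eq_add_sub]
  rfl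

lemma exists_response_hardTest_ne {a b : ℝ} (hab : a ≠ b) :
    ∃ D, MeasurableSet D ∧ response (hardTest D) a ≠ response (hardTest D) b := by
  by_contra! hcon
  refine hab (gaussianReal_ext_iff.1 (Measure.ext fun D hD ↦ ?_) : a = b ∧ (1 : ℝ≥0) = 1).1
  have heq := hcon D hD
  rw [response_hardTest hD, response_hardTest hD] at heq
  exact (measureReal_eq_measureReal_iff).1 heq

lemma nonneg_of_ae_nonneg_of_mem_closure {g : ℝ → ℝ} (hg : Continuous g) {U : Set ℝ}
    (hU : IsOpen U) (h : ∀ᵐ y, y ∈ U → 0 ≤ g y) {y : ℝ} (hy : y ∈ closure U) : 0 ≤ g y := by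
  have hmin : EqOn (fun y ↦ min (g y) 0) 0 U :=
    Measure.eqOn_open_of_ae_eq ((ae_restrict_iff' hU.measurableSet).2
      (h.mono fun y hy hyU ↦ min_eq_right (hy hyU))) hU (by fun_prop) (by fun_prop)
  exact closure_minimal (fun y hy ↦ min_eq_right_iff.1 (hmin hy))
    (isClosed_le continuous_const hg) hy

/-- The input law `μ` and the region `D` attain the capacity in unit-variance noise. -/
structure IsOptimal (P : ℝ) (μ : Measure ℝ) (D : Set ℝ) : Prop where
  isAdmissibleInput : IsAdmissibleInput P μ
  measurableSet : MeasurableSet D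
  info_le : ∀ μ', IsAdmissibleInput P μ' → ∀ D', MeasurableSet D' →
    info μ' (response (hardTest D')) ≤ info μ (response (hardTest D))

namespace IsOptimal

variable {P : ℝ} {μ : Measure ℝ} {D : Set ℝ}

lemma isProbabilityMeasure (h : IsOptimal P μ D) : IsProbabilityMeasure μ :=
  h.isAdmissibleInput.isProbabilityMeasure

lemma integrable_sq (h : IsOptimal P μ D) : Integrable (fun x ↦ x ^ 2) μ :=
  h.isAdmissibleInput.integrable_sq

lemma isSoftTest (h : IsOptimal P μ D) : IsSoftTest (hardTest D) :=
  isSoftTest_hardTest h.measurableSet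

lemma of_info_eq (h : IsOptimal P μ D) {μ' : Measure ℝ} {D' : Set ℝ}
    (hμ' : IsAdmissibleInput P μ') (hD' : MeasurableSet D')
    (heq : info μ' (response (hardTest D')) = info μ (response (hardTest D))) :
    IsOptimal P μ' D' :=
  ⟨hμ', hD', fun μ'' h'' D'' hD'' ↦ heq ▸ h.info_le μ'' h'' D'' hD''⟩

lemma congr_ae (h : IsOptimal P μ D) {D' : Set ℝ} (hD' : MeasurableSet D')
    (heq : D =ᵐ[volume] D') : IsOptimal P μ D' := by
  have hae : hardTest D =ᵐ[volume] hardTest D' := indicator_ae_eq_of_ae_eq_set heq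
  exact h.of_info_eq h.isAdmissibleInput hD' (by rw [response_congr hae])

lemma compl (h : IsOptimal P μ D) : IsOptimal P μ Dᶜ := by
  have := h.isProbabilityMeasure
  refine h.of_info_eq h.isAdmissibleInput h.measurableSet.compl ?_
  have hresponse : response (hardTest Dᶜ) = fun x ↦ 1 - response (hardTest D) x := by
    rw [hardTest_compl]
    exact funext h.isSoftTest.response_one_sub
  rw [info, info, hresponse, h.isSoftTest.isSoftTest_response.integral_one_sub]
  simp only [binEntropy_one_sub]

lemma info_pos (h : IsOptimal P μ D) (hP : 0 < P) : 0 < info μ (response (hardTest D)) := by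
  obtain ⟨E, hE, hne⟩ := exists_response_hardTest_ne (self_ne_neg.2 (sqrt_pos.2 hP).ne')
  have hadm := isAdmissibleInput_two_point (P := P) (p := 1 / 2) (a := √P) (b := -√P)
    (by norm_num) (by norm_num) (by rw [neg_sq, sq_sqrt hP.le]; linarith)
  refine lt_of_lt_of_le ?_ (h.info_le _ hadm E hE)
  rw [info, integral_two_point (by norm_num) (by norm_num),
    integral_two_point (by norm_num) (by norm_num)]
  have hE' := (isSoftTest_hardTest hE).isSoftTest_response
  have hconcave := strictConcave_binEntropy.2 ⟨hE'.nonneg √P, hE'.le_one √P⟩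
    ⟨hE'.nonneg (-√P), hE'.le_one (-√P)⟩ hne (show (0 : ℝ) < 1 / 2 by norm_num)
    (show (0 : ℝ) < 1 - 1 / 2 by norm_num) (by norm_num)
  simp only [smul_eq_mul] at hconcave
  linarith

lemma isProperTest (h : IsOptimal P μ D) (hP : 0 < P) : IsProperTest (hardTest D) := by
  have := h.isProbabilityMeasure
  exact h.isSoftTest.isProperTest_of_info_pos (h.info_pos hP)

lemma integral_sq (h : IsOptimal P μ D) (hP : 0 < P) : ∫ x, x ^ 2 ∂μ = P := by
  have := h.isProbabilityMeasure
  refine (h.isAdmissibleInput.integral_sq_le hP.le).eq_of_not_lt fun hlt ↦ ?_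
  obtain ⟨s, hs, hsP⟩ : ∃ s : ℝ, 1 < s ∧ s ^ 2 * ∫ x, x ^ 2 ∂μ ≤ P := by
    rcases (integral_nonneg fun x ↦ sq_nonneg x : 0 ≤ ∫ x, x ^ 2 ∂μ).eq_or_lt with h0 | h0
    · exact ⟨2, one_lt_two, by rw [← h0, mul_zero]; exact hP.le⟩
    · refine ⟨√(P / ∫ x, x ^ 2 ∂μ), ?_, ?_⟩
      · rwa [lt_sqrt zero_le_one, one_pow, one_lt_div h0]
      · rw [sq_sqrt (by positivity), div_mul_cancel₀ _ h0.ne']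
  obtain ⟨D', hD', hlt'⟩ :=
    exists_info_lt_info_map_mul h.integrable_sq h.measurableSet (h.info_pos hP) hs
  have : IsProbabilityMeasure (μ.map (s * ·)) := Measure.isProbabilityMeasure_map (by fun_prop)
  refine hlt'.not_ge (h.info_le _ (isAdmissibleInput_of_integral_sq_le
    (integrable_sq_map_mul h.integrable_sq s) ?_) D' hD')
  rw [integral_map (by fun_prop) (by fun_prop)]
  simp only [mul_pow]
  rwa [integral_const_mul]

lemma integral_id (h : IsOptimal P μ D) (hP : 0 < P) : ∫ x, x ∂μ = 0 := by
  have := h.isProbabilityMeasure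
  set m := ∫ x, x ∂μ
  have hvar : ∫ x, (x - m) ^ 2 ∂μ = P - m ^ 2 :=
    (integral_sub_integral_sq h.integrable_sq).trans (by rw [h.integral_sq hP])
  have hadm : IsAdmissibleInput P (μ.map (· - m)) :=
    isAdmissibleInput_map_sub h.integrable_sq (hvar.trans_le (sub_le_self _ (sq_nonneg m)))
  have hD' : MeasurableSet {y | y + m ∈ D} := (measurable_add_const m) h.measurableSet
  have hopt : IsOptimal P (μ.map (· - m)) {y | y + m ∈ D} := by
    refine h.of_info_eq hadm hD' ?_
    rw [info_map (by fun_prop) (isSoftTest_hardTest hD').continuous_response.measurable]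
    simp only [response_hardTest_preimage_add]
  have hsq := hopt.integral_sq hP
  rw [integral_map (by fun_prop) (by fun_prop), hvar, sub_eq_self] at hsq
  exact pow_eq_zero_iff two_ne_zero |>.1 hsq

lemma continuous_smoothedScore (h : IsOptimal P μ D) (hP : 0 < P) :
    Continuous (smoothedScore μ (response (hardTest D))) :=
  have := h.isProbabilityMeasure
  (h.isProperTest hP).continuous_smoothedScore h.integrable_sq

lemma ae_sign_smoothedScore (h : IsOptimal P μ D) (hP : 0 < P) :
    ∀ᵐ y, (y ∈ D → 0 ≤ smoothedScore μ (response (hardTest D)) y) ∧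
      (y ∉ D → smoothedScore μ (response (hardTest D)) y ≤ 0) := by
  have := h.isProbabilityMeasure
  have hproper := h.isProperTest hP
  filter_upwards [hproper.ae_eq_zero_of_info_hardTest_le h.integrable_sq
    (h.info_le _ h.isAdmissibleInput _ (hproper.measurableSet_smoothedScore_pos h.integrable_sq))]
    with y hy
  refine ⟨fun hyD ↦ not_lt.1 fun hneg ↦ hneg.ne ?_, fun hyD ↦ not_lt.1 fun hpos ↦ hpos.ne' ?_⟩
  · have hyE : y ∉ {z | 0 < smoothedScore μ (response (hardTest D)) z} := hneg.not_gt
    rw [hardTest_of_mem hyD, hardTest_of_notMem hyE] at hy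
    simpa using hy
  · have hyE : y ∈ {z | 0 < smoothedScore μ (response (hardTest D)) z} := hpos
    rw [hardTest_of_notMem hyD, hardTest_of_mem hyE] at hy
    simpa using hy

lemma smoothedScore_nonneg (h : IsOptimal P μ D) (hP : 0 < P) {y : ℝ}
    (hy : y ∈ closure (interior D)) : 0 ≤ smoothedScore μ (response (hardTest D)) y :=
  nonneg_of_ae_nonneg_of_mem_closure (h.continuous_smoothedScore hP) isOpen_interior
    ((h.ae_sign_smoothedScore hP).mono fun _ hz hzD ↦ hz.1 (interior_subset hzD)) hy

lemma smoothedScore_nonpos (h : IsOptimal P μ D) (hP : 0 < P) {y : ℝ}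
    (hy : y ∈ closure (interior Dᶜ)) : smoothedScore μ (response (hardTest D)) y ≤ 0 :=
  neg_nonneg.1 <| nonneg_of_ae_nonneg_of_mem_closure (h.continuous_smoothedScore hP).neg
    isOpen_interior ((h.ae_sign_smoothedScore hP).mono fun _ hz hzD ↦
      neg_nonneg.2 (hz.2 (interior_subset hzD))) hy

lemma smoothedScore_eq_zero (h : IsOptimal P μ D) (hP : 0 < P) {y : ℝ}
    (hy : y ∈ closure (interior D)) (hy' : y ∈ closure (interior Dᶜ)) :
    smoothedScore μ (response (hardTest D)) y = 0 :=
  le_antisymm (h.smoothedScore_nonpos hP hy') (h.smoothedScore_nonneg hP hy)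

end IsOptimal

/-! ### Neutral reweightings of the input law -/

section Span

variable {μ : Measure ℝ}

lemma integrable_boundedContinuousFunction_mul (w : ℝ →ᵇ ℝ) {u : ℝ → ℝ} (hu : Integrable u μ) :
    Integrable (fun x ↦ w x * u x) μ :=
  hu.bdd_mul (c := ‖w‖) w.continuous.aestronglyMeasurable (ae_of_all _ w.norm_coe_le_norm)

lemma ae_eq_zero_of_forall_integral_mul_eq_zero {u : ℝ → ℝ} (hu : Integrable u μ)
    (h : ∀ w : ℝ →ᵇ ℝ, ∫ x, w x * u x ∂μ = 0) : ∀ᵐ x ∂μ, u x = 0 := by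
  refine ae_eq_zero_of_integral_contDiff_smul_eq_zero hu.locallyIntegrable fun g hg hg_supp ↦ ?_
  obtain ⟨C, hC⟩ := hg_supp.exists_bound_of_continuous hg.continuous
  exact h (BoundedContinuousFunction.ofNormedAddCommGroup g hg.continuous C hC)

/-- The linear functional `w ↦ ∫ w u dμ` on bounded continuous functions. -/
def integralMulFunctional {u : ℝ → ℝ} (hu : Integrable u μ) : (ℝ →ᵇ ℝ) →ₗ[ℝ] ℝ where
  toFun w := ∫ x, w x * u x ∂μ
  map_add' w w' := by
    simp only [BoundedContinuousFunction.coe_add, Pi.add_apply, add_mul]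
    exact integral_add (integrable_boundedContinuousFunction_mul w hu)
      (integrable_boundedContinuousFunction_mul w' hu)
  map_smul' c w := by
    simp only [BoundedContinuousFunction.coe_smul, smul_eq_mul, mul_assoc, RingHom.id_apply]
    exact integral_const_mul _ _

lemma exists_ae_eq_sum_of_forall_integral_eq_zero {ι : Type*} [Fintype ι] {v : ι → ℝ → ℝ}
    {e : ℝ → ℝ} (hv : ∀ i, Integrable (v i) μ) (he : Integrable e μ)
    (h : ∀ w : ℝ →ᵇ ℝ, (∀ i, ∫ x, w x * v i x ∂μ = 0) → ∫ x, w x * e x ∂μ = 0) :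
    ∃ c : ι → ℝ, ∀ᵐ x ∂μ, e x = ∑ i, c i * v i x := by
  have hmem : integralMulFunctional he ∈
      Submodule.span ℝ (range fun i ↦ integralMulFunctional (hv i)) := by
    refine mem_span_of_iInf_ker_le_ker fun w hw ↦ ?_
    simp only [Submodule.mem_iInf, LinearMap.mem_ker] at hw ⊢
    exact h w hw
  obtain ⟨c, hc⟩ := (Submodule.mem_span_range_iff_exists_fun ℝ).1 hmem
  have hcv (i : ι) (_ : i ∈ Finset.univ) : Integrable (fun x ↦ c i * v i x) μ :=
    (hv i).const_mul (c i)
  have hzero : ∀ᵐ x ∂μ, e x - ∑ i, c i * v i x = 0 := by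
    refine ae_eq_zero_of_forall_integral_mul_eq_zero (he.sub (integrable_finsetSum _ hcv))
      fun w ↦ ?_
    have hw := LinearMap.congr_fun hc w
    simp only [LinearMap.sum_apply, LinearMap.smul_apply, smul_eq_mul] at hw
    simp only [mul_sub, Finset.mul_sum]
    rw [integral_sub (integrable_boundedContinuousFunction_mul w he) (integrable_finsetSum _
        fun i hi ↦ integrable_boundedContinuousFunction_mul w (hcv i hi)),
      integral_finsetSum _ fun i hi ↦ integrable_boundedContinuousFunction_mul w (hcv i hi),
      sub_eq_zero]
    simp only [mul_left_comm (w _), integral_const_mul]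
    exact hw.symm
  exact ⟨c, hzero.mono fun x hx ↦ sub_eq_zero.1 hx⟩

lemma exists_ae_eq_add_of_forall_integral_eq_zero [IsFiniteMeasure μ] {u v e : ℝ → ℝ}
    (hu : Integrable u μ) (hv : Integrable v μ) (he : Integrable e μ)
    (h : ∀ w : ℝ →ᵇ ℝ, ∫ x, w x ∂μ = 0 → ∫ x, w x * u x ∂μ = 0 → ∫ x, w x * v x ∂μ = 0 →
      ∫ x, w x * e x ∂μ = 0) :
    ∃ a b c : ℝ, ∀ᵐ x ∂μ, e x = a + b * u x + c * v x := by
  obtain ⟨c, hc⟩ := exists_ae_eq_sum_of_forall_integral_eq_zero (v := ![fun _ ↦ 1, u, v])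
    (Fin.forall_fin_succ.2 ⟨integrable_const _, Fin.forall_fin_two.2 ⟨hu, hv⟩⟩) he
    fun w hw ↦ h w (by simpa using hw 0) (hw 1) (hw 2)
  refine ⟨c 0, c 1, c 2, ?_⟩
  simpa only [Fin.sum_univ_three, Matrix.cons_val, mul_one] using hc

end Span

/-- The measure `μ` reweighted by the density `1 + w`. -/
def reweight (μ : Measure ℝ) (w : ℝ →ᵇ ℝ) : Measure ℝ :=
  μ.withDensity fun x ↦ ENNReal.ofReal (1 + w x)

section Reweight

variable {μ : Measure ℝ} {w : ℝ →ᵇ ℝ}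

lemma toReal_ofReal_one_add (hw : ‖w‖ ≤ 1) (x : ℝ) :
    (ENNReal.ofReal (1 + w x)).toReal = 1 + w x :=
  ENNReal.toReal_ofReal (by linarith [(abs_le.1 ((w.norm_coe_le_norm x).trans hw)).1])

lemma integral_reweight (hw : ‖w‖ ≤ 1) {u : ℝ → ℝ} (hu : Integrable u μ) :
    ∫ x, u x ∂(reweight μ w) = ∫ x, u x ∂μ + ∫ x, w x * u x ∂μ := by
  rw [reweight, integral_withDensity_eq_integral_toReal_smul (by fun_prop)
    (ae_of_all _ fun _ ↦ ENNReal.ofReal_lt_top),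
    ← integral_add hu (integrable_boundedContinuousFunction_mul w hu)]
  simp only [toReal_ofReal_one_add hw, smul_eq_mul, add_mul, one_mul]

lemma integrable_reweight (hw : ‖w‖ ≤ 1) {u : ℝ → ℝ} (hu : Integrable u μ) :
    Integrable u (reweight μ w) := by
  rw [reweight, integrable_withDensity_iff_integrable_smul' (by fun_prop)
    (ae_of_all _ fun _ ↦ ENNReal.ofReal_lt_top)]
  simp only [toReal_ofReal_one_add hw, smul_eq_mul, add_mul, one_mul]
  exact hu.add (integrable_boundedContinuousFunction_mul w hu)

lemma isProbabilityMeasure_reweight [IsProbabilityMeasure μ] (hw : ‖w‖ ≤ 1)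
    (h0 : ∫ x, w x ∂μ = 0) : IsProbabilityMeasure (reweight μ w) := by
  have h := integral_reweight (μ := μ) hw (u := fun _ ↦ (1 : ℝ)) (integrable_const _)
  simp only [integral_const, smul_eq_mul, mul_one, probReal_univ, h0, add_zero] at h
  exact ⟨(ENNReal.toReal_eq_one_iff _).1 h⟩

end Reweight

/-- A direction of reweighting that preserves, to first order and hence exactly, the total mass,
the power and the output law of the channel `f`. -/
structure IsNeutral (μ : Measure ℝ) (f : ℝ → ℝ) (w : ℝ →ᵇ ℝ) : Prop where
  mass : ∫ x, w x ∂μ = 0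
  power : ∫ x, w x * x ^ 2 ∂μ = 0
  output : ∫ x, w x * f x ∂μ = 0

namespace IsNeutral

variable {μ : Measure ℝ} {f : ℝ → ℝ} {w : ℝ →ᵇ ℝ}

lemma const_smul (hw : IsNeutral μ f w) (c : ℝ) : IsNeutral μ f (c • w) := by
  constructor <;>
    simp only [BoundedContinuousFunction.coe_smul, smul_eq_mul, mul_assoc, integral_const_mul,
      hw.mass, hw.power, hw.output, mul_zero]

lemma of_ae_eq_quadratic [IsFiniteMeasure μ] (hμ : Integrable (fun x ↦ x ^ 2) μ) {A B C : ℝ}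
    (hf : ∀ᵐ x ∂μ, f x = A + B * x + C * x ^ 2) (h0 : ∫ x, w x ∂μ = 0)
    (h1 : ∫ x, w x * x ∂μ = 0) (h2 : ∫ x, w x * x ^ 2 ∂μ = 0) : IsNeutral μ f w where
  mass := h0
  power := h2
  output := by
    have hw0 : Integrable w μ := w.integrable μ
    have hw1 := integrable_boundedContinuousFunction_mul w (integrable_id_of_integrable_sq hμ)
    have hw2 := integrable_boundedContinuousFunction_mul w hμ
    rw [integral_congr_ae (g := fun x ↦ A * w x + B * (w x * x) + C * (w x * x ^ 2))
        (hf.mono fun x hx ↦ by simp only [hx]; ring),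
      integral_add ((hw0.const_mul A).fun_add (hw1.const_mul B)) (hw2.const_mul C),
      integral_add (hw0.const_mul A) (hw1.const_mul B)]
    simp only [integral_const_mul, h0, h1, h2, mul_zero, add_zero]

lemma info_reweight [IsFiniteMeasure μ] (hf : IsSoftTest f) (hw : IsNeutral μ f w)
    (hw1 : ‖w‖ ≤ 1) :
    info (reweight μ w) f = info μ f - ∫ x, w x * binEntropy (f x) ∂μ := by
  rw [info, info, integral_reweight hw1 hf.integrable, hw.output, add_zero,
    integral_reweight hw1 hf.integrable_binEntropy]
  ring

lemma score_reweight [IsFiniteMeasure μ] (hf : IsSoftTest f) (hw : IsNeutral μ f w)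
    (hw1 : ‖w‖ ≤ 1) : score (reweight μ w) f = score μ f := by
  ext x
  rw [score, score, integral_reweight hw1 hf.integrable, hw.output, add_zero]

lemma isAdmissibleInput_reweight {P : ℝ} (hμ : IsAdmissibleInput P μ) (hP : 0 ≤ P)
    (hw : IsNeutral μ f w) (hw1 : ‖w‖ ≤ 1) : IsAdmissibleInput P (reweight μ w) := by
  have := hμ.isProbabilityMeasure
  have := isProbabilityMeasure_reweight hw1 hw.mass
  refine isAdmissibleInput_of_integral_sq_le (integrable_reweight hw1 hμ.integrable_sq) ?_
  rw [integral_reweight hw1 hμ.integrable_sq, hw.power, add_zero]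
  exact hμ.integral_sq_le hP

lemma integral_mul_eq_zero_of_forall_norm_le_one {u : ℝ → ℝ}
    (h : ∀ w : ℝ →ᵇ ℝ, IsNeutral μ f w → ‖w‖ ≤ 1 → ∫ x, w x * u x ∂μ = 0)
    (hw : IsNeutral μ f w) : ∫ x, w x * u x ∂μ = 0 := by
  have hpos : 0 < ‖w‖ + 1 := by positivity
  have hscaled := h _ (hw.const_smul (‖w‖ + 1)⁻¹) (by
    rw [norm_smul, norm_inv, norm_eq_abs, abs_of_pos hpos, inv_mul_le_one₀ hpos]
    exact (lt_add_one _).le)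
  simp only [BoundedContinuousFunction.coe_smul, smul_eq_mul, mul_assoc, integral_const_mul]
    at hscaled
  exact (mul_eq_zero.1 hscaled).resolve_left (inv_ne_zero hpos.ne')

end IsNeutral

namespace IsOptimal

variable {P : ℝ} {μ : Measure ℝ} {D : Set ℝ} {w : ℝ →ᵇ ℝ}

-- The information is affine along a neutral direction, so at a maximum it is constant there.
lemma isOptimal_reweight (h : IsOptimal P μ D) (hP : 0 ≤ P)
    (hw : IsNeutral μ (response (hardTest D)) w) (hw1 : ‖w‖ ≤ 1) :
    IsOptimal P (reweight μ w) D := by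
  have := h.isProbabilityMeasure
  have hf := h.isSoftTest.isSoftTest_response
  have hneg := hw.const_smul (-1)
  have hneg1 : ‖(-1 : ℝ) • w‖ ≤ 1 := by rwa [norm_smul, norm_neg, norm_one, one_mul]
  have hadm := hw.isAdmissibleInput_reweight h.isAdmissibleInput hP hw1
  have hadm' := hneg.isAdmissibleInput_reweight h.isAdmissibleInput hP hneg1
  have hle := h.info_le _ hadm D h.measurableSet
  have hle' := h.info_le _ hadm' D h.measurableSet
  refine h.of_info_eq hadm h.measurableSet (hle.antisymm ?_)
  rw [hw.info_reweight hf hw1]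
  rw [hneg.info_reweight hf hneg1] at hle'
  simp only [BoundedContinuousFunction.coe_smul, smul_eq_mul, neg_mul, one_mul, integral_neg]
    at hle'
  linarith

lemma integral_mul_id_eq_zero (h : IsOptimal P μ D) (hP : 0 < P)
    (hw : IsNeutral μ (response (hardTest D)) w) : ∫ x, w x * x ∂μ = 0 := by
  have := h.isProbabilityMeasure
  refine IsNeutral.integral_mul_eq_zero_of_forall_norm_le_one (fun w hw hw1 ↦ ?_) hw
  have hmean := (h.isOptimal_reweight hP.le hw hw1).integral_id hP
  rwa [integral_reweight hw1 (integrable_id_of_integrable_sq h.integrable_sq), h.integral_id hP,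
    zero_add] at hmean

lemma integrable_score_mul_gaussPDF (h : IsOptimal P μ D) (hP : 0 < P) (y : ℝ) :
    Integrable (fun x ↦ score μ (response (hardTest D)) x * gaussPDF (y - x)) μ :=
  have := h.isProbabilityMeasure
  integrable_mul_gaussPDF_sub ((h.isProperTest hP).integrable_score h.integrable_sq) y

lemma integral_mul_score_eq_zero (h : IsOptimal P μ D) (hP : 0 < P) {y : ℝ}
    (hy : y ∈ closure (interior D)) (hy' : y ∈ closure (interior Dᶜ))
    (hw : IsNeutral μ (response (hardTest D)) w) :
    ∫ x, w x * (score μ (response (hardTest D)) x * gaussPDF (y - x)) ∂μ = 0 := by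
  have := h.isProbabilityMeasure
  refine IsNeutral.integral_mul_eq_zero_of_forall_norm_le_one (fun w hw hw1 ↦ ?_) hw
  have hzero := h.smoothedScore_eq_zero hP hy hy'
  have hzero' := (h.isOptimal_reweight hP.le hw hw1).smoothedScore_eq_zero hP hy hy'
  rw [smoothedScore] at hzero hzero'
  rwa [hw.score_reweight h.isSoftTest.isSoftTest_response hw1,
    integral_reweight hw1 (h.integrable_score_mul_gaussPDF hP y), hzero, zero_add] at hzero'

lemma ae_eq_quadratic_or_ae_response_eq_quadratic (h : IsOptimal P μ D) (hP : 0 < P) :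
    (∃ α β : ℝ, ∀ᵐ x ∂μ, x = α + β * x ^ 2) ∨
      ∃ A B C : ℝ, ∀ᵐ x ∂μ, response (hardTest D) x = A + B * x + C * x ^ 2 := by
  have := h.isProbabilityMeasure
  obtain ⟨a, b, c, habc⟩ := exists_ae_eq_add_of_forall_integral_eq_zero h.integrable_sq
    h.isSoftTest.isSoftTest_response.integrable (integrable_id_of_integrable_sq h.integrable_sq)
    fun w h0 h2 hf ↦ h.integral_mul_id_eq_zero hP (w := w) ⟨h0, h2, hf⟩
  rcases eq_or_ne c 0 with rfl | hc
  · exact .inl ⟨a, b, habc.mono fun x hx ↦ by linarith⟩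
  · refine .inr ⟨-a / c, 1 / c, -b / c, habc.mono fun x hx ↦ ?_⟩
    field_simp
    linarith

lemma ae_score_eq_quadratic (h : IsOptimal P μ D) (hP : 0 < P) {A B C : ℝ}
    (hf : ∀ᵐ x ∂μ, response (hardTest D) x = A + B * x + C * x ^ 2) {y : ℝ}
    (hy : y ∈ closure (interior D)) (hy' : y ∈ closure (interior Dᶜ)) :
    ∃ r s : ℝ, ∀ᵐ x ∂μ,
      score μ (response (hardTest D)) x * gaussPDF (y - x) = r * (x ^ 2 - P) + s * x := by
  have := h.isProbabilityMeasure
  have hsq := h.integrable_sq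
  have hid := integrable_id_of_integrable_sq hsq
  obtain ⟨a, r, s, hars⟩ := exists_ae_eq_add_of_forall_integral_eq_zero hsq hid
    (h.integrable_score_mul_gaussPDF hP y) fun w h0 h2 h1 ↦
      h.integral_mul_score_eq_zero hP hy hy' (.of_ae_eq_quadratic hsq hf h0 h1 h2)
  have hzero := h.smoothedScore_eq_zero hP hy hy'
  rw [smoothedScore, integral_congr_ae hars,
    integral_add ((integrable_const a).fun_add (hsq.const_mul r)) (hid.const_mul s),
    integral_add (integrable_const a) (hsq.const_mul r), integral_const_mul, integral_const_mul,
    h.integral_sq hP, h.integral_id hP, integral_const, probReal_univ, one_smul] at hzero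
  exact ⟨r, s, hars.mono fun x hx ↦ by linarith⟩

end IsOptimal

/-! ### Variation diminishing and the shape of optimal quantizers -/

lemma exists_strictMono_of_lt_encard {α : Type*} [LinearOrder α] {S : Set α} {n : ℕ}
    (h : (n : ℕ∞) < S.encard) : ∃ z : Fin (n + 1) → α, StrictMono z ∧ ∀ i, z i ∈ S := by
  obtain ⟨t, htS, ht⟩ := exists_subset_encard_eq (Order.add_one_le_of_lt h)
  have hfin : t.Finite := finite_of_encard_eq_coe (k := n + 1) (by rw [ht]; rfl)
  lift t to Finset α using hfin
  have hcard : t.card = n + 1 := by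
    rw [encard_coe_eq_coe_finsetCard] at ht
    exact_mod_cast ht
  exact ⟨t.orderEmbOfFin hcard, (t.orderEmbOfFin hcard).strictMono,
    fun i ↦ htS (t.orderEmbOfFin_mem hcard i)⟩

lemma sign_sub_eq_of_strictConvexOn {φ : ℝ → ℝ} (hφ : StrictConvexOn ℝ univ φ) {α β c : ℝ}
    (hαβ : α < β) (hα : φ α = c) (hβ : φ β = c) (x : ℝ) :
    SignType.sign (c - φ x) = SignType.sign ((x - α) * (β - x)) := by
  have hbetween {u v w : ℝ} (huv : u < v) (hvw : v < w) : φ v < max (φ u) (φ w) :=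
    hφ.lt_on_openSegment (mem_univ u) (mem_univ w) (huv.trans hvw).ne
      (by rw [openSegment_eq_Ioo (huv.trans hvw)]; exact ⟨huv, hvw⟩)
  rcases lt_trichotomy x α with hx | rfl | hx
  · have h := hbetween hx hαβ
    rw [hα, hβ, lt_max_iff, or_iff_left (lt_irrefl c)] at h
    rw [sign_neg (sub_neg.2 h), sign_neg (mul_neg_of_neg_of_pos (by linarith) (by linarith))]
  · rw [hα, sub_self, sub_self, zero_mul]
  rcases lt_trichotomy x β with hx' | rfl | hx'
  · have h := hbetween hx hx'
    rw [hα, hβ, max_self] at h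
    rw [sign_pos (sub_pos.2 h), sign_pos (mul_pos (by linarith) (by linarith))]
  · rw [hβ, sub_self, sub_self, mul_zero]
  · have h := hbetween hαβ hx'
    rw [hα, hβ, lt_max_iff, or_iff_right (lt_irrefl c)] at h
    rw [sign_neg (sub_neg.2 h), sign_neg (mul_neg_of_pos_of_neg (by linarith) (by linarith))]

lemma exists_pos_combination_eq_one {u₁ u₂ v₁ v₂ : ℝ} (hu₂ : 0 < u₂) (hu : u₂ < u₁) (hv₁ : 0 < v₁)
    (hv : v₁ < v₂) : ∃ a > 0, ∃ b > 0, a * u₁ + b * v₁ = 1 ∧ a * u₂ + b * v₂ = 1 := by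
  have hdet : 0 < u₁ * v₂ - u₂ * v₁ := by nlinarith
  refine ⟨(v₂ - v₁) / (u₁ * v₂ - u₂ * v₁), div_pos (sub_pos.2 hv) hdet,
    (u₁ - u₂) / (u₁ * v₂ - u₂ * v₁), div_pos (sub_pos.2 hu) hdet, ?_, ?_⟩ <;>
  · rw [div_mul_eq_mul_div, div_mul_eq_mul_div, ← add_div, div_eq_one_iff_eq hdet.ne']
    ring

lemma strictConvexOn_mul_exp_mul {κ c : ℝ} (hκ : κ ≠ 0) (hc : 0 < c) :
    StrictConvexOn ℝ univ fun x ↦ c * exp (κ * x) := by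
  refine ⟨convex_univ, fun x _ y _ hxy a b ha hb hab ↦ ?_⟩
  have hexp := strictConvexOn_exp.2 (mem_univ (κ * x)) (mem_univ (κ * y))
    (fun h ↦ hxy (mul_left_cancel₀ hκ h)) ha hb hab
  simp only [smul_eq_mul] at hexp ⊢
  rw [show κ * (a * x + b * y) = a * (κ * x) + b * (κ * y) by ring]
  nlinarith

lemma exists_sign_exp_combination {α β d e : ℝ} (hαβ : α < β) (hd : 0 < d) (he : 0 < e) :
    ∃ a > 0, ∃ b > 0, ∀ x, SignType.sign (1 - (a * exp (-d * x) + b * exp (e * x))) =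
      SignType.sign ((x - α) * (β - x)) := by
  obtain ⟨a, ha, b, hb, hα, hβ⟩ := exists_pos_combination_eq_one (exp_pos (-d * β))
    (exp_lt_exp.2 (by nlinarith : -d * β < -d * α)) (exp_pos (e * α))
    (exp_lt_exp.2 (by nlinarith : e * α < e * β))
  exact ⟨a, ha, b, hb, sign_sub_eq_of_strictConvexOn
    ((strictConvexOn_mul_exp_mul (neg_ne_zero.2 hd.ne') ha).add
      (strictConvexOn_mul_exp_mul he.ne' hb)) hαβ hα hβ⟩

section SignChange

lemma integral_mul_pos_of_sign_eq {α : Type*} [MeasurableSpace α] {μ : Measure α} {s k : α → ℝ}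
    (hne : ¬ s =ᵐ[μ] 0) (hsk : Integrable (fun x ↦ s x * k x) μ)
    (hsign : ∀ᵐ x ∂μ, SignType.sign (k x) = SignType.sign (s x)) : 0 < ∫ x, s x * k x ∂μ := by
  have hpos : ∀ᵐ x ∂μ, s x ≠ 0 → 0 < s x * k x := by
    filter_upwards [hsign] with x hx hsx
    rw [← sign_eq_one_iff, sign_mul, hx, ← sign_mul, sign_eq_one_iff]
    exact mul_self_pos.2 hsx
  have hnonneg : ∀ᵐ x ∂μ, 0 ≤ s x * k x := by
    filter_upwards [hpos] with x hx
    rcases eq_or_ne (s x) 0 with h | h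
    · rw [h, zero_mul]
    · exact (hx h).le
  refine (integral_nonneg_of_ae hnonneg).lt_of_ne fun h0 ↦ hne ?_
  filter_upwards [hpos, (integral_eq_zero_iff_of_nonneg_ae hnonneg hsk).1 h0.symm] with x hx hx0
  by_contra hsx
  exact (hx hsx).ne' hx0

lemma frequently_pos_of_integral_eq_zero {α : Type*} [MeasurableSpace α] {μ : Measure α}
    {s : α → ℝ} (hs : Integrable s μ) (h0 : ∫ x, s x ∂μ = 0) (hne : ¬ s =ᵐ[μ] 0) :
    ∃ᵐ x ∂μ, 0 < s x := by
  refine fun hle ↦ hne ?_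
  have hneg : 0 ≤ᵐ[μ] -s := hle.mono fun x hx ↦ neg_nonneg.2 (not_lt.1 hx)
  have hzero := (integral_eq_zero_iff_of_nonneg_ae hneg hs.neg).1 (by
    simp only [Pi.neg_apply, integral_neg, h0, neg_zero])
  filter_upwards [hzero] with x hx using neg_eq_zero.1 hx

lemma exists_quadratic_eq_mul_of_neg {A B C x₀ : ℝ} (hC : C < 0)
    (hx₀ : 0 < A + B * x₀ + C * x₀ ^ 2) :
    ∃ α β, α < β ∧ ∀ x, A + B * x + C * x ^ 2 = -C * ((x - α) * (β - x)) := by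
  have hdiscr : 0 < B ^ 2 - 4 * C * A := by nlinarith [sq_nonneg (2 * C * x₀ + B)]
  have hsq := sq_sqrt hdiscr.le
  have hsqrt := sqrt_pos.2 hdiscr
  refine ⟨(-B + √(B ^ 2 - 4 * C * A)) / (2 * C), (-B - √(B ^ 2 - 4 * C * A)) / (2 * C), ?_,
    fun x ↦ ?_⟩
  · rw [div_lt_div_right_of_neg (by linarith)]
    linarith
  · have hC0 := hC.ne
    field_simp
    ring_nf at hsq ⊢
    linear_combination hsq

variable {μ : Measure ℝ} {s : ℝ → ℝ}

/-- For suitable `A, B > 0` the kernel `gaussPDF (y₂ - x) - A * gaussPDF (y₁ - x) - B * gaussPDF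
(y₃ - x)` has the sign of `s x`, so that its integral against `s` is positive. -/
lemma integral_mul_gaussPDF_pos_of_sign_eq_quadratic (hs : Integrable s μ) (hne : ¬ s =ᵐ[μ] 0)
    {α β : ℝ} (hαβ : α < β)
    (hsign : ∀ᵐ x ∂μ, SignType.sign (s x) = SignType.sign ((x - α) * (β - x)))
    {y₁ y₂ y₃ : ℝ} (h₁₂ : y₁ < y₂) (h₂₃ : y₂ < y₃) (h₁ : 0 ≤ ∫ x, s x * gaussPDF (y₁ - x) ∂μ)
    (h₃ : 0 ≤ ∫ x, s x * gaussPDF (y₃ - x) ∂μ) : 0 < ∫ x, s x * gaussPDF (y₂ - x) ∂μ := by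
  obtain ⟨a, ha, b, hb, hab⟩ :=
    exists_sign_exp_combination hαβ (sub_pos.2 h₁₂) (sub_pos.2 h₂₃)
  set A := a * exp ((y₁ ^ 2 - y₂ ^ 2) / 2) with hA
  set B := b * exp ((y₃ ^ 2 - y₂ ^ 2) / 2) with hB
  have hA0 : 0 < A := by positivity
  have hB0 : 0 < B := by positivity
  have hkernel (x : ℝ) : gaussPDF (y₂ - x) - A * gaussPDF (y₁ - x) - B * gaussPDF (y₃ - x) =
      gaussPDF (y₂ - x) * (1 - (a * exp (-(y₂ - y₁) * x) + b * exp ((y₃ - y₂) * x))) := by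
    rw [gaussPDF_sub_eq_mul y₁ y₂ x, gaussPDF_sub_eq_mul y₃ y₂ x, hA, hB,
      show -(y₂ - y₁) * x = x * (y₁ - y₂) by ring, mul_comm (y₃ - y₂),
      show (y₂ ^ 2 - y₁ ^ 2) / 2 = -((y₁ ^ 2 - y₂ ^ 2) / 2) by ring,
      show (y₂ ^ 2 - y₃ ^ 2) / 2 = -((y₃ ^ 2 - y₂ ^ 2) / 2) by ring, exp_neg, exp_neg]
    field_simp
    ring
  have i₁ := (integrable_mul_gaussPDF_sub hs y₁).const_mul A
  have i₂ := integrable_mul_gaussPDF_sub hs y₂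
  have i₃ := (integrable_mul_gaussPDF_sub hs y₃).const_mul B
  have i₂₁ : Integrable (fun x ↦ s x * gaussPDF (y₂ - x) - A * (s x * gaussPDF (y₁ - x))) μ :=
    i₂.sub i₁
  have hexpand : (fun x ↦ s x * (gaussPDF (y₂ - x) - A * gaussPDF (y₁ - x) -
      B * gaussPDF (y₃ - x))) = fun x ↦ s x * gaussPDF (y₂ - x) -
        A * (s x * gaussPDF (y₁ - x)) - B * (s x * gaussPDF (y₃ - x)) := by
    ext x
    ring
  have hpos : 0 < ∫ x, s x * (gaussPDF (y₂ - x) - A * gaussPDF (y₁ - x) -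
      B * gaussPDF (y₃ - x)) ∂μ := by
    refine integral_mul_pos_of_sign_eq hne (hexpand ▸ i₂₁.sub i₃) ?_
    filter_upwards [hsign] with x hx
    rw [hkernel, sign_mul, sign_pos (gaussPDF_pos _), one_mul, hab, hx]
  rw [hexpand, integral_sub i₂₁ i₃, integral_sub i₂ i₁, integral_const_mul,
    integral_const_mul] at hpos
  nlinarith [mul_nonneg hA0.le h₁, mul_nonneg hB0.le h₃]

lemma sign_one_sub_exp (x : ℝ) : SignType.sign (1 - exp x) = SignType.sign (-x) := by
  rcases lt_trichotomy x 0 with h | rfl | h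
  · rw [sign_pos (sub_pos.2 (exp_lt_one_iff.2 h)), sign_pos (neg_pos.2 h)]
  · rw [exp_zero, sub_self, neg_zero]
  · rw [sign_neg (sub_neg.2 (one_lt_exp_iff.2 h)), sign_neg (neg_neg_iff_pos.2 h)]

lemma integral_mul_gaussPDF_pos_of_sign_eq_linear (hs : Integrable s μ) (hne : ¬ s =ᵐ[μ] 0)
    {α b : ℝ} (hsign : ∀ᵐ x ∂μ, SignType.sign (s x) = SignType.sign (b * (x - α)))
    {y₁ y₂ : ℝ} (h₁₂ : 0 < b * (y₂ - y₁)) (h₁ : 0 ≤ ∫ x, s x * gaussPDF (y₁ - x) ∂μ) :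
    0 < ∫ x, s x * gaussPDF (y₂ - x) ∂μ := by
  set A := exp (α * (y₂ - y₁)) * exp ((y₁ ^ 2 - y₂ ^ 2) / 2) with hA
  have hA0 : 0 < A := by positivity
  have hkernel (x : ℝ) : gaussPDF (y₂ - x) - A * gaussPDF (y₁ - x) =
      gaussPDF (y₂ - x) * (1 - exp ((α - x) * (y₂ - y₁))) := by
    rw [gaussPDF_sub_eq_mul y₁ y₂ x, hA,
      show (α - x) * (y₂ - y₁) = α * (y₂ - y₁) + x * (y₁ - y₂) by ring,
      show (y₂ ^ 2 - y₁ ^ 2) / 2 = -((y₁ ^ 2 - y₂ ^ 2) / 2) by ring, exp_neg, exp_add]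
    field_simp
  have hb : b ≠ 0 := left_ne_zero_of_mul h₁₂.ne'
  have i₁ := (integrable_mul_gaussPDF_sub hs y₁).const_mul A
  have i₂ := integrable_mul_gaussPDF_sub hs y₂
  have hexpand : (fun x ↦ s x * (gaussPDF (y₂ - x) - A * gaussPDF (y₁ - x))) =
      fun x ↦ s x * gaussPDF (y₂ - x) - A * (s x * gaussPDF (y₁ - x)) := by
    ext x
    ring
  have hpos : 0 < ∫ x, s x * (gaussPDF (y₂ - x) - A * gaussPDF (y₁ - x)) ∂μ := by
    refine integral_mul_pos_of_sign_eq hne (hexpand ▸ i₂.sub i₁) ?_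
    filter_upwards [hsign] with x hx
    rw [hkernel, sign_mul, sign_pos (gaussPDF_pos _), one_mul, sign_one_sub_exp, hx,
      show -((α - x) * (y₂ - y₁)) = b * (x - α) * (b * (y₂ - y₁)) / b ^ 2 by field_simp; ring,
      div_eq_mul_inv, sign_mul, sign_mul, sign_pos h₁₂,
      sign_pos (by positivity : 0 < (b ^ 2)⁻¹), mul_one, mul_one]
  rw [hexpand, integral_sub i₂ i₁, integral_const_mul] at hpos
  nlinarith [mul_nonneg hA0.le h₁]

end SignChange

lemma strictAntiOn_entropySlope : StrictAntiOn entropySlope (Ioo 0 1) := fun p hp q hq hpq ↦ by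
  have h₁ := log_lt_log hp.1 hpq
  have h₂ := log_lt_log (sub_pos.2 hq.2) (sub_lt_sub_left hpq 1)
  unfold entropySlope
  linarith

lemma IsProperTest.sign_score {ψ : ℝ → ℝ} (hψ : IsProperTest ψ) (μ : Measure ℝ)
    [IsProbabilityMeasure μ] (x : ℝ) : SignType.sign (score μ (response ψ) x) =
      SignType.sign (response ψ x - ∫ x, response ψ x ∂μ) := by
  have hx : response ψ x ∈ Ioo 0 1 := ⟨hψ.response_pos x, hψ.response_lt_one x⟩
  have hq : ∫ x, response ψ x ∂μ ∈ Ioo 0 1 :=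
    ⟨hψ.integral_response_pos, hψ.integral_response_lt_one⟩
  rw [score]
  rcases lt_trichotomy (response ψ x) (∫ x, response ψ x ∂μ) with h | h | h
  · rw [sign_neg (sub_neg.2 h), sign_neg (sub_neg.2 (strictAntiOn_entropySlope hx hq h))]
  · rw [h, sub_self, sub_self]
  · rw [sign_pos (sub_pos.2 h), sign_pos (sub_pos.2 (strictAntiOn_entropySlope hq hx h))]

namespace IsOptimal

variable {P : ℝ} {μ : Measure ℝ} {D : Set ℝ}

lemma not_score_ae_eq_zero (h : IsOptimal P μ D) (hP : 0 < P) :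
    ¬ score μ (response (hardTest D)) =ᵐ[μ] 0 := fun h0 ↦ by
  have := h.isProbabilityMeasure
  have hle := (h.isProperTest hP).info_response_add_le h.integrable_sq
    (isSoftTest_hardTest MeasurableSet.empty)
  have hsmoothed (y : ℝ) : smoothedScore μ (response (hardTest D)) y = 0 := by
    rw [smoothedScore, integral_congr_ae (g := fun _ ↦ (0 : ℝ))
      (by filter_upwards [h0] with x hx; rw [hx]; simp), integral_zero]
  have hempty : info μ (response (hardTest ∅)) = 0 := by simp [info, response, hardTest]
  simp only [hsmoothed, mul_zero, integral_zero, add_zero, hempty] at hle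
  exact (h.info_pos hP).not_ge hle

lemma frequently_integral_lt_response (h : IsOptimal P μ D) (hP : 0 < P) :
    ∃ᵐ x ∂μ, 0 < response (hardTest D) x - ∫ x, response (hardTest D) x ∂μ := by
  have := h.isProbabilityMeasure
  have hf := h.isSoftTest.isSoftTest_response.integrable (μ := μ)
  refine frequently_pos_of_integral_eq_zero (hf.sub (integrable_const _)) ?_ fun h0 ↦
    h.not_score_ae_eq_zero hP ?_
  · rw [integral_sub hf (integrable_const _)]
    simp
  · filter_upwards [h0] with x hx
    rw [Pi.zero_apply, ← _root_.sign_eq_zero_iff, (h.isProperTest hP).sign_score μ,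
      _root_.sign_eq_zero_iff]
    exact hx

lemma smoothedScore_pos_of_quadratic (h : IsOptimal P μ D) (hP : 0 < P) {A B C : ℝ} (hC : C < 0)
    (hquad : ∀ᵐ x ∂μ, response (hardTest D) x = A + B * x + C * x ^ 2) {y₁ y₂ y₃ : ℝ}
    (h₁₂ : y₁ < y₂) (h₂₃ : y₂ < y₃) (h₁ : 0 ≤ smoothedScore μ (response (hardTest D)) y₁)
    (h₃ : 0 ≤ smoothedScore μ (response (hardTest D)) y₃) :
    0 < smoothedScore μ (response (hardTest D)) y₂ := by
  have := h.isProbabilityMeasure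
  have hproper := h.isProperTest hP
  have hshift : ∀ᵐ x ∂μ, response (hardTest D) x - ∫ x, response (hardTest D) x ∂μ =
      (A - ∫ x, response (hardTest D) x ∂μ) + B * x + C * x ^ 2 := by
    filter_upwards [hquad] with x hx
    rw [hx]
    ring
  obtain ⟨x₀, hx₀, hx₀'⟩ := ((h.frequently_integral_lt_response hP).and_eventually hshift).exists
  obtain ⟨α, β, hαβ, hfactor⟩ := exists_quadratic_eq_mul_of_neg hC (hx₀'.subst hx₀)
  refine integral_mul_gaussPDF_pos_of_sign_eq_quadratic (hproper.integrable_score h.integrable_sq)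
    (h.not_score_ae_eq_zero hP) hαβ ?_ h₁₂ h₂₃ h₁ h₃
  filter_upwards [hshift] with x hx
  rw [hproper.sign_score μ, hx, hfactor, sign_mul, sign_pos (neg_pos.2 hC), one_mul]

lemma smoothedScore_pos_of_linear (h : IsOptimal P μ D) (hP : 0 < P) {A B : ℝ}
    (hlin : ∀ᵐ x ∂μ, response (hardTest D) x = A + B * x) {y₁ y₂ y₃ : ℝ} (h₁₂ : y₁ < y₂)
    (h₂₃ : y₂ < y₃) (h₁ : 0 ≤ smoothedScore μ (response (hardTest D)) y₁)
    (h₃ : 0 ≤ smoothedScore μ (response (hardTest D)) y₃) :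
    0 < smoothedScore μ (response (hardTest D)) y₂ := by
  have := h.isProbabilityMeasure
  have hproper := h.isProperTest hP
  set q := ∫ x, response (hardTest D) x ∂μ with hq
  have hB : B ≠ 0 := by
    rintro rfl
    have hconst : ∀ᵐ x ∂μ, response (hardTest D) x = A := hlin.mono fun x hx ↦ by simpa using hx
    have hqA : q = A := by rw [hq, integral_congr_ae hconst, integral_const]; simp
    obtain ⟨x, hx, hx'⟩ := ((h.frequently_integral_lt_response hP).and_eventually hconst).exists
    rw [← hq, hx', hqA, sub_self] at hx
    exact lt_irrefl 0 hx
  have hsign : ∀ᵐ x ∂μ, SignType.sign (score μ (response (hardTest D)) x) =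
      SignType.sign (B * (x - (q - A) / B)) := by
    filter_upwards [hlin] with x hx
    rw [hproper.sign_score μ, hx, show B * (x - (q - A) / B) = A + B * x - q by field_simp; ring]
  have hs := hproper.integrable_score h.integrable_sq
  have hne := h.not_score_ae_eq_zero hP
  rcases hB.lt_or_gt with hB | hB
  · exact integral_mul_gaussPDF_pos_of_sign_eq_linear hs hne hsign (by nlinarith) h₃
  · exact integral_mul_gaussPDF_pos_of_sign_eq_linear hs hne hsign (by nlinarith) h₁

lemma smoothedScore_pos_of_concave (h : IsOptimal P μ D) (hP : 0 < P) {A B C : ℝ} (hC : C ≤ 0)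
    (hquad : ∀ᵐ x ∂μ, response (hardTest D) x = A + B * x + C * x ^ 2) {y₁ y₂ y₃ : ℝ}
    (h₁₂ : y₁ < y₂) (h₂₃ : y₂ < y₃) (h₁ : 0 ≤ smoothedScore μ (response (hardTest D)) y₁)
    (h₃ : 0 ≤ smoothedScore μ (response (hardTest D)) y₃) :
    0 < smoothedScore μ (response (hardTest D)) y₂ := by
  rcases hC.lt_or_eq with hC | rfl
  · exact h.smoothedScore_pos_of_quadratic hP hC hquad h₁₂ h₂₃ h₁ h₃
  · exact h.smoothedScore_pos_of_linear hP (hquad.mono fun x hx ↦ by simpa using hx) h₁₂ h₂₃ h₁ h₃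

lemma ae_eq_setOf_smoothedScore_pos (h : IsOptimal P μ D) (hP : 0 < P) {A B C : ℝ} (hC : C ≤ 0)
    (hquad : ∀ᵐ x ∂μ, response (hardTest D) x = A + B * x + C * x ^ 2) :
    D =ᵐ[volume] {y | 0 < smoothedScore μ (response (hardTest D)) y} := by
  have hzero : volume {y | smoothedScore μ (response (hardTest D)) y = 0} = 0 := by
    refine Set.Finite.measure_zero ?_ _
    by_contra hinf
    obtain ⟨z, hz, hz0⟩ := exists_strictMono_of_lt_encard (n := 2)
      (S := {y | smoothedScore μ (response (hardTest D)) y = 0})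
      (by rw [encard_eq_top_iff.2 hinf]; exact ENat.natCast_lt_top 2)
    have hpos := h.smoothedScore_pos_of_concave hP hC hquad (hz (show (0 : Fin 3) < 1 by decide))
      (hz (show (1 : Fin 3) < 2 by decide)) (hz0 0).ge (hz0 2).ge
    exact hpos.ne' (hz0 1)
  filter_upwards [h.ae_sign_smoothedScore hP, measure_eq_zero_iff_ae_notMem.1 hzero] with y hy hy0
  refine propext ⟨fun hyD ↦ (hy.1 hyD).lt_of_ne' hy0, fun hpos ↦ ?_⟩
  by_contra hyD
  exact (hy.2 hyD).not_gt hpos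

lemma ordConnected_setOf_smoothedScore_pos (h : IsOptimal P μ D) (hP : 0 < P) {A B C : ℝ}
    (hC : C ≤ 0) (hquad : ∀ᵐ x ∂μ, response (hardTest D) x = A + B * x + C * x ^ 2) :
    {y | 0 < smoothedScore μ (response (hardTest D)) y}.OrdConnected := by
  refine ⟨fun y₁ h₁ y₃ h₃ y₂ h₂ ↦ ?_⟩
  rcases h₂.1.eq_or_lt with rfl | h₁₂
  · exact h₁
  rcases h₂.2.eq_or_lt with rfl | h₂₃
  · exact h₃
  exact h.smoothedScore_pos_of_concave hP hC hquad h₁₂ h₂₃ (le_of_lt h₁) (le_of_lt h₃)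

lemma not_ae_eq_empty (h : IsOptimal P μ D) (hP : 0 < P) : ¬ D =ᵐ[volume] (∅ : Set ℝ) :=
  fun hae ↦ (h.isProperTest hP).not_zero <| by
    have := indicator_ae_eq_of_ae_eq_set (f := fun _ : ℝ ↦ (1 : ℝ)) hae
    rwa [indicator_empty] at this

lemma not_ae_eq_univ (h : IsOptimal P μ D) (hP : 0 < P) : ¬ D =ᵐ[volume] univ :=
  fun hae ↦ (h.isProperTest hP).not_one <| by
    have := indicator_ae_eq_of_ae_eq_set (f := fun _ : ℝ ↦ (1 : ℝ)) hae
    rwa [indicator_univ] at this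

lemma isOptimal_Ioi_of_ae_eq_Iio (h : IsOptimal P μ D) {τ : ℝ} (hae : D =ᵐ[volume] Iio τ) :
    IsOptimal P μ (Ioi τ) := by
  have hcompl := (h.congr_ae measurableSet_Iio hae).compl
  rw [compl_Iio] at hcompl
  exact hcompl.congr_ae measurableSet_Ioi Ioi_ae_eq_Ici.symm

lemma exists_isOptimal_Ioo_of_ae_eq (h : IsOptimal P μ D) (hP : 0 < P) {a b : ℝ}
    (hae : D =ᵐ[volume] Ioo a b) : ∃ a b, a < b ∧ IsOptimal P μ (Ioo a b) := by
  refine ⟨a, b, not_le.1 fun hba ↦ h.not_ae_eq_empty hP ?_, h.congr_ae measurableSet_Ioo hae⟩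
  rwa [Ioo_eq_empty (not_lt.2 hba)] at hae

lemma exists_isOptimal_interval_of_ordConnected (h : IsOptimal P μ D) (hP : 0 < P) {U : Set ℝ}
    (hU : U.OrdConnected) (hae : D =ᵐ[volume] U) :
    (∃ τ, IsOptimal P μ (Ioi τ)) ∨ ∃ a b, a < b ∧ IsOptimal P μ (Ioo a b) := by
  have hmem := hU.isPreconnected.mem_intervals
  simp only [mem_insert_iff, mem_singleton_iff] at hmem
  generalize sInf U = a, sSup U = b at hmem
  rcases hmem with rfl | rfl | rfl | rfl | rfl | rfl | rfl | rfl | rfl | rfl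
  · exact .inr (h.exists_isOptimal_Ioo_of_ae_eq hP (hae.trans Ioo_ae_eq_Icc.symm))
  · exact .inr (h.exists_isOptimal_Ioo_of_ae_eq hP (hae.trans Ioo_ae_eq_Ico.symm))
  · exact .inr (h.exists_isOptimal_Ioo_of_ae_eq hP (hae.trans Ioo_ae_eq_Ioc.symm))
  · exact .inr (h.exists_isOptimal_Ioo_of_ae_eq hP hae)
  · exact .inl ⟨a, h.congr_ae measurableSet_Ioi (hae.trans Ioi_ae_eq_Ici.symm)⟩
  · exact .inl ⟨a, h.congr_ae measurableSet_Ioi hae⟩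
  · exact .inl ⟨b, h.isOptimal_Ioi_of_ae_eq_Iio (hae.trans Iio_ae_eq_Iic.symm)⟩
  · exact .inl ⟨b, h.isOptimal_Ioi_of_ae_eq_Iio hae⟩
  · exact absurd hae (h.not_ae_eq_univ hP)
  · exact absurd hae (h.not_ae_eq_empty hP)

lemma exists_isOptimal_interval_of_concave (h : IsOptimal P μ D) (hP : 0 < P) {A B C : ℝ}
    (hC : C ≤ 0) (hquad : ∀ᵐ x ∂μ, response (hardTest D) x = A + B * x + C * x ^ 2) :
    (∃ τ, IsOptimal P μ (Ioi τ)) ∨ ∃ a b, a < b ∧ IsOptimal P μ (Ioo a b) :=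
  h.exists_isOptimal_interval_of_ordConnected hP
    (h.ordConnected_setOf_smoothedScore_pos hP hC hquad)
    (h.ae_eq_setOf_smoothedScore_pos hP hC hquad)

lemma exists_isOptimal_interval (h : IsOptimal P μ D) (hP : 0 < P) {A B C : ℝ}
    (hquad : ∀ᵐ x ∂μ, response (hardTest D) x = A + B * x + C * x ^ 2) :
    (∃ τ, IsOptimal P μ (Ioi τ)) ∨ ∃ a b, a < b ∧ IsOptimal P μ (Ioo a b) := by
  rcases le_total C 0 with hC | hC
  · exact h.exists_isOptimal_interval_of_concave hP hC hquad
  · refine h.compl.exists_isOptimal_interval_of_concave hP (A := 1 - A) (B := -B) (C := -C)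
      (by linarith) ?_
    filter_upwards [hquad] with x hx
    rw [hardTest_compl, h.isSoftTest.response_one_sub, hx]
    ring

end IsOptimal

/-! ### Karush–Kuhn–Tucker conditions for the input -/

lemma le_of_hasDerivAt_zero_of_le_add_mul {u : ℝ → ℝ} {u' c : ℝ} (hu : HasDerivAt u u' 0)
    (hle : ∀ t, 0 ≤ t → t ≤ 1 → u t ≤ u 0 + t * c) : u' ≤ c := by
  refine le_of_tendsto hu.tendsto_slope_zero_right ?_
  filter_upwards [Ioo_mem_nhdsGT (show (0 : ℝ) < 1 by norm_num)] with t ht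
  rw [zero_add, smul_eq_mul, inv_mul_le_iff₀ ht.1]
  linarith [hle t ht.1.le ht.2.le]

/-- The mixture `(1 - t) μ + t ν`, meant for `0 ≤ t ≤ 1`. -/
def mixture {α : Type*} [MeasurableSpace α] (t : ℝ) (μ ν : Measure α) : Measure α :=
  ENNReal.ofReal (1 - t) • μ + ENNReal.ofReal t • ν

lemma ofReal_one_sub_add_ofReal {t : ℝ} (h0 : 0 ≤ t) (h1 : t ≤ 1) :
    ENNReal.ofReal (1 - t) + ENNReal.ofReal t = 1 := by
  rw [← ENNReal.ofReal_add (sub_nonneg.2 h1) h0, sub_add_cancel, ENNReal.ofReal_one]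

section Mixture

variable {α : Type*} [MeasurableSpace α] {μ ν : Measure α} {t : ℝ}

lemma integral_mixture (h0 : 0 ≤ t) (h1 : t ≤ 1) {v : α → ℝ} (hμ : Integrable v μ)
    (hν : Integrable v ν) :
    ∫ x, v x ∂mixture t μ ν = (1 - t) * ∫ x, v x ∂μ + t * ∫ x, v x ∂ν := by
  rw [mixture, integral_add_measure (hμ.smul_measure ENNReal.ofReal_ne_top)
    (hν.smul_measure ENNReal.ofReal_ne_top), integral_smul_measure, integral_smul_measure,
    ENNReal.toReal_ofReal h0, ENNReal.toReal_ofReal (sub_nonneg.2 h1), smul_eq_mul, smul_eq_mul]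

lemma info_mixture [IsProbabilityMeasure μ] [IsProbabilityMeasure ν] {f : α → ℝ}
    (hf : IsSoftTest f) (h0 : 0 ≤ t) (h1 : t ≤ 1) :
    info (mixture t μ ν) f = binEntropy ((1 - t) * ∫ x, f x ∂μ + t * ∫ x, f x ∂ν) -
      ((1 - t) * ∫ x, binEntropy (f x) ∂μ + t * ∫ x, binEntropy (f x) ∂ν) := by
  rw [info, integral_mixture h0 h1 hf.integrable hf.integrable,
    integral_mixture h0 h1 hf.integrable_binEntropy hf.integrable_binEntropy]

end Mixture

lemma isAdmissibleInput_mixture {P t : ℝ} {μ ν : Measure ℝ} (hμ : IsAdmissibleInput P μ)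
    (hν : IsAdmissibleInput P ν) (h0 : 0 ≤ t) (h1 : t ≤ 1) :
    IsAdmissibleInput P (mixture t μ ν) where
  isProbabilityMeasure := by
    have := hμ.isProbabilityMeasure
    have := hν.isProbabilityMeasure
    exact ⟨by simp [mixture, ofReal_one_sub_add_ofReal h0 h1]⟩
  power_le := by
    rw [mixture, lintegral_add_measure, lintegral_smul_measure, lintegral_smul_measure,
      smul_eq_mul, smul_eq_mul]
    calc _ ≤ ENNReal.ofReal (1 - t) * ENNReal.ofReal P + ENNReal.ofReal t * ENNReal.ofReal P :=
          add_le_add (mul_le_mul_right hμ.power_le _) (mul_le_mul_right hν.power_le _)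
      _ = ENNReal.ofReal P := by rw [← add_mul, ofReal_one_sub_add_ofReal h0 h1, one_mul]

section Multiplier

variable {Ψ : ℝ → ℝ} {K l P : ℝ}

lemma div_sub_le_div_sub_of_two_point
    (hΨ : ∀ p a b, 0 ≤ p → p ≤ 1 → p * a ^ 2 + (1 - p) * b ^ 2 ≤ P →
      p * Ψ a + (1 - p) * Ψ b ≤ K) {x y : ℝ} (hx : x ^ 2 < P) (hy : P < y ^ 2) :
    (Ψ y - K) / (y ^ 2 - P) ≤ (K - Ψ x) / (P - x ^ 2) := by
  have hxy : 0 < y ^ 2 - x ^ 2 := by linarith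
  have hle := hΨ ((y ^ 2 - P) / (y ^ 2 - x ^ 2)) x y (div_nonneg (by linarith) hxy.le)
    ((div_le_one hxy).2 (by linarith)) (le_of_eq (by field_simp; ring))
  have hcombine : (y ^ 2 - P) / (y ^ 2 - x ^ 2) * Ψ x +
      (1 - (y ^ 2 - P) / (y ^ 2 - x ^ 2)) * Ψ y =
      ((y ^ 2 - P) * Ψ x + (P - x ^ 2) * Ψ y) / (y ^ 2 - x ^ 2) := by
    field_simp
    ring
  rw [hcombine, div_le_iff₀ hxy] at hle
  rw [div_le_div_iff₀ (by linarith) (by linarith)]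
  linarith

lemma exists_forall_le_of_two_point (hP : 0 < P)
    (hΨ : ∀ p a b, 0 ≤ p → p ≤ 1 → p * a ^ 2 + (1 - p) * b ^ 2 ≤ P →
      p * Ψ a + (1 - p) * Ψ b ≤ K) : ∃ l, ∀ x, Ψ x ≤ K + l * (x ^ 2 - P) := by
  obtain ⟨l, hl, hl'⟩ := exists_between_of_forall_le
    (s := (fun y : ℝ ↦ (Ψ y - K) / (y ^ 2 - P)) '' {y | P < y ^ 2})
    (t := (fun x : ℝ ↦ (K - Ψ x) / (P - x ^ 2)) '' {x | x ^ 2 < P})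
    ⟨_, P + 1, show P < (P + 1) ^ 2 by nlinarith, rfl⟩ ⟨_, 0, show (0 : ℝ) ^ 2 < P by simpa, rfl⟩
    (forall_mem_image.2 fun _ hy ↦ forall_mem_image.2 fun _ hx ↦
      div_sub_le_div_sub_of_two_point hΨ hx hy)
  refine ⟨l, fun x ↦ ?_⟩
  rcases lt_trichotomy (x ^ 2) P with hx | hx | hx
  · have hle := hl' ⟨x, hx, rfl⟩
    rw [le_div_iff₀ (by linarith)] at hle
    linarith
  · have hle := hΨ 1 x x zero_le_one le_rfl (by linarith)
    rw [hx]
    linarith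
  · have hle := hl ⟨x, hx, rfl⟩
    rw [div_le_iff₀ (by linarith)] at hle
    linarith

lemma nonneg_of_forall_le_add_mul {m : ℝ} (hΨ : ∀ x, m ≤ Ψ x)
    (hle : ∀ x, Ψ x ≤ K + l * (x ^ 2 - P)) : 0 ≤ l := by
  by_contra! hl
  have hlim : Tendsto (fun x : ℝ ↦ K + l * (x ^ 2 - P)) atTop atBot :=
    tendsto_atBot_add_const_left _ _ (Tendsto.const_mul_atTop_of_neg hl
      (tendsto_atTop_add_const_right _ _ (tendsto_pow_atTop two_ne_zero)))
  obtain ⟨x, hx⟩ := (hlim.eventually_lt_atBot m).exists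
  exact ((hΨ x).trans (hle x)).not_gt hx

lemma ae_eq_of_forall_le_add_mul {μ : Measure ℝ} [IsProbabilityMeasure μ]
    (hμ : Integrable (fun x ↦ x ^ 2) μ) (hpower : ∫ x, x ^ 2 ∂μ = P) (hΨ : Integrable Ψ μ)
    (hK : ∫ x, Ψ x ∂μ = K) (hle : ∀ x, Ψ x ≤ K + l * (x ^ 2 - P)) :
    ∀ᵐ x ∂μ, Ψ x = K + l * (x ^ 2 - P) := by
  have hcentred : Integrable (fun x ↦ x ^ 2 - P) μ := hμ.sub (integrable_const _)
  have hbound : Integrable (fun x ↦ K + l * (x ^ 2 - P)) μ :=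
    (integrable_const _).add (hcentred.const_mul _)
  refine (integral_eq_iff_of_ae_le hΨ hbound (ae_of_all _ hle)).1 ?_
  rw [integral_add (integrable_const _) (hcentred.const_mul _), integral_const_mul,
    integral_sub hμ (integrable_const _), hpower, hK]
  simp

end Multiplier

namespace IsOptimal

variable {P : ℝ} {μ : Measure ℝ} {D : Set ℝ}

/-- The derivative of the mutual information at `μ` in the direction of `ν` is nonpositive. -/
lemma integral_binaryDivergence_le_info (h : IsOptimal P μ D) (hP : 0 < P) {ν : Measure ℝ}
    (hν : IsAdmissibleInput P ν) :
    ∫ x, binaryDivergence (response (hardTest D) x) (∫ x, response (hardTest D) x ∂μ) ∂ν ≤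
      info μ (response (hardTest D)) := by
  have := h.isProbabilityMeasure
  have := hν.isProbabilityMeasure
  have hproper := h.isProperTest hP
  have hf := h.isSoftTest.isSoftTest_response
  have hq0 : 0 < ∫ x, response (hardTest D) x ∂μ := hproper.integral_response_pos
  have hq1 : ∫ x, response (hardTest D) x ∂μ < 1 := hproper.integral_response_lt_one
  have hmix (t : ℝ) (h0 : 0 ≤ t) (h1 : t ≤ 1) := h.info_le _
    (isAdmissibleInput_mixture h.isAdmissibleInput hν h0 h1) D h.measurableSet
  rw [hf.integral_binaryDivergence]
  set f := response (hardTest D)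
  set q := ∫ x, f x ∂μ with hq
  have hderiv : HasDerivAt (fun t : ℝ ↦ binEntropy (q + t * (∫ x, f x ∂ν - q)))
      (entropySlope q * (∫ x, f x ∂ν - q)) 0 := by
    have hline : HasDerivAt (fun t : ℝ ↦ q + t * (∫ x, f x ∂ν - q)) (∫ x, f x ∂ν - q) 0 := by
      simpa using ((hasDerivAt_id (0 : ℝ)).mul_const (∫ x, f x ∂ν - q)).const_add q
    have hentropy : HasDerivAt binEntropy (entropySlope q) (q + 0 * (∫ x, f x ∂ν - q)) := by
      rw [zero_mul, add_zero]
      exact hasDerivAt_binEntropy hq0.ne' hq1.ne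
    exact hentropy.comp 0 hline
  have hslope := le_of_hasDerivAt_zero_of_le_add_mul hderiv
    (c := ∫ x, binEntropy (f x) ∂ν - ∫ x, binEntropy (f x) ∂μ) fun t h0 h1 ↦ by
      have hle := hmix t h0 h1
      rw [info_mixture hf h0 h1, info, ← hq,
        show (1 - t) * q + t * ∫ x, f x ∂ν = q + t * (∫ x, f x ∂ν - q) by ring] at hle
      rw [zero_mul, add_zero]
      linarith
  rw [info]
  linarith

lemma exists_multiplier (h : IsOptimal P μ D) (hP : 0 < P) :
    ∃ l : ℝ, 0 ≤ l ∧
      (∀ x, binaryDivergence (response (hardTest D) x) (∫ x, response (hardTest D) x ∂μ) ≤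
        info μ (response (hardTest D)) + l * (x ^ 2 - P)) ∧
      ∀ᵐ x ∂μ, binaryDivergence (response (hardTest D) x) (∫ x, response (hardTest D) x ∂μ) =
        info μ (response (hardTest D)) + l * (x ^ 2 - P) := by
  have := h.isProbabilityMeasure
  have hf := h.isSoftTest.isSoftTest_response
  obtain ⟨l, hle⟩ := exists_forall_le_of_two_point hP
    (Ψ := fun x ↦ binaryDivergence (response (hardTest D) x) (∫ x, response (hardTest D) x ∂μ))
    (K := info μ (response (hardTest D))) fun p a b hp0 hp1 hab ↦
      (integral_two_point hp0 hp1 a b _).symm.trans_le <|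
        h.integral_binaryDivergence_le_info hP (isAdmissibleInput_two_point hp0 hp1 hab)
  exact ⟨l, nonneg_of_forall_le_add_mul (fun x ↦ neg_le_binaryDivergence (hf.nonneg x)
    (hf.le_one x) hf.integral_nonneg hf.integral_le_one) hle, hle,
    ae_eq_of_forall_le_add_mul h.integrable_sq (h.integral_sq hP)
      (hf.integrable_binaryDivergence _) hf.integral_binaryDivergence_integral hle⟩

end IsOptimal

/-! ### The Gaussian distribution function and hazard rate -/

/-- The standard normal distribution function. -/
def gaussCDF (u : ℝ) : ℝ := cdf (gaussianReal 0 1) u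

lemma gaussCDF_eq_integral (u : ℝ) : gaussCDF u = ∫ y in Iic u, gaussPDF y := by
  rw [gaussCDF, cdf_eq_real, measureReal_def, gaussianReal_apply_eq_integral 0 one_ne_zero,
    ENNReal.toReal_ofReal (setIntegral_nonneg measurableSet_Iic fun y _ ↦
      gaussianPDFReal_nonneg 0 1 y)]
  rfl

lemma hasDerivAt_gaussCDF (u : ℝ) : HasDerivAt gaussCDF (gaussPDF u) u := by
  have h : gaussCDF = fun v ↦ gaussCDF 0 + ∫ y in (0 : ℝ)..v, gaussPDF y := by
    ext v
    rw [← intervalIntegral.integral_Iic_sub_Iic integrable_gaussPDF.integrableOn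
      integrable_gaussPDF.integrableOn, gaussCDF_eq_integral, gaussCDF_eq_integral,
      add_sub_cancel]
  rw [h]
  exact (intervalIntegral.integral_hasDerivAt_right (continuous_gaussPDF.intervalIntegrable _ _)
    (continuous_gaussPDF.stronglyMeasurableAtFilter _ _) continuous_gaussPDF.continuousAt).const_add
    _

lemma tendsto_gaussCDF_atTop : Tendsto gaussCDF atTop (𝓝 1) := tendsto_cdf_atTop _

lemma strictMono_gaussCDF : StrictMono gaussCDF :=
  strictMono_of_deriv_pos fun u ↦ by rw [(hasDerivAt_gaussCDF u).deriv]; exact gaussPDF_pos u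

lemma gaussCDF_pos (u : ℝ) : 0 < gaussCDF u :=
  (cdf_nonneg _ (u - 1)).trans_lt (strictMono_gaussCDF (sub_one_lt u))

lemma gaussCDF_lt_one (u : ℝ) : gaussCDF u < 1 :=
  (strictMono_gaussCDF (lt_add_one u)).trans_le (cdf_le_one _ _)

lemma one_sub_gaussCDF_pos (u : ℝ) : 0 < 1 - gaussCDF u := sub_pos.2 (gaussCDF_lt_one u)

lemma response_hardTest_Ioi (τ x : ℝ) : response (hardTest (Ioi τ)) x = gaussCDF (x - τ) := by
  have hmap := gaussianReal_map_const_sub (μ := 0) (v := 1) x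
  rw [sub_zero] at hmap
  rw [response_hardTest measurableSet_Ioi, ← hmap,
    map_measureReal_apply (measurable_const_sub x) measurableSet_Ioi, preimage_const_sub_Ioi,
    gaussCDF, cdf_eq_real]
  have := nullSingletonClass_gaussianReal (μ := 0) (v := 1) one_ne_zero
  exact measureReal_congr Iio_ae_eq_Iic

lemma response_hardTest_Ioo {a b : ℝ} (hab : a < b) (x : ℝ) :
    response (hardTest (Ioo a b)) x = gaussCDF (x - a) - gaussCDF (x - b) := by
  rw [← response_hardTest_Ioi, ← response_hardTest_Ioi, response_hardTest measurableSet_Ioo,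
    response_hardTest measurableSet_Ioi, response_hardTest measurableSet_Ioi,
    ← measureReal_sdiff (Ioi_subset_Ioi hab.le) measurableSet_Ioi, Ioi_sdiff_Ioi]
  have := nullSingletonClass_gaussianReal (μ := x) (v := 1) one_ne_zero
  exact measureReal_congr Ioo_ae_eq_Ioc

lemma gaussCDF_neg (u : ℝ) : gaussCDF (-u) = 1 - gaussCDF u := by
  have h : gaussCDF u + ∫ y in Ioi u, gaussPDF y = 1 := by
    rw [gaussCDF_eq_integral, ← integral_gaussPDF, ← compl_Iic,
      integral_add_compl measurableSet_Iic integrable_gaussPDF]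
  have hneg : gaussCDF (-u) = ∫ y in Ioi u, gaussPDF y := by
    rw [gaussCDF_eq_integral, ← neg_neg u, ← integral_comp_neg_Iic, neg_neg]
    simp only [gaussPDF_neg]
  rw [hneg, eq_sub_iff_add_eq', h]

lemma gaussCDF_zero : gaussCDF 0 = 1 / 2 := by
  have := gaussCDF_neg 0
  rw [neg_zero] at this
  linarith

lemma tendsto_mul_gaussPDF_atTop : Tendsto (fun u ↦ u * gaussPDF u) atTop (𝓝 0) := by
  have hlim := ((tendsto_rpow_abs_mul_exp_neg_mul_sq_cocompact (a := 1 / 2) one_half_pos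
    1).mono_left atTop_le_cocompact).const_mul (√(2 * π))⁻¹
  rw [mul_zero] at hlim
  refine hlim.congr' ((eventually_ge_atTop 0).mono fun u hu ↦ ?_)
  simp only [gaussPDF_eq, rpow_one, abs_of_nonneg hu]
  ring_nf

lemma tendsto_gaussPDF_atTop : Tendsto gaussPDF atTop (𝓝 0) :=
  squeeze_zero' (Eventually.of_forall gaussPDF_nonneg)
    (eventually_atTop.2 ⟨1, fun u hu ↦ le_mul_of_one_le_left (gaussPDF_nonneg u) hu⟩)
    tendsto_mul_gaussPDF_atTop

lemma pos_of_deriv_neg_of_tendsto {f f' : ℝ → ℝ} (hf : ∀ u, HasDerivAt f (f' u) u)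
    (hneg : ∀ u, f' u < 0) (hlim : Tendsto f atTop (𝓝 0)) (u : ℝ) : 0 < f u := by
  have hanti : StrictAnti f := strictAnti_of_deriv_neg fun u ↦ by rw [(hf u).deriv]; exact hneg u
  exact (hanti.antitone.le_of_tendsto hlim (u + 1)).trans_lt (hanti (lt_add_one u))

lemma mul_gaussPDF_lt_mul_one_sub_gaussCDF (u : ℝ) :
    u * gaussPDF u < (1 + u ^ 2) * (1 - gaussCDF u) := by
  have hden (v : ℝ) : 0 < 1 + v ^ 2 := by positivity
  have hderiv (v : ℝ) : HasDerivAt (fun u ↦ 1 - gaussCDF u - u * gaussPDF u / (1 + u ^ 2))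
      (-(2 * gaussPDF v / (1 + v ^ 2) ^ 2)) v := by
    have hnum := (hasDerivAt_id v).fun_mul (hasDerivAt_gaussPDF v)
    have hsq : HasDerivAt (fun u : ℝ ↦ 1 + u ^ 2) (2 * v) v := by
      simpa using (hasDerivAt_pow 2 v).const_add 1
    refine (((hasDerivAt_gaussCDF v).const_sub 1).sub
      (hnum.fun_div hsq (hden v).ne')).congr_deriv ?_
    have := (hden v).ne'
    simp only [id]
    field_simp
    ring
  have hquot : Tendsto (fun u ↦ u * gaussPDF u / (1 + u ^ 2)) atTop (𝓝 0) :=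
    squeeze_zero'
      (eventually_atTop.2
        ⟨0, fun u hu ↦ div_nonneg (mul_nonneg hu (gaussPDF_nonneg u)) (hden u).le⟩)
      (eventually_atTop.2 ⟨0, fun u hu ↦ div_le_self (mul_nonneg hu (gaussPDF_nonneg u))
        (le_add_of_nonneg_right (sq_nonneg u))⟩) tendsto_mul_gaussPDF_atTop
  have hlim : Tendsto (fun u ↦ 1 - gaussCDF u - u * gaussPDF u / (1 + u ^ 2)) atTop (𝓝 0) := by
    simpa using (tendsto_gaussCDF_atTop.const_sub 1).sub hquot
  have hpos := pos_of_deriv_neg_of_tendsto hderiv (fun v ↦ neg_neg_of_pos <|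
    div_pos (mul_pos two_pos (gaussPDF_pos v)) (pow_pos (hden v) 2)) hlim u
  rw [sub_pos, div_lt_iff₀ (hden u)] at hpos
  linarith

/-- The hazard rate of the standard normal distribution. -/
def hazardRate (u : ℝ) : ℝ := gaussPDF u / (1 - gaussCDF u)

lemma hazardRate_pos (u : ℝ) : 0 < hazardRate u := div_pos (gaussPDF_pos u) (one_sub_gaussCDF_pos u)

lemma hazardRate_neg (u : ℝ) : hazardRate (-u) = gaussPDF u / gaussCDF u := by
  rw [hazardRate, gaussPDF_neg, gaussCDF_neg, sub_sub_cancel]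

lemma hasDerivAt_hazardRate (u : ℝ) :
    HasDerivAt hazardRate (hazardRate u * (hazardRate u - u)) u := by
  have hne := (one_sub_gaussCDF_pos u).ne'
  refine ((hasDerivAt_gaussPDF u).fun_div
    ((hasDerivAt_gaussCDF u).const_sub 1) hne).congr_deriv ?_
  rw [hazardRate]
  field_simp
  ring

lemma hasDerivAt_hazardRate_neg (u : ℝ) :
    HasDerivAt (fun v ↦ hazardRate (-v)) (-(hazardRate (-u) * (hazardRate (-u) + u))) u := by
  simpa [Function.comp_def] using (hasDerivAt_hazardRate (-u)).comp u (hasDerivAt_neg u)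

lemma hazardRate_mul_sub_lt_one (u : ℝ) : hazardRate u * (hazardRate u - u) < 1 := by
  have hderiv (v : ℝ) : HasDerivAt
      (fun u ↦ (1 - gaussCDF u) ^ 2 + u * gaussPDF u * (1 - gaussCDF u) - gaussPDF u ^ 2)
      (gaussPDF v * (v * gaussPDF v - (1 + v ^ 2) * (1 - gaussCDF v))) v := by
    have htail := (hasDerivAt_gaussCDF v).const_sub 1
    have hmul := (hasDerivAt_id v).fun_mul (hasDerivAt_gaussPDF v)
    refine (((htail.fun_pow 2).fun_add (hmul.fun_mul htail)).sub
      ((hasDerivAt_gaussPDF v).fun_pow 2)).congr_deriv ?_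
    simp only [id]
    ring
  have hlim : Tendsto
      (fun u ↦ (1 - gaussCDF u) ^ 2 + u * gaussPDF u * (1 - gaussCDF u) - gaussPDF u ^ 2)
      atTop (𝓝 0) := by
    have htail := tendsto_gaussCDF_atTop.const_sub 1
    simpa using ((htail.pow 2).add (tendsto_mul_gaussPDF_atTop.mul htail)).sub
      (tendsto_gaussPDF_atTop.pow 2)
  have hpos := pos_of_deriv_neg_of_tendsto hderiv (fun v ↦ mul_neg_of_pos_of_neg (gaussPDF_pos v)
    (sub_neg.2 (mul_gaussPDF_lt_mul_one_sub_gaussCDF v))) hlim u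
  have htail := one_sub_gaussCDF_pos u
  rw [hazardRate, div_sub' htail.ne', div_mul_div_comm, div_lt_one (by positivity)]
  nlinarith

/-! ### The Fisher information of a quantized Gaussian location -/

/-- The Fisher information about the mean `u` carried by the sign of a normal variable of unit
variance. -/
def fisher (u : ℝ) : ℝ := hazardRate u * hazardRate (-u)

/-- The logarithmic derivative of `fisher`. -/
def fisherSlope (u : ℝ) : ℝ := hazardRate u - hazardRate (-u) - 2 * u

lemma fisher_eq_div (u : ℝ) : fisher u = gaussPDF u ^ 2 / (gaussCDF u * (1 - gaussCDF u)) := by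
  rw [fisher, hazardRate_neg, hazardRate, div_mul_div_comm, ← sq, mul_comm (gaussCDF u)]

lemma fisher_pos (u : ℝ) : 0 < fisher u := mul_pos (hazardRate_pos u) (hazardRate_pos (-u))

lemma fisher_neg (u : ℝ) : fisher (-u) = fisher u := by rw [fisher, fisher, neg_neg, mul_comm]

lemma hasDerivAt_fisher (u : ℝ) : HasDerivAt fisher (fisher u * fisherSlope u) u := by
  refine ((hasDerivAt_hazardRate u).fun_mul (hasDerivAt_hazardRate_neg u)).congr_deriv ?_
  rw [fisher, fisherSlope]
  ring

lemma exists_hasDerivAt_fisherSlope (u : ℝ) : ∃ r < 0, HasDerivAt fisherSlope r u := by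
  refine ⟨_, ?_, ((hasDerivAt_hazardRate u).fun_sub (hasDerivAt_hazardRate_neg u)).fun_sub
    ((hasDerivAt_id u).const_mul 2)⟩
  linarith [hazardRate_mul_sub_lt_one u, hazardRate_mul_sub_lt_one (-u)]

lemma strictAnti_fisherSlope : StrictAnti fisherSlope :=
  strictAnti_of_deriv_neg fun u ↦ by
    obtain ⟨r, hr, hderiv⟩ := exists_hasDerivAt_fisherSlope u
    rwa [hderiv.deriv]

lemma fisherSlope_zero : fisherSlope 0 = 0 := by simp [fisherSlope]

lemma fisherSlope_neg_of_pos {u : ℝ} (hu : 0 < u) : fisherSlope u < 0 :=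
  fisherSlope_zero ▸ strictAnti_fisherSlope hu

lemma neg_two_mul_le_fisherSlope {u : ℝ} (hu : 0 ≤ u) : -2 * u ≤ fisherSlope u := by
  have hhalf : 1 / 2 ≤ gaussCDF u := gaussCDF_zero ▸ strictMono_gaussCDF.monotone hu
  have hle : hazardRate (-u) ≤ hazardRate u := by
    rw [hazardRate_neg]
    exact div_le_div_of_nonneg_left (gaussPDF_nonneg u) (one_sub_gaussCDF_pos u) (by linarith)
  rw [fisherSlope]
  linarith

lemma strictAntiOn_fisher : StrictAntiOn fisher (Ici 0) := by
  refine strictAntiOn_of_deriv_neg (convex_Ici 0)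
    (fun u _ ↦ (hasDerivAt_fisher u).continuousAt.continuousWithinAt) fun u hu ↦ ?_
  rw [interior_Ici] at hu
  rw [(hasDerivAt_fisher u).deriv]
  exact mul_neg_of_pos_of_neg (fisher_pos u) (fisherSlope_neg_of_pos hu)

lemma exists_hasDerivAt_fisher_quotient {v : ℝ} (hv : v ∈ Ioo (0 : ℝ) 1) : ∃ d > 0,
    HasDerivAt (fun v ↦ fisher v * (1 - v * fisherSlope v) / (1 - v ^ 2)) d v := by
  obtain ⟨r, hr, hslope⟩ := exists_hasDerivAt_fisherSlope v
  have hw : 0 < 1 - v ^ 2 := by nlinarith [hv.1, hv.2]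
  have hfactor := ((hasDerivAt_id v).fun_mul hslope).const_sub 1
  have hden : HasDerivAt (fun v : ℝ ↦ 1 - v ^ 2) (-(2 * v)) v := by
    simpa using (hasDerivAt_pow 2 v).const_sub 1
  refine ⟨_, div_pos ?_ (pow_pos hw 2),
    ((hasDerivAt_fisher v).fun_mul hfactor).fun_div hden hw.ne'⟩
  have hk := fisher_pos v
  have hs := fisherSlope_neg_of_pos hv.1
  have hs' := neg_two_mul_le_fisherSlope hv.1.le
  set s := fisherSlope v
  set k := fisher v
  have hnum : (k * s * (1 - v * s) + k * -(1 * s + v * r)) * (1 - v ^ 2) -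
      k * (1 - v * s) * -(2 * v) =
      k * v * (2 - 2 * (v * s) - s ^ 2 * (1 - v ^ 2) + -r * (1 - v ^ 2)) := by ring
  have hsq : s ^ 2 * (1 - v ^ 2) ≤ 1 := by
    have : s ^ 2 ≤ 4 * v ^ 2 := by nlinarith [hv.1]
    nlinarith [mul_le_mul_of_nonneg_right this hw.le, sq_nonneg (2 * v ^ 2 - 1)]
  have hr' : 0 < -r * (1 - v ^ 2) := mul_pos (neg_pos.2 hr) hw
  have hvs : v * s ≤ 0 := mul_nonpos_of_nonneg_of_nonpos hv.1.le hs.le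
  simp only [id]
  rw [hnum]
  exact mul_pos (mul_pos hk hv.1) (by linarith)

lemma strictMonoOn_fisher_quotient :
    StrictMonoOn (fun v ↦ fisher v * (1 - v * fisherSlope v) / (1 - v ^ 2)) (Ioo 0 1) := by
  refine strictMonoOn_of_deriv_pos (convex_Ioo 0 1) (fun v hv ↦ ?_) fun v hv ↦ ?_
  · obtain ⟨d, -, hd⟩ := exists_hasDerivAt_fisher_quotient hv
    exact hd.continuousAt.continuousWithinAt
  · rw [interior_Ioo] at hv
    obtain ⟨d, hpos, hd⟩ := exists_hasDerivAt_fisher_quotient hv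
    rwa [hd.deriv]

/-! ### Counting contact points -/

lemma exists_injective_deriv_eq_zero {f f' : ℝ → ℝ} (hf : ∀ x, HasDerivAt f (f' x) x) {n : ℕ}
    {z : Fin (n + 1) → ℝ} (hz : StrictMono z) {c : ℝ} (hc : ∀ i, f (z i) = c) :
    ∃ w : Fin n → ℝ, Function.Injective w ∧ (∀ i, f' (w i) = 0) ∧ ∀ i j, w i ≠ z j := by
  have hrolle (i : Fin n) : ∃ w ∈ Ioo (z i.castSucc) (z i.succ), f' w = 0 :=
    exists_hasDerivAt_eq_zero (hz i.castSucc_lt_succ)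
      (fun x _ ↦ (hf x).continuousAt.continuousWithinAt) ((hc _).trans (hc _).symm) fun x _ ↦ hf x
  choose w hw hw0 using hrolle
  have hmono : StrictMono w := fun i j hij ↦
    (hw i).2.trans_le ((hz.monotone (Fin.succ_le_castSucc_iff.2 hij)).trans (hw j).1.le)
  refine ⟨w, hmono.injective, hw0, fun i j hij ↦ ?_⟩
  rcases le_or_gt j i.castSucc with hj | hj
  · exact ((hz.monotone hj).trans_lt (hw i).1).ne' hij
  · exact ((hw i).2.trans_le (hz.monotone (Fin.castSucc_lt_iff_succ_le.1 hj))).ne hij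

lemma natCast_le_encard_deriv_eq_zero {f f' : ℝ → ℝ} (hf : ∀ x, HasDerivAt f (f' x) x) {c : ℝ}
    {n : ℕ} (h : (n : ℕ∞) < {x | f x = c}.encard) : (n : ℕ∞) ≤ {x | f' x = 0}.encard := by
  obtain ⟨z, hz, hzc⟩ := exists_strictMono_of_lt_encard h
  obtain ⟨w, hw, hw0, -⟩ := exists_injective_deriv_eq_zero hf hz hzc
  calc (n : ℕ∞) = (range w).encard := by simp [← image_univ, hw.encard_image]
    _ ≤ {x | f' x = 0}.encard := encard_le_encard (range_subset_iff.2 hw0)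

lemma two_mul_lt_encard_deriv_eq_zero {f f' : ℝ → ℝ} (hf : ∀ x, HasDerivAt f (f' x) x) {c : ℝ}
    (hle : ∀ x, f x ≤ c) {n : ℕ} (h : (n : ℕ∞) < {x | f x = c}.encard) :
    ((2 * n : ℕ) : ℕ∞) < {x | f' x = 0}.encard := by
  obtain ⟨z, hz, hzc⟩ := exists_strictMono_of_lt_encard h
  obtain ⟨w, hw, hw0, hwz⟩ := exists_injective_deriv_eq_zero hf hz hzc
  have hz0 (i : Fin (n + 1)) : f' (z i) = 0 :=
    IsLocalMax.hasDerivAt_eq_zero (Eventually.of_forall fun x ↦ (hle x).trans (hzc i).ge) (hf (z i))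
  have hinj : Function.Injective (Sum.elim w z) := hw.sumElim hz.injective hwz
  calc ((2 * n : ℕ) : ℕ∞) < ((n + (n + 1) : ℕ) : ℕ∞) := by exact_mod_cast (by lia)
    _ = (range (Sum.elim w z)).encard := by simp [← image_univ, hinj.encard_image]
    _ ≤ {x | f' x = 0}.encard :=
      encard_le_encard (range_subset_iff.2 (Sum.forall.2 ⟨hw0, hz0⟩))

lemma exists_fisher_quotient_eq {l τ a b : ℝ} (ha : 0 < a) (hab : a < b) (hb : b < 1)
    (hfa : fisher a = 2 * l * (1 + a ^ 2 - τ * a)) (hfb : fisher b = 2 * l * (1 + b ^ 2 - τ * b)) :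
    ∃ c ∈ Ioo a b, fisher c * (1 - c * fisherSlope c) / (1 - c ^ 2) = 2 * l := by
  have hderiv {v : ℝ} (hv : 0 < v) : HasDerivAt (fun v ↦ (fisher v - 2 * l * (1 + v ^ 2)) / v)
      (((fisher v * fisherSlope v - 2 * l * (2 * v)) * v - (fisher v - 2 * l * (1 + v ^ 2))) /
        v ^ 2) v := by
    have hsq : HasDerivAt (fun v : ℝ ↦ 2 * l * (1 + v ^ 2)) (2 * l * (2 * v)) v := by
      simpa using ((hasDerivAt_pow 2 v).const_add 1).const_mul (2 * l)
    refine (((hasDerivAt_fisher v).fun_sub hsq).fun_div (hasDerivAt_id v) hv.ne').congr_deriv ?_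
    simp
  have hval {v : ℝ} (hv : 0 < v) (hfv : fisher v = 2 * l * (1 + v ^ 2 - τ * v)) :
      (fisher v - 2 * l * (1 + v ^ 2)) / v = -(2 * l * τ) := by
    rw [hfv]
    field_simp
    ring
  obtain ⟨c, hc, hc0⟩ := exists_hasDerivAt_eq_zero hab
    (fun x hx ↦ (hderiv (ha.trans_le hx.1)).continuousAt.continuousWithinAt)
    ((hval ha hfa).trans (hval (ha.trans hab) hfb).symm) (fun x hx ↦ hderiv (ha.trans hx.1))
  have hcpos : 0 < c := ha.trans hc.1
  have hden : 0 < 1 - c ^ 2 := by nlinarith [hc.2]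
  have hnum := (div_eq_zero_iff.1 hc0).resolve_right (pow_pos hcpos 2).ne'
  refine ⟨c, hc, ?_⟩
  rw [div_eq_iff hden.ne']
  linarith

lemma not_three_fisher_eq {l τ : ℝ} (hl : 0 ≤ l) {v₁ v₂ v₃ : ℝ} (h₀ : 0 < v₁) (h₁₂ : v₁ < v₂)
    (h₂₃ : v₂ < v₃) (h₃ : v₃ < τ / 2) (hf₁ : fisher v₁ = 2 * l * (1 + v₁ ^ 2 - τ * v₁))
    (hf₂ : fisher v₂ = 2 * l * (1 + v₂ ^ 2 - τ * v₂))
    (hf₃ : fisher v₃ = 2 * l * (1 + v₃ ^ 2 - τ * v₃)) : False := by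
  have hv₃ : v₃ < 1 := by
    by_contra! hge
    have hpos := fisher_pos v₃
    rw [hf₃] at hpos
    have := pos_of_mul_pos_right hpos (by positivity)
    nlinarith
  obtain ⟨c, hc, hceq⟩ := exists_fisher_quotient_eq h₀ h₁₂ (h₂₃.trans hv₃) hf₁ hf₂
  obtain ⟨d, hd, hdeq⟩ := exists_fisher_quotient_eq (h₀.trans h₁₂) h₂₃ hv₃ hf₂ hf₃
  have hcd : c < d := hc.2.trans hd.1
  have hc0 : 0 < c := h₀.trans hc.1
  have hd1 : d < 1 := hd.2.trans hv₃
  exact (strictMonoOn_fisher_quotient ⟨hc0, hcd.trans hd1⟩ ⟨hc0.trans hcd, hd1⟩ hcd).ne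
    (hceq.trans hdeq.symm)

-- On `[0, ∞)` and on `(-∞, -τ / 2]` the two sides are monotone in opposite senses, so only one of
-- five solutions can lie in each, and the other three lie in `(-τ / 2, 0)`.
lemma not_five_fisher_eq_of_nonneg {l τ : ℝ} (hl : 0 ≤ l) (hτ : 0 ≤ τ) {z : Fin 5 → ℝ}
    (hz : StrictMono z) (h : ∀ i, fisher (z i) = 2 * l * (1 + z i * (z i + τ))) : False := by
  have h₀₁ : z 0 < z 1 := hz (by decide)
  have h₁₂ : z 1 < z 2 := hz (by decide)
  have h₂₃ : z 2 < z 3 := hz (by decide)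
  have h₃₄ : z 3 < z 4 := hz (by decide)
  have hz₁ : -(τ / 2) < z 1 := by
    by_contra! hle
    have hlt : fisher (-z 0) < fisher (-z 1) := strictAntiOn_fisher
      (show (0 : ℝ) ≤ -z 1 by linarith) (show (0 : ℝ) ≤ -z 0 by linarith) (by linarith)
    rw [fisher_neg, fisher_neg, h 0, h 1] at hlt
    have := mul_nonneg hl (mul_nonneg (sub_nonneg.2 h₀₁.le)
      (show 0 ≤ -(z 0 + z 1 + τ) by linarith))
    nlinarith
  have hz₃ : z 3 < 0 := by
    by_contra! hge
    have hlt : fisher (z 4) < fisher (z 3) := strictAntiOn_fisher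
      (show (0 : ℝ) ≤ z 3 by linarith) (show (0 : ℝ) ≤ z 4 by linarith) h₃₄
    rw [h 3, h 4] at hlt
    have := mul_nonneg hl (mul_nonneg (sub_nonneg.2 h₃₄.le)
      (show 0 ≤ z 3 + z 4 + τ by linarith))
    nlinarith
  have hneg (i : Fin 5) : fisher (-z i) = 2 * l * (1 + (-z i) ^ 2 - τ * -z i) := by
    rw [fisher_neg, h i]
    ring
  exact not_three_fisher_eq hl (show 0 < -z 3 by linarith) (show -z 3 < -z 2 by linarith)
    (show -z 2 < -z 1 by linarith) (show -z 1 < τ / 2 by linarith) (hneg 3) (hneg 2) (hneg 1)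

lemma encard_fisher_eq_le {l : ℝ} (hl : 0 ≤ l) (τ : ℝ) :
    {v | fisher v = 2 * l * (1 + v * (v + τ))}.encard ≤ 4 := by
  by_contra! hlt
  obtain ⟨z, hz, hzmem⟩ := exists_strictMono_of_lt_encard (n := 4) hlt
  rcases le_total 0 τ with hτ | hτ
  · exact not_five_fisher_eq_of_nonneg hl hτ hz hzmem
  · refine not_five_fisher_eq_of_nonneg (τ := -τ) (z := fun i ↦ -z i.rev) hl (neg_nonneg.2 hτ)
      (fun i j hij ↦ neg_lt_neg (hz (Fin.rev_lt_rev.2 hij))) fun i ↦ ?_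
    rw [fisher_neg, show fisher (z i.rev) = _ from hzmem i.rev]
    ring

lemma hasDerivAt_entropySlope {p : ℝ} (h0 : 0 < p) (h1 : p < 1) :
    HasDerivAt entropySlope (-(1 / (p * (1 - p)))) p := by
  have hp := (sub_pos.2 h1).ne'
  refine ((((hasDerivAt_id p).const_sub 1).log hp).sub (hasDerivAt_log h0.ne')).congr_deriv ?_
  simp only [id]
  field_simp
  ring

lemma hasDerivAt_binaryDivergence {p : ℝ} (h0 : 0 < p) (h1 : p < 1) (q : ℝ) :
    HasDerivAt (fun p ↦ binaryDivergence p q) (entropySlope q - entropySlope p) p := by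
  refine (((hasDerivAt_binEntropy h0.ne' h1.ne).const_sub _).add
    (((hasDerivAt_id p).sub_const q).const_mul _)).congr_deriv ?_
  rw [entropySlope, entropySlope]
  ring

lemma entropySlope_sub_mul_eq_of_contact {f : ℝ → ℝ} {f' x q l K : ℝ} (hf : HasDerivAt f f' x)
    (h0 : 0 < f x) (h1 : f x < 1) (hle : ∀ y, binaryDivergence (f y) q ≤ K + l * y ^ 2)
    (hx : binaryDivergence (f x) q = K + l * x ^ 2) :
    (entropySlope q - entropySlope (f x)) * f' = 2 * l * x := by
  have hpar : HasDerivAt (fun x ↦ K + l * x ^ 2) (l * (2 * x)) x := by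
    simpa using ((hasDerivAt_pow 2 x).const_mul l).const_add K
  have hmax : IsLocalMax (fun x ↦ binaryDivergence (f x) q - (K + l * x ^ 2)) x :=
    Eventually.of_forall fun y ↦ by
      simp only [hx, sub_self]
      exact sub_nonpos.2 (hle y)
  have := hmax.hasDerivAt_eq_zero (((hasDerivAt_binaryDivergence h0 h1 q).comp x hf).fun_sub hpar)
  linarith

lemma hasDerivAt_entropySlope_gaussCDF_sub_div (q l τ u : ℝ) :
    HasDerivAt
      (fun u ↦ entropySlope q - entropySlope (gaussCDF u) - 2 * l * (u + τ) / gaussPDF u)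
      ((fisher u - 2 * l * (1 + u * (u + τ))) / gaussPDF u) u := by
  have hpdf := (gaussPDF_pos u).ne'
  have hcdf := (gaussCDF_pos u).ne'
  have hcdf' := (one_sub_gaussCDF_pos u).ne'
  have hslope := ((hasDerivAt_entropySlope (gaussCDF_pos u) (gaussCDF_lt_one u)).comp u
    (hasDerivAt_gaussCDF u)).const_sub (entropySlope q)
  have hlin : HasDerivAt (fun u : ℝ ↦ 2 * l * (u + τ)) (2 * l) u := by
    simpa using ((hasDerivAt_id u).add_const τ).const_mul (2 * l)
  refine (hslope.sub (hlin.fun_div (hasDerivAt_gaussPDF u) hpdf)).congr_deriv ?_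
  rw [fisher_eq_div]
  field_simp
  ring

lemma encard_contact_gaussCDF_le {q l τ K : ℝ} (hl : 0 ≤ l)
    (hle : ∀ u, binaryDivergence (gaussCDF u) q ≤ K + l * (u + τ) ^ 2) :
    {u | binaryDivergence (gaussCDF u) q = K + l * (u + τ) ^ 2}.encard ≤ 3 := by
  have hgap (u : ℝ) :
      HasDerivAt (fun u ↦ binaryDivergence (gaussCDF u) q - (K + l * (u + τ) ^ 2))
        ((entropySlope q - entropySlope (gaussCDF u)) * gaussPDF u - 2 * l * (u + τ)) u := by
    refine (((hasDerivAt_binaryDivergence (gaussCDF_pos u) (gaussCDF_lt_one u) q).comp u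
      (hasDerivAt_gaussCDF u)).fun_sub
      (((((hasDerivAt_id u).add_const τ).fun_pow 2).const_mul l).const_add K)).congr_deriv ?_
    simp only [id]
    ring
  have hzero : {u | (entropySlope q - entropySlope (gaussCDF u)) * gaussPDF u - 2 * l * (u + τ) = 0}
      = {u | entropySlope q - entropySlope (gaussCDF u) - 2 * l * (u + τ) / gaussPDF u = 0} := by
    ext u
    rw [mem_ofPred_eq, mem_ofPred_eq, sub_eq_zero, sub_eq_zero, eq_div_iff (gaussPDF_pos u).ne']
  have hfisher : {u | (fisher u - 2 * l * (1 + u * (u + τ))) / gaussPDF u = 0} =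
      {u | fisher u = 2 * l * (1 + u * (u + τ))} := by
    ext u
    rw [mem_ofPred_eq, mem_ofPred_eq, div_eq_zero_iff, or_iff_left (gaussPDF_pos u).ne',
      sub_eq_zero]
  by_contra! hlt
  have hseven := two_mul_lt_encard_deriv_eq_zero hgap (fun u ↦ sub_nonpos.2 (hle u)) (n := 3)
    (by simp only [sub_eq_zero]; exact hlt)
  rw [hzero] at hseven
  have hsix := natCast_le_encard_deriv_eq_zero
    (hasDerivAt_entropySlope_gaussCDF_sub_div q l τ) hseven
  rw [hfisher] at hsix
  exact absurd (hsix.trans (encard_fisher_eq_le hl τ)) (by norm_num)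

lemma encard_quadratic_eq_zero_le {a b : ℝ} (h : a ≠ 0 ∨ b ≠ 0) (c : ℝ) :
    {x : ℝ | a * x ^ 2 + b * x + c = 0}.encard ≤ 2 := by
  set p : Polynomial ℝ :=
    Polynomial.C a * Polynomial.X ^ 2 + Polynomial.C b * Polynomial.X + Polynomial.C c with hp
  have hp0 : p ≠ 0 := by
    intro h0
    have ha : a = 0 := by
      simpa [hp, Polynomial.coeff_C, Polynomial.coeff_X] using congrArg (·.coeff 2) h0
    have hb : b = 0 := by
      simpa [hp, Polynomial.coeff_C, Polynomial.coeff_X] using congrArg (·.coeff 1) h0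
    exact h.elim (· ha) (· hb)
  have hroots : {x : ℝ | a * x ^ 2 + b * x + c = 0} = ↑p.roots.toFinset := by
    ext x
    rw [mem_ofPred_eq, Finset.mem_coe, Multiset.mem_toFinset, Polynomial.mem_roots hp0]
    simp [hp]
  rw [hroots, encard_coe_eq_coe_finsetCard]
  exact_mod_cast (Multiset.toFinset_card_le _).trans
    ((Polynomial.card_roots' p).trans Polynomial.natDegree_quadratic_le)

/-- The quadratics with mean zero under every centred law of second moment `P`. -/
def centredQuadratic (P r s x : ℝ) : ℝ := r * (x ^ 2 - P) + s * x

lemma encard_centredQuadratic_eq_zero_le {r s : ℝ} (h : r ≠ 0 ∨ s ≠ 0) (P : ℝ) :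
    {x | centredQuadratic P r s x = 0}.encard ≤ 2 := by
  have heq : {x | centredQuadratic P r s x = 0} = {x | r * x ^ 2 + s * x + -(r * P) = 0} := by
    ext x
    simp only [centredQuadratic, mem_ofPred_eq]
    ring_nf
  exact heq ▸ encard_quadratic_eq_zero_le h _

/-- The points at which `E` solves the equation obtained by eliminating the score between the
contact condition and the quadratic shape of the score of an interval test. -/
def contactSet (P l r s : ℝ) (E : ℝ → ℝ) : Set ℝ :=
  {x | centredQuadratic P r s x * E x = centredQuadratic P r s x - 2 * l * x}

section ContactSet

variable {P l r s x y : ℝ} {E : ℝ → ℝ}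

lemma centredQuadratic_mul_mul_sub (hx : x ∈ contactSet P l r s E)
    (hy : y ∈ contactSet P l r s E) :
    centredQuadratic P r s x * centredQuadratic P r s y * (E y - E x) =
      2 * (l * r) * ((y - x) * (x * y + P)) := by
  have hx' : centredQuadratic P r s x * E x = centredQuadratic P r s x - 2 * l * x := hx
  have hy' : centredQuadratic P r s y * E y = centredQuadratic P r s y - 2 * l * y := hy
  have hcross : x * centredQuadratic P r s y - y * centredQuadratic P r s x =
      r * ((y - x) * (x * y + P)) := by
    simp only [centredQuadratic]
    ring
  linear_combination centredQuadratic P r s x * hy' - centredQuadratic P r s y * hx' +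
    2 * l * hcross

lemma encard_contactSet_le_of_mul_eq_zero (hE : Function.Injective E) (hrs : r ≠ 0 ∨ s ≠ 0)
    (hlr : l * r = 0) : (contactSet P l r s E).encard ≤ 3 := by
  have hsub : {x ∈ contactSet P l r s E | centredQuadratic P r s x ≠ 0}.Subsingleton := by
    rintro x ⟨hx, hx0⟩ y ⟨hy, hy0⟩
    have hxy := centredQuadratic_mul_mul_sub hx hy
    rw [hlr, mul_zero, zero_mul] at hxy
    exact hE (sub_eq_zero.1 ((mul_eq_zero.1 hxy).resolve_left (mul_ne_zero hx0 hy0))).symm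
  calc (contactSet P l r s E).encard
      ≤ ({x | centredQuadratic P r s x = 0} ∪
          {x ∈ contactSet P l r s E | centredQuadratic P r s x ≠ 0}).encard :=
        encard_le_encard fun x hx ↦ or_iff_not_imp_left.2 fun h ↦ ⟨hx, h⟩
    _ ≤ 2 + 1 := (encard_union_le _ _).trans
        (add_le_add (encard_centredQuadratic_eq_zero_le hrs P)
          (encard_le_one_iff_subsingleton.2 hsub))
    _ = 3 := by norm_num

lemma centredQuadratic_ne_zero_of_mem_contactSet (hP : 0 < P) (hl : 0 < l) (hr : r < 0)
    (hx : x ∈ contactSet P l r s E) : centredQuadratic P r s x ≠ 0 := by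
  intro h0
  have hx' : centredQuadratic P r s x * E x = centredQuadratic P r s x - 2 * l * x := hx
  have hx0 : x = 0 := by
    refine (mul_eq_zero.1 (?_ : l * x = 0)).resolve_left hl.ne'
    rw [h0] at hx'
    linarith
  refine (mul_neg_of_neg_of_pos hr hP).ne ?_
  simp only [centredQuadratic, hx0] at h0
  linarith

lemma mul_add_neg_of_mem_contactSet (hl : 0 < l) (hr : r < 0) (hE : StrictMono E) (hxy : x < y)
    (hx : x ∈ contactSet P l r s E) (hy : y ∈ contactSet P l r s E)
    (hpos : 0 < centredQuadratic P r s x * centredQuadratic P r s y) : x * y + P < 0 := by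
  have hprod : 0 < 2 * (l * r) * ((y - x) * (x * y + P)) :=
    centredQuadratic_mul_mul_sub hx hy ▸ mul_pos hpos (sub_pos.2 (hE hxy))
  have hlr : 2 * (l * r) < 0 := by linarith [mul_neg_of_pos_of_neg hl hr]
  exact (pos_iff_neg_of_mul_neg (neg_of_mul_pos_right hprod hlr.le)).1 (sub_pos.2 hxy)

lemma not_lt_of_mem_contactSet (hP : 0 ≤ P) (hl : 0 < l) (hr : r < 0) (hE : StrictMono E)
    (hx : x ∈ contactSet P l r s E) (hy : y ∈ contactSet P l r s E)
    (hx0 : 0 < centredQuadratic P r s x) (hy0 : 0 < centredQuadratic P r s y) : ¬ x < y := by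
  intro hxy
  have hneg := mul_add_neg_of_mem_contactSet hl hr hE hxy hx hy (mul_pos hx0 hy0)
  have hprod : x * y < 0 := by linarith
  obtain ⟨hx', hy'⟩ : x < 0 ∧ 0 < y := by
    rcases mul_neg_iff.1 hprod with h | h
    · exact absurd hxy (h.2.trans h.1).asymm
    · exact h
  have hcomb : centredQuadratic P r s x * y + centredQuadratic P r s y * -x =
      r * ((x - y) * (x * y + P)) := by
    simp only [centredQuadratic]
    ring
  have hpos : 0 < r * ((x - y) * (x * y + P)) :=
    hcomb ▸ add_pos (mul_pos hx0 hy') (mul_pos hy0 (neg_pos.2 hx'))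
  exact hpos.not_gt (mul_neg_of_neg_of_pos hr (mul_pos_of_neg_of_neg (sub_neg.2 hxy) hneg))

lemma encard_contactSet_neg_le (hP : 0 ≤ P) (hl : 0 < l) (hr : r < 0) (hE : StrictMono E) :
    {x ∈ contactSet P l r s E | centredQuadratic P r s x < 0}.encard ≤ 2 := by
  by_contra! hlt
  obtain ⟨z, hz, hmem⟩ := exists_strictMono_of_lt_encard (n := 2) hlt
  have hprod (i j : Fin 3) (hij : i < j) : z i * z j < 0 := by
    linarith [mul_add_neg_of_mem_contactSet hl hr hE (hz hij) (hmem i).1 (hmem j).1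
      (mul_pos_of_neg_of_neg (hmem i).2 (hmem j).2)]
  have hneg := mul_neg_of_pos_of_neg
    (mul_pos_of_neg_of_neg (hprod 0 1 (by decide)) (hprod 1 2 (by decide))) (hprod 0 2 (by decide))
  nlinarith [sq_nonneg (z 0 * z 1 * z 2)]

lemma encard_contactSet_le (hP : 0 < P) (hl : 0 ≤ l) (hr : r ≤ 0) (hrs : r ≠ 0 ∨ s ≠ 0)
    (hE : StrictMono E) : (contactSet P l r s E).encard ≤ 3 := by
  by_cases hlr : l * r = 0
  · exact encard_contactSet_le_of_mul_eq_zero hE.injective hrs hlr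
  have hl' : 0 < l := hl.lt_of_ne' (left_ne_zero_of_mul hlr)
  have hr' : r < 0 := hr.lt_of_ne (right_ne_zero_of_mul hlr)
  have hsub : {x ∈ contactSet P l r s E | 0 < centredQuadratic P r s x}.Subsingleton :=
    fun x hx y hy ↦ le_antisymm
      (not_lt.1 (not_lt_of_mem_contactSet hP.le hl' hr' hE hy.1 hx.1 hy.2 hx.2))
      (not_lt.1 (not_lt_of_mem_contactSet hP.le hl' hr' hE hx.1 hy.1 hx.2 hy.2))
  calc (contactSet P l r s E).encard
      ≤ ({x ∈ contactSet P l r s E | centredQuadratic P r s x < 0} ∪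
          {x ∈ contactSet P l r s E | 0 < centredQuadratic P r s x}).encard :=
        encard_le_encard fun x hx ↦
          (centredQuadratic_ne_zero_of_mem_contactSet hP hl' hr' hx).lt_or_gt.imp
            (fun h ↦ ⟨hx, h⟩) fun h ↦ ⟨hx, h⟩
    _ ≤ 2 + 1 := (encard_union_le _ _).trans
        (add_le_add (encard_contactSet_neg_le hP.le hl' hr' hE)
          (encard_le_one_iff_subsingleton.2 hsub))
    _ = 3 := by norm_num

end ContactSet

lemma Icc_subset_closure_interior_Ioo {a b : ℝ} (hab : a < b) :
    Icc a b ⊆ closure (interior (Ioo a b)) := by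
  rw [isOpen_Ioo.interior_eq, closure_Ioo hab.ne]

lemma Iic_subset_closure_interior_compl_Ioo (a b : ℝ) :
    Iic a ⊆ closure (interior (Ioo a b)ᶜ) := by
  rw [← closure_Iio]
  exact closure_mono (isOpen_Iio.subset_interior_iff.2 fun x hx hx' ↦ lt_asymm hx hx'.1)

lemma Ici_subset_closure_interior_compl_Ioo (a b : ℝ) :
    Ici b ⊆ closure (interior (Ioo a b)ᶜ) := by
  rw [← closure_Ioi]
  exact closure_mono (isOpen_Ioi.subset_interior_iff.2 fun x hx hx' ↦ lt_asymm hx hx'.2)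

namespace IsOptimal

variable {P : ℝ} {μ : Measure ℝ} {D : Set ℝ}

lemma leading_coeff_nonpos {a b : ℝ} (hab : a < b) (h : IsOptimal P μ (Ioo a b)) (hP : 0 < P)
    {r s : ℝ} (hrs : ∀ᵐ x ∂μ, score μ (response (hardTest (Ioo a b))) x * gaussPDF (a - x) =
      centredQuadratic P r s x) : r ≤ 0 := by
  by_contra! hr
  have := h.isProbabilityMeasure
  set φ := score μ (response (hardTest (Ioo a b))) with hφ
  obtain ⟨α, β, hαβ, hfactor⟩ :=
    exists_quadratic_eq_mul_of_neg (A := r * P) (B := -s) (x₀ := 0) (neg_neg_of_pos hr)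
      (by simpa using mul_pos hr hP)
  have hsign : ∀ᵐ x ∂μ, SignType.sign (-φ x) = SignType.sign ((x - α) * (β - x)) := by
    filter_upwards [hrs] with x hx
    have hx' : -φ x * gaussPDF (a - x) = r * ((x - α) * (β - x)) := by
      rw [centredQuadratic] at hx
      linear_combination -hx + hfactor x
    calc SignType.sign (-φ x) = SignType.sign (-φ x * gaussPDF (a - x)) := by
          rw [sign_mul, sign_pos (gaussPDF_pos _), mul_one]
      _ = SignType.sign ((x - α) * (β - x)) := by rw [hx', sign_mul, sign_pos hr, one_mul]
  have hneg (y : ℝ) : ∫ x, -φ x * gaussPDF (y - x) ∂μ =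
      -smoothedScore μ (response (hardTest (Ioo a b))) y := by
    simp only [neg_mul, integral_neg, smoothedScore, hφ]
  have hmid := integral_mul_gaussPDF_pos_of_sign_eq_quadratic
    ((h.isProperTest hP).integrable_score h.integrable_sq).neg
    (fun h0 ↦ h.not_score_ae_eq_zero hP (h0.mono fun x hx ↦ neg_eq_zero.1 hx)) hαβ hsign
    (left_lt_add_div_two.2 hab) (add_div_two_lt_right.2 hab)
    ((hneg a).symm ▸ neg_nonneg.2 (h.smoothedScore_nonpos hP
      (Iic_subset_closure_interior_compl_Ioo a b self_mem_Iic)))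
    ((hneg b).symm ▸ neg_nonneg.2 (h.smoothedScore_nonpos hP
      (Ici_subset_closure_interior_compl_Ioo a b self_mem_Ici)))
  rw [Pi.neg_def, hneg] at hmid
  exact (neg_pos.1 hmid).not_ge (h.smoothedScore_nonneg hP (Icc_subset_closure_interior_Ioo hab
    ⟨(left_lt_add_div_two.2 hab).le, (add_div_two_lt_right.2 hab).le⟩))

lemma exists_support_of_Ioi {τ : ℝ} (h : IsOptimal P μ (Ioi τ)) (hP : 0 < P) :
    ∃ S : Set ℝ, S.encard ≤ 3 ∧ ∀ᵐ x ∂μ, x ∈ S := by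
  obtain ⟨l, hl, hle, heq⟩ := h.exists_multiplier hP
  simp only [response_hardTest_Ioi] at hle heq
  set q := ∫ x, gaussCDF (x - τ) ∂μ
  set K := info μ (response (hardTest (Ioi τ))) - l * P with hK
  have hcontact : {u | binaryDivergence (gaussCDF u) q = K + l * (u + τ) ^ 2}.encard ≤ 3 :=
    encard_contact_gaussCDF_le hl fun u ↦ by
      have := hle (u + τ)
      rw [add_sub_cancel_right] at this
      linarith
  refine ⟨_, (encard_image_le (· + τ) _).trans hcontact, ?_⟩
  filter_upwards [heq] with x hx
  refine ⟨x - τ, ?_, sub_add_cancel x τ⟩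
  rw [mem_ofPred_eq, hx, sub_add_cancel, hK]
  ring

lemma exists_support_of_Ioo {a b : ℝ} (hab : a < b) (h : IsOptimal P μ (Ioo a b)) (hP : 0 < P)
    {A B C : ℝ} (hQ : ∀ᵐ x ∂μ, response (hardTest (Ioo a b)) x = A + B * x + C * x ^ 2) :
    ∃ S : Set ℝ, S.encard ≤ 3 ∧ ∀ᵐ x ∂μ, x ∈ S := by
  have hproper := h.isProperTest hP
  obtain ⟨l, hl, hle, heq⟩ := h.exists_multiplier hP
  obtain ⟨r, s, hrs⟩ := h.ae_score_eq_quadratic hP hQ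
    (Icc_subset_closure_interior_Ioo hab (left_mem_Icc.2 hab.le))
    (Iic_subset_closure_interior_compl_Ioo a b self_mem_Iic)
  have hne : r ≠ 0 ∨ s ≠ 0 := by
    by_contra! h0
    refine h.not_score_ae_eq_zero hP (hrs.mono fun x hx ↦ ?_)
    rw [h0.1, h0.2, zero_mul, zero_mul, zero_add] at hx
    exact (mul_eq_zero.1 hx).resolve_right (gaussPDF_pos _).ne'
  have hE : StrictMono fun x ↦ exp ((a ^ 2 - b ^ 2) / 2) * exp (x * (b - a)) := fun x y hxy ↦
    mul_lt_mul_of_pos_left (exp_lt_exp.2 (mul_lt_mul_of_pos_right hxy (sub_pos.2 hab))) (exp_pos _)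
  refine ⟨_, encard_contactSet_le hP hl (h.leading_coeff_nonpos hab hP hrs) hne hE, ?_⟩
  filter_upwards [hrs, heq] with x hx hxe
  have hderiv : HasDerivAt (response (hardTest (Ioo a b)))
      (gaussPDF (x - a) - gaussPDF (x - b)) x := by
    rw [funext (response_hardTest_Ioo hab)]
    exact ((hasDerivAt_gaussCDF _).comp_sub_const x a).sub
      ((hasDerivAt_gaussCDF _).comp_sub_const x b)
  have hcontact : score μ (response (hardTest (Ioo a b))) x *
      (gaussPDF (a - x) - gaussPDF (b - x)) = 2 * l * x := by
    rw [← gaussPDF_neg (a - x), ← gaussPDF_neg (b - x), neg_sub, neg_sub]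
    exact entropySlope_sub_mul_eq_of_contact
      (K := info μ (response (hardTest (Ioo a b))) - l * P) hderiv (hproper.response_pos x)
      (hproper.response_lt_one x) (fun y ↦ by linarith [hle y]) (by linarith)
  rw [gaussPDF_sub_eq_mul b a x] at hcontact
  change centredQuadratic P r s x * (exp ((a ^ 2 - b ^ 2) / 2) * exp (x * (b - a))) = _
  rw [centredQuadratic, ← hx]
  linear_combination -hcontact

lemma exists_support (h : IsOptimal P μ D) (hP : 0 < P) :
    ∃ S : Set ℝ, S.encard ≤ 3 ∧ ∀ᵐ x ∂μ, x ∈ S := by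
  have hparabola {ν : Measure ℝ} {α β : ℝ} (hαβ : ∀ᵐ x ∂ν, x = α + β * x ^ 2) :
      ∃ S : Set ℝ, S.encard ≤ 3 ∧ ∀ᵐ x ∂ν, x ∈ S :=
    ⟨{x | β * x ^ 2 + (-1) * x + α = 0},
      (encard_quadratic_eq_zero_le (.inr (by norm_num)) α).trans (by norm_num),
      hαβ.mono fun x hx ↦ by rw [mem_ofPred_eq]; linarith⟩
  rcases h.ae_eq_quadratic_or_ae_response_eq_quadratic hP with ⟨α, β, hαβ⟩ | ⟨A, B, C, hQ⟩
  · exact hparabola hαβ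
  rcases h.exists_isOptimal_interval hP hQ with ⟨τ, hτ⟩ | ⟨a, b, hab, hI⟩
  · exact hτ.exists_support_of_Ioi hP
  · rcases hI.ae_eq_quadratic_or_ae_response_eq_quadratic hP with ⟨α, β, hαβ⟩ | ⟨A, B, C, hQ⟩
    · exact hparabola hαβ
    · exact hI.exists_support_of_Ioo hab hP hQ

end IsOptimal

/-! ### Finitely supported measures -/

lemma eq_sum_smul_dirac_of_ae_mem {α : Type*} [MeasurableSpace α] [MeasurableSingletonClass α]
    {μ : Measure α} {S : Finset α} (h : ∀ᵐ x ∂μ, x ∈ S) :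
    μ = ∑ x ∈ S, μ {x} • Measure.dirac x := by
  classical
  ext A hA
  have hinter : A ∩ S = ((S.filter (· ∈ A) : Finset α) : Set α) := by
    ext x
    simp [and_comm]
  have hae : (A ∩ S : Set α) =ᵐ[μ] A := inter_ae_eq_left_of_ae_eq_univ (eventuallyEq_univ.2 h)
  rw [← measure_congr hae, hinter, ← sum_measure_singleton, Measure.finsetSum_apply,
    Finset.sum_filter]
  refine Finset.sum_congr rfl fun x _ ↦ ?_
  rw [Measure.smul_apply, Measure.dirac_apply' _ hA, indicator_apply]
  simp

lemma integral_sum_smul_dirac {α ι : Type*} [MeasurableSpace α] [MeasurableSingletonClass α]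
    [Fintype ι] {p : ι → ℝ} (hp : ∀ i, 0 ≤ p i) (ξ : ι → α) (f : α → ℝ) :
    ∫ x, f x ∂(∑ i, ENNReal.ofReal (p i) • Measure.dirac (ξ i)) = ∑ i, p i * f (ξ i) := by
  rw [integral_finsetSum_measure fun i _ ↦
    (integrable_dirac (by simp)).smul_measure ENNReal.ofReal_ne_top]
  refine Finset.sum_congr rfl fun i _ ↦ ?_
  rw [integral_smul_measure, integral_dirac, ENNReal.toReal_ofReal (hp i), smul_eq_mul]

lemma exists_eq_sum_dirac {α : Type*} [MeasurableSpace α] [MeasurableSingletonClass α]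
    [Infinite α] {μ : Measure α} [IsProbabilityMeasure μ] {n : ℕ} {S : Set α}
    (hS : S.encard ≤ n) (h : ∀ᵐ x ∂μ, x ∈ S) :
    ∃ (p : Fin n → ℝ) (ξ : Fin n → α), (∀ l, 0 ≤ p l ∧ p l ≤ 1) ∧
      μ = ∑ l, ENNReal.ofReal (p l) • Measure.dirac (ξ l) := by
  lift S to Finset α using finite_of_encard_le_coe hS
  rw [encard_coe_eq_coe_finsetCard, Nat.cast_le] at hS
  obtain ⟨T, hST, hT⟩ := Infinite.exists_superset_card_eq S n hS
  let e : Fin n ≃ T := (T.equivFinOfCardEq hT).symm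
  refine ⟨fun l ↦ μ.real {(e l : α)}, fun l ↦ e l,
    fun l ↦ ⟨measureReal_nonneg, measureReal_le_one⟩, ?_⟩
  calc μ = ∑ x ∈ T, μ {x} • Measure.dirac x :=
        eq_sum_smul_dirac_of_ae_mem (h.mono fun x hx ↦ hST hx)
    _ = ∑ l, μ {(e l : α)} • Measure.dirac (e l : α) := by
        rw [← Finset.sum_coe_sort, ← e.sum_comp]
    _ = ∑ l, ENNReal.ofReal (μ.real {(e l : α)}) • Measure.dirac (e l : α) := by
        simp only [ofReal_measureReal (measure_ne_top μ _)]

lemma exists_eq_sum_dirac_and_moments {μ : Measure ℝ} [IsProbabilityMeasure μ] {n : ℕ}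
    {S : Set ℝ} (hS : S.encard ≤ n) (h : ∀ᵐ x ∂μ, x ∈ S) :
    ∃ p ξ : Fin n → ℝ, (∀ l, 0 ≤ p l ∧ p l ≤ 1) ∧ ∑ l, p l = 1 ∧
      μ = ∑ l, ENNReal.ofReal (p l) • Measure.dirac (ξ l) ∧
      ∑ l, p l * ξ l = ∫ x, x ∂μ ∧ ∑ l, p l * ξ l ^ 2 = ∫ x, x ^ 2 ∂μ := by
  obtain ⟨p, ξ, hp, hμ⟩ := exists_eq_sum_dirac hS h
  have hint (f : ℝ → ℝ) : ∑ l, p l * f (ξ l) = ∫ x, f x ∂μ := by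
    rw [← integral_sum_smul_dirac (fun l ↦ (hp l).1), ← hμ]
  exact ⟨p, ξ, hp, by simpa using hint 1, hμ, hint id, hint (· ^ 2)⟩

/-! ### Existence of optimal pairs -/

lemma exists_subseq_tendsto_inner {H : Type*} [NormedAddCommGroup H] [InnerProductSpace ℝ H]
    [CompleteSpace H] [TopologicalSpace.SeparableSpace H] {v : ℕ → H} {C : ℝ}
    (hv : ∀ n, ‖v n‖ ≤ C) :
    ∃ φ : ℕ → ℕ, StrictMono φ ∧ ∃ u : H, ∀ w,
      Tendsto (fun n ↦ inner ℝ (v (φ n)) w) atTop (𝓝 (inner ℝ u w)) := by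
  obtain ⟨T, -, φ, hφ, hT⟩ := WeakDual.isSeqCompact_closedBall ℝ H 0 C
    (x := fun n ↦ StrongDual.toWeakDual (InnerProductSpace.toDual ℝ H (v n)))
    (fun n ↦ by simpa using hv n)
  refine ⟨φ, hφ, (InnerProductSpace.toDual ℝ H).symm (WeakDual.toStrongDual T), fun w ↦ ?_⟩
  rw [InnerProductSpace.toDual_symm_apply]
  exact (WeakDual.eval_continuous w).continuousAt.tendsto.comp hT

lemma exists_isSoftTest_ae_eq {α : Type*} [MeasurableSpace α] {γ : Measure α} {u : α → ℝ}
    (hu : AEMeasurable u γ) (h0 : 0 ≤ᵐ[γ] u) (h1 : u ≤ᵐ[γ] 1) : ∃ χ, IsSoftTest χ ∧ χ =ᵐ[γ] u := by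
  refine ⟨fun y ↦ max 0 (min 1 (hu.mk u y)), ⟨by fun_prop, fun y ↦ le_max_left _ _,
    fun y ↦ max_le zero_le_one (min_le_left _ _)⟩, ?_⟩
  filter_upwards [h0, h1, hu.ae_eq_mk] with y hy0 hy1 hy
  rw [← hy]
  exact (congrArg _ (min_eq_right hy1)).trans (max_eq_right hy0)

section WeakCompactness

variable {α : Type*} [MeasurableSpace α] {γ : Measure α} [IsFiniteMeasure γ]

lemma IsSoftTest.memLp {f : α → ℝ} (hf : IsSoftTest f) (p : ℝ≥0∞) : MemLp f p γ :=
  .of_bound hf.measurable.aestronglyMeasurable 1 (ae_of_all _ hf.norm_le_one)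

lemma exists_subseq_tendsto_integral_mul_of_memLp [MeasurableSpace.CountablyGenerated α]
    {ψ : ℕ → α → ℝ} (hψ : ∀ n, IsSoftTest (ψ n)) :
    ∃ φ : ℕ → ℕ, StrictMono φ ∧ ∃ u, MemLp u 2 γ ∧ ∀ g, MemLp g 2 γ →
      Tendsto (fun n ↦ ∫ y, ψ (φ n) y * g y ∂γ) atTop (𝓝 (∫ y, u y * g y ∂γ)) := by
  have : Fact ((2 : ℝ≥0∞) ≠ ∞) := ⟨ENNReal.ofNat_ne_top⟩
  have hbound (n : ℕ) := Lp.norm_le_of_ae_bound (p := 2) (f := ((hψ n).memLp 2).toLp (ψ n))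
    (μ := γ) zero_le_one (((hψ n).memLp 2).coeFn_toLp.mono fun y hy ↦
      hy ▸ (hψ n).norm_le_one y)
  obtain ⟨φ, hφ, u, hu⟩ := exists_subseq_tendsto_inner hbound
  have hinner {f g : α → ℝ} (hf : MemLp f 2 γ) (hg : MemLp g 2 γ) :
      inner ℝ (hf.toLp f) (hg.toLp g) = ∫ y, f y * g y ∂γ := by
    refine integral_congr_ae ?_
    filter_upwards [hf.coeFn_toLp, hg.coeFn_toLp] with y hfy hgy
    rw [hfy, hgy, real_inner_eq_re_inner, RCLike.inner_apply', conj_trivial, RCLike.re_to_real]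
  refine ⟨φ, hφ, u, Lp.memLp u, fun g hg ↦ ?_⟩
  have hlim := hu (hg.toLp g)
  simp only [hinner _ hg] at hlim
  rwa [← Lp.toLp_coeFn u (Lp.memLp u), hinner _ hg] at hlim

lemma exists_subseq_tendsto_integral_mul [MeasurableSpace.CountablyGenerated α]
    {ψ : ℕ → α → ℝ} (hψ : ∀ n, IsSoftTest (ψ n)) :
    ∃ φ : ℕ → ℕ, StrictMono φ ∧ ∃ χ, IsSoftTest χ ∧ ∀ g, MemLp g 2 γ →
      Tendsto (fun n ↦ ∫ y, ψ (φ n) y * g y ∂γ) atTop (𝓝 (∫ y, χ y * g y ∂γ)) := by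
  obtain ⟨φ, hφ, u, hu, hlim⟩ := exists_subseq_tendsto_integral_mul_of_memLp (γ := γ) hψ
  have hint : Integrable u γ := hu.integrable one_le_two
  have hset {s : Set α} (hs : MeasurableSet s) :
      Tendsto (fun n ↦ ∫ y in s, ψ (φ n) y ∂γ) atTop (𝓝 (∫ y in s, u y ∂γ)) := by
    have hmul (f : α → ℝ) : ∫ y, f y * s.indicator 1 y ∂γ = ∫ y in s, f y ∂γ := by
      rw [← integral_indicator hs]
      exact integral_congr_ae (ae_of_all _ fun y ↦ by by_cases hy : y ∈ s <;> simp [hy])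
    simpa only [hmul] using hlim (s.indicator 1)
      (memLp_indicator_const 2 hs (1 : ℝ) (.inr (measure_ne_top _ _)))
  have h0 : 0 ≤ᵐ[γ] u := ae_nonneg_of_forall_setIntegral_nonneg hint fun s hs _ ↦
    ge_of_tendsto' (hset hs) fun n ↦ (hψ (φ n)).integral_nonneg
  have h1 : u ≤ᵐ[γ] 1 :=
    ae_le_of_forall_setIntegral_le hint (integrable_const _) fun s hs _ ↦
      le_of_tendsto' (hset hs) fun n ↦ integral_mono (hψ (φ n)).integrable
        (integrable_const _) (hψ (φ n)).le_one
  obtain ⟨χ, hχ, hχu⟩ := exists_isSoftTest_ae_eq hint.aemeasurable h0 h1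
  refine ⟨φ, hφ, χ, hχ, fun g hg ↦ ?_⟩
  exact (integral_congr_ae (hχu.mul (EventuallyEq.refl _ g)) :
    ∫ y, χ y * g y ∂γ = ∫ y, u y * g y ∂γ) ▸ hlim g hg

end WeakCompactness

lemma memLp_two_exp_gaussianReal (x : ℝ) :
    MemLp (fun y ↦ exp (x * y - x ^ 2 / 2)) 2 (gaussianReal 0 1) := by
  rw [memLp_two_iff_integrable_sq (by fun_prop)]
  refine ((integrable_exp_mul_gaussianReal (2 * x)).const_mul (exp (-x ^ 2))).congr
    (ae_of_all _ fun y ↦ ?_)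
  simp only [← exp_add, ← exp_nat_mul]
  ring_nf

lemma exists_subseq_tendsto_response {ψ : ℕ → ℝ → ℝ} (hψ : ∀ n, IsSoftTest (ψ n)) :
    ∃ φ : ℕ → ℕ, StrictMono φ ∧ ∃ χ, IsSoftTest χ ∧ ∀ x,
      Tendsto (fun n ↦ response (ψ (φ n)) x) atTop (𝓝 (response χ x)) := by
  obtain ⟨φ, hφ, χ, hχ, h⟩ := exists_subseq_tendsto_integral_mul (γ := gaussianReal 0 1) hψ
  refine ⟨φ, hφ, χ, hχ, fun x ↦ ?_⟩
  simpa only [response_eq_integral_exp] using h _ (memLp_two_exp_gaussianReal x)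

lemma exists_uniformContinuous_eq_binEntropy :
    ∃ H : ℝ → ℝ, UniformContinuous H ∧ ∀ p ∈ Icc (0 : ℝ) 1, H p = binEntropy p :=
  ⟨IccExtend (zero_le_one (α := ℝ)) ((Icc (0 : ℝ) 1).domRestrict binEntropy),
    (CompactSpace.uniformContinuous_of_continuous
      (binEntropy_continuous.comp continuous_subtype_val)).comp
      (LipschitzWith.projIcc zero_le_one).uniformContinuous,
    fun _ hp ↦ IccExtend_of_mem _ _ hp⟩

section VaryingMeasures

variable {X : Type*} [TopologicalSpace X] {ι : Type*} {l : Filter ι} {F : ι → X → ℝ} {f : X → ℝ}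

lemma tendstoUniformlyOn_of_equicontinuous (hF : Equicontinuous F)
    (hpt : ∀ x, Tendsto (F · x) l (𝓝 (f x))) {K : Set X} (hK : IsCompact K) :
    TendstoUniformlyOn F f l K :=
  UniformOnFun.tendsto_iff_tendstoUniformlyOn.1
    ((EquicontinuousOn.tendsto_uniformOnFun_iff_pi' (𝔖 := {K}) (by simpa using hK)
      (fun _ _ ↦ hF.equicontinuousOn _) l f).2 (tendsto_pi_nhds.2 fun x ↦ hpt x)) K rfl

lemma abs_integral_sub_integral_le {α : Type*} [MeasurableSpace α] {μ : Measure α}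
    [IsProbabilityMeasure μ] {f g : α → ℝ} (hf : Integrable f μ) (hg : Integrable g μ) {M ε : ℝ}
    (hfM : ∀ x, |f x| ≤ M) (hgM : ∀ x, |g x| ≤ M) {K : Set α} (hK : MeasurableSet K)
    (hε : 0 ≤ ε) (hfg : ∀ x ∈ K, |f x - g x| ≤ ε) :
    |∫ x, f x ∂μ - ∫ x, g x ∂μ| ≤ ε + 2 * M * μ.real Kᶜ := by
  have hbound (x : α) : |f x - g x| ≤ ε + Kᶜ.indicator (fun _ ↦ 2 * M) x := by
    by_cases hx : x ∈ K
    · simpa [hx] using hfg x hx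
    · rw [indicator_of_mem hx]
      linarith [abs_sub (f x) (g x), hfM x, hgM x]
  have hind : Integrable (Kᶜ.indicator fun _ ↦ 2 * M) μ :=
    (integrable_const _).indicator hK.compl
  calc |∫ x, f x ∂μ - ∫ x, g x ∂μ|
      ≤ ∫ x, |f x - g x| ∂μ := integral_sub hf hg ▸ abs_integral_le_integral_abs
    _ ≤ ∫ x, (ε + Kᶜ.indicator (fun _ ↦ 2 * M) x) ∂μ :=
        integral_mono (hf.sub hg).abs ((integrable_const _).add hind) hbound
    _ = ε + 2 * M * μ.real Kᶜ := by
        rw [integral_add (integrable_const _) hind, integral_indicator_const _ hK.compl,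
          integral_const, probReal_univ, one_smul, smul_eq_mul, mul_comm (μ.real _)]

variable [T2Space X] [MeasurableSpace X] [OpensMeasurableSpace X]

lemma tendsto_integral_of_isTightMeasureSet [l.NeBot] (hF : Equicontinuous F) {M : ℝ}
    (hM : ∀ i x, |F i x| ≤ M) (hpt : ∀ x, Tendsto (F · x) l (𝓝 (f x)))
    {μ : ι → ProbabilityMeasure X} {ν : ProbabilityMeasure X} (hμ : Tendsto μ l (𝓝 ν))
    (htight : IsTightMeasureSet (range fun i ↦ (μ i : Measure X))) :
    Tendsto (fun i ↦ ∫ x, F i x ∂(μ i : Measure X)) l (𝓝 (∫ x, f x ∂(ν : Measure X))) := by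
  have hfM (x : X) : |f x| ≤ M := le_of_tendsto' (hpt x).abs fun i ↦ hM i x
  have hfc : Continuous f := Tendsto.continuous_of_equicontinuous (tendsto_pi_nhds.2 hpt) hF
  have hfix : Tendsto (fun i ↦ ∫ x, f x ∂(μ i : Measure X)) l (𝓝 (∫ x, f x ∂(ν : Measure X))) :=
    ProbabilityMeasure.tendsto_iff_forall_integral_tendsto.1 hμ
      (.ofNormedAddCommGroup f hfc M hfM)
  suffices hdiff : Tendsto (fun i ↦ ∫ x, F i x ∂(μ i : Measure X) - ∫ x, f x ∂(μ i : Measure X)) l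
      (𝓝 0) by simpa using hdiff.add hfix
  obtain ⟨i₀⟩ := l.nonempty_of_neBot
  obtain ⟨x₀⟩ := (ν : Measure X).nonempty_of_neZero
  have hM0 : 0 ≤ M := (abs_nonneg _).trans (hM i₀ x₀)
  refine Metric.tendsto_nhds.2 fun ε hε ↦ ?_
  obtain ⟨δ, hδ, hMδ⟩ : ∃ δ, 0 < δ ∧ 2 * M * δ < ε / 2 :=
    ⟨ε / (4 * (M + 1)), by positivity, by
      rw [mul_div_assoc', div_lt_div_iff₀ (by positivity) two_pos]; nlinarith⟩
  obtain ⟨K, hK, hKδ⟩ := isTightMeasureSet_iff_exists_isCompact_measure_compl_le.1 htight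
    (ENNReal.ofReal δ) (ENNReal.ofReal_pos.2 hδ)
  filter_upwards [Metric.tendstoUniformlyOn_iff.1 (tendstoUniformlyOn_of_equicontinuous hF hpt hK)
    (ε / 2) (half_pos hε)] with i hi
  have hcompl : (μ i : Measure X).real Kᶜ ≤ δ :=
    ENNReal.toReal_le_of_le_ofReal hδ.le (hKδ _ ⟨i, rfl⟩)
  rw [Real.dist_eq, sub_zero]
  calc |∫ x, F i x ∂(μ i : Measure X) - ∫ x, f x ∂(μ i : Measure X)|
      ≤ ε / 2 + 2 * M * (μ i : Measure X).real Kᶜ :=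
        abs_integral_sub_integral_le
          (.of_bound (hF.continuous i).aestronglyMeasurable M (ae_of_all _ (hM i)))
          (.of_bound hfc.aestronglyMeasurable M (ae_of_all _ hfM)) (hM i) hfM hK.measurableSet
          (half_pos hε).le fun x hx ↦ by
            rw [abs_sub_comm, ← Real.dist_eq]
            exact (hi x hx).le
    _ ≤ ε / 2 + 2 * M * δ := by gcongr
    _ < ε := by linarith

end VaryingMeasures

lemma tendsto_info {ψ : ℕ → ℝ → ℝ} (hψ : ∀ n, IsSoftTest (ψ n)) {χ : ℝ → ℝ} (hχ : IsSoftTest χ)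
    (hpt : ∀ x, Tendsto (fun n ↦ response (ψ n) x) atTop (𝓝 (response χ x)))
    {μ : ℕ → ProbabilityMeasure ℝ} {ν : ProbabilityMeasure ℝ} (hμ : Tendsto μ atTop (𝓝 ν))
    (htight : IsTightMeasureSet (range fun n ↦ (μ n : Measure ℝ))) :
    Tendsto (fun n ↦ info (μ n) (response (ψ n))) atTop (𝓝 (info ν (response χ))) := by
  obtain ⟨H, hH, hHeq⟩ := exists_uniformContinuous_eq_binEntropy
  have hH' {φ : ℝ → ℝ} (hφ : IsSoftTest φ) (x : ℝ) : H (response φ x) = binEntropy (response φ x) :=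
    hHeq _ ⟨hφ.response_nonneg x, hφ.response_le_one x⟩
  have hequi : Equicontinuous fun n ↦ response (ψ n) :=
    (uniformEquicontinuous_response hψ).equicontinuous
  have hmean := tendsto_integral_of_isTightMeasureSet hequi
    (fun n ↦ (hψ n).isSoftTest_response.norm_le_one) hpt hμ htight
  have hcond := tendsto_integral_of_isTightMeasureSet (F := fun n x ↦ H (response (ψ n) x))
    (f := fun x ↦ H (response χ x)) (fun x _ hU ↦ hequi x _ (hH hU)) (M := log 2)
    (fun n x ↦ by
      rw [hH' (hψ n), abs_of_nonneg (binEntropy_nonneg ((hψ n).response_nonneg x)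
        ((hψ n).response_le_one x))]
      exact binEntropy_le_log_two)
    (fun x ↦ (hH.continuous.tendsto _).comp (hpt x)) hμ htight
  simp only [hH' hχ, hH' (hψ _)] at hcond
  exact ((binEntropy_continuous.tendsto _).comp hmean).sub hcond

lemma isTightMeasureSet_isAdmissibleInput (P : ℝ) :
    IsTightMeasureSet {μ | IsAdmissibleInput P μ} := by
  rw [isTightMeasureSet_iff_exists_isCompact_measure_compl_le]
  intro ε hε
  have hlim : Tendsto (fun R : ℝ ↦ ENNReal.ofReal P / ENNReal.ofReal (R ^ 2)) atTop (𝓝 0) := by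
    simpa using ENNReal.Tendsto.const_div (ENNReal.tendsto_ofReal_atTop.comp
      (tendsto_pow_atTop two_ne_zero)) (.inr (ENNReal.ofReal_ne_top (r := P)))
  obtain ⟨R, hRε, hR⟩ := ((hlim.eventually (ge_mem_nhds hε)).and (eventually_gt_atTop 0)).exists
  refine ⟨Metric.closedBall 0 R, isCompact_closedBall _ _, fun μ hμ ↦ ?_⟩
  calc μ (Metric.closedBall 0 R)ᶜ ≤ μ {x | ENNReal.ofReal (R ^ 2) ≤ ENNReal.ofReal (x ^ 2)} := by
        refine measure_mono fun x hx ↦ ENNReal.ofReal_le_ofReal (sq_le_sq.2 ?_)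
        rw [mem_compl_iff, mem_closedBall_zero_iff, not_le, Real.norm_eq_abs] at hx
        rw [abs_of_pos hR]
        exact hx.le
    _ ≤ (∫⁻ x, ENNReal.ofReal (x ^ 2) ∂μ) / ENNReal.ofReal (R ^ 2) :=
        meas_ge_le_lintegral_div (by fun_prop) (ENNReal.ofReal_pos.2 (by positivity)).ne'
          ENNReal.ofReal_ne_top
    _ ≤ ENNReal.ofReal P / ENNReal.ofReal (R ^ 2) := ENNReal.div_le_div_right hμ.power_le _
    _ ≤ ε := hRε

lemma isAdmissibleInput_of_tendsto {P : ℝ} {μ : ℕ → ProbabilityMeasure ℝ}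
    (hμ : ∀ n, IsAdmissibleInput P (μ n : Measure ℝ)) {ν : ProbabilityMeasure ℝ}
    (hν : Tendsto μ atTop (𝓝 ν)) : IsAdmissibleInput P (ν : Measure ℝ) where
  isProbabilityMeasure := inferInstance
  power_le :=
    calc ∫⁻ x, ENNReal.ofReal (x ^ 2) ∂(ν : Measure ℝ)
        ≤ liminf (fun n ↦ ∫⁻ x, ENNReal.ofReal (x ^ 2) ∂(μ n : Measure ℝ)) atTop :=
          lintegral_le_liminf_lintegral_of_forall_isOpen_measure_le_liminf_measure
            (f := fun x ↦ x ^ 2) (by fun_prop) (fun x ↦ sq_nonneg x) fun G hG ↦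
              ProbabilityMeasure.le_liminf_measure_open_of_tendsto hν hG
      _ ≤ ENNReal.ofReal P := liminf_le_of_le (by isBoundedDefault) fun b hb ↦
          hb.exists.choose_spec.trans (hμ _).power_le

lemma exists_subseq_tendsto_isAdmissibleInput {P : ℝ} {μ : ℕ → ProbabilityMeasure ℝ}
    (hμ : ∀ n, IsAdmissibleInput P (μ n : Measure ℝ)) :
    ∃ φ : ℕ → ℕ, StrictMono φ ∧ ∃ ν : ProbabilityMeasure ℝ, IsAdmissibleInput P (ν : Measure ℝ) ∧
      Tendsto (μ ∘ φ) atTop (𝓝 ν) := by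
  have hcompact := isCompact_closure_of_isTightMeasureSet
    (S := {ν : ProbabilityMeasure ℝ | IsAdmissibleInput P (ν : Measure ℝ)})
    ((isTightMeasureSet_isAdmissibleInput P).subset (by rintro _ ⟨ν, hν, rfl⟩; exact hν))
  obtain ⟨ν, -, φ, hφ, hν⟩ := hcompact.tendsto_subseq fun n ↦ subset_closure (hμ n)
  exact ⟨φ, hφ, ν, isAdmissibleInput_of_tendsto (fun n ↦ hμ (φ n)) hν, hν⟩

lemma exists_isAdmissibleInput_isSoftTest_info_le (P : ℝ) :
    ∃ μ ψ, IsAdmissibleInput P μ ∧ IsSoftTest ψ ∧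
      ∀ μ', IsAdmissibleInput P μ' → ∀ ψ', IsSoftTest ψ' →
        info μ' (response ψ') ≤ info μ (response ψ) := by
  set S : Set ℝ := {r | ∃ μ, IsAdmissibleInput P μ ∧ ∃ ψ, IsSoftTest ψ ∧ info μ (response ψ) = r}
  have hbdd : BddAbove S := ⟨log 2, by
    rintro _ ⟨μ, -, ψ, hψ, rfl⟩
    exact hψ.isSoftTest_response.info_le_log_two⟩
  have hne : S.Nonempty :=
    ⟨_, Measure.dirac 0, ⟨inferInstance, by simp⟩, _, .const le_rfl zero_le_one, rfl⟩
  obtain ⟨u, -, hu, huS⟩ := exists_seq_tendsto_sSup hne hbdd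
  choose μ hμ ψ hψ hval using huS
  let m : ℕ → ProbabilityMeasure ℝ := fun n ↦ ⟨μ n, (hμ n).isProbabilityMeasure⟩
  obtain ⟨φ, hφ, ν, hν, hlim⟩ := exists_subseq_tendsto_isAdmissibleInput (μ := m) hμ
  obtain ⟨φ', hφ', χ, hχ, hpt⟩ := exists_subseq_tendsto_response fun n ↦ hψ (φ n)
  have hinfo : Tendsto (fun n ↦ info (μ (φ (φ' n))) (response (ψ (φ (φ' n))))) atTop
      (𝓝 (info ν (response χ))) :=
    tendsto_info (fun n ↦ hψ _) hχ hpt (hlim.comp hφ'.tendsto_atTop)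
      ((isTightMeasureSet_isAdmissibleInput P).subset (range_subset_iff.2 fun n ↦ hμ _))
  have hsup : info ν (response χ) = sSup S :=
    tendsto_nhds_unique (hinfo.congr fun n ↦ hval _)
      (hu.comp (hφ.tendsto_atTop.comp hφ'.tendsto_atTop))
  exact ⟨ν, χ, hν, hχ, fun μ' hμ' ψ' hψ' ↦ hsup ▸ le_csSup hbdd ⟨μ', hμ', ψ', hψ', rfl⟩⟩

lemma exists_isOptimal (P : ℝ) : ∃ μ D, IsOptimal P μ D := by
  obtain ⟨μ, ψ, hμ, hψ, hmax⟩ := exists_isAdmissibleInput_isSoftTest_info_le P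
  suffices h : ∃ D, MeasurableSet D ∧ info μ (response ψ) ≤ info μ (response (hardTest D)) by
    obtain ⟨D, hD, hle⟩ := h
    exact ⟨μ, D, hμ, hD, fun μ' hμ' D' hD' ↦
      (hmax μ' hμ' _ (isSoftTest_hardTest hD')).trans hle⟩
  have := hμ.isProbabilityMeasure
  rcases hψ.isSoftTest_response.info_nonneg.eq_or_lt (b := info μ (response ψ)) with h0 | hpos
  · exact ⟨∅, .empty, h0 ▸ (isSoftTest_hardTest .empty).isSoftTest_response.info_nonneg⟩
  · have hproper := hψ.isProperTest_of_info_pos hpos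
    exact ⟨_, hproper.measurableSet_smoothedScore_pos hμ.integrable_sq,
      hproper.info_le_info_hardTest hμ.integrable_sq⟩

/-! ### Reduction to unit noise -/

section Scaling

variable {σ : ℝ≥0} {P : ℝ} {μ : Measure ℝ} {D : Set ℝ}

lemma measurableSet_setOf_mul_mem (c : ℝ) (hD : MeasurableSet D) : MeasurableSet {y | c * y ∈ D} :=
  measurable_const_mul c hD

lemma mutualInfo_jointLaw_eq_info_map [IsProbabilityMeasure μ] (hσ : σ ≠ 0)
    (hD : MeasurableSet D) :
    mutualInfo (jointLaw σ D μ) =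
      ENNReal.ofReal
        (info (μ.map ((σ : ℝ)⁻¹ * ·)) (response (hardTest {y | (σ : ℝ) * y ∈ D}))) := by
  rw [mutualInfo_jointLaw σ hD, info_map (by fun_prop)
    (isSoftTest_hardTest (measurableSet_setOf_mul_mem _ hD)).isSoftTest_response.measurable]
  simp only [← crossover_eq_response hσ hD, inv_mul_eq_div]

lemma mutualInfo_jointLaw_map [IsProbabilityMeasure μ] (hσ : σ ≠ 0) (hD : MeasurableSet D) :
    mutualInfo (jointLaw σ {y | (σ : ℝ)⁻¹ * y ∈ D} (μ.map ((σ : ℝ) * ·))) =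
      ENNReal.ofReal (info μ (response (hardTest D))) := by
  have h0 : (σ : ℝ) ≠ 0 := NNReal.coe_ne_zero.2 hσ
  have : IsProbabilityMeasure (μ.map ((σ : ℝ) * ·)) :=
    Measure.isProbabilityMeasure_map (by fun_prop)
  rw [mutualInfo_jointLaw_eq_info_map hσ (measurableSet_setOf_mul_mem _ hD),
    Measure.map_map (by fun_prop) (by fun_prop)]
  simp [Function.comp_def, h0]

lemma mutualInfo_le_capacity (hD : MeasurableSet D) (hμ : IsAdmissibleInput P μ) :
    mutualInfo (jointLaw σ D μ) ≤ capacity σ P :=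
  le_iSup₂_of_le D hD (le_iSup₂_of_le μ hμ le_rfl)

lemma IsAdmissibleInput.map_mul_of_inv (hσ : σ ≠ 0)
    (h : IsAdmissibleInput ((σ : ℝ)⁻¹ ^ 2 * P) μ) : IsAdmissibleInput P (μ.map ((σ : ℝ) * ·)) := by
  have hmap := h.map_mul σ
  rwa [← mul_assoc, ← mul_pow, mul_inv_cancel₀ (NNReal.coe_ne_zero.2 hσ), one_pow, one_mul] at hmap

lemma IsOptimal.isCapacityAchieving (hσ : σ ≠ 0) (h : IsOptimal ((σ : ℝ)⁻¹ ^ 2 * P) μ D) :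
    IsCapacityAchieving σ P (μ.map ((σ : ℝ) * ·)) := by
  have := h.isProbabilityMeasure
  have hadm := h.isAdmissibleInput.map_mul_of_inv hσ
  have hD := measurableSet_setOf_mul_mem (σ : ℝ)⁻¹ h.measurableSet
  refine ⟨hadm, _, hD, le_antisymm (mutualInfo_le_capacity hD hadm) ?_⟩
  refine iSup₂_le fun D' hD' ↦ iSup₂_le fun μ' hμ' ↦ ?_
  have := hμ'.isProbabilityMeasure
  rw [mutualInfo_jointLaw_map hσ h.measurableSet, mutualInfo_jointLaw_eq_info_map hσ hD']
  exact ENNReal.ofReal_le_ofReal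
    (h.info_le _ (hμ'.map_mul _) _ (measurableSet_setOf_mul_mem _ hD'))

namespace IsCapacityAchieving

lemma exists_isOptimal (hσ : σ ≠ 0) (h : IsCapacityAchieving σ P μ) :
    ∃ E, IsOptimal ((σ : ℝ)⁻¹ ^ 2 * P) (μ.map ((σ : ℝ)⁻¹ * ·)) E := by
  obtain ⟨hμ, D, hD, hval⟩ := h
  have hadm := hμ.map_mul (σ : ℝ)⁻¹
  have hE := measurableSet_setOf_mul_mem σ hD
  have := hμ.isProbabilityMeasure
  have := hadm.isProbabilityMeasure
  refine ⟨_, hadm, hE, fun μ' hμ' D' hD' ↦ ?_⟩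
  have := hμ'.isProbabilityMeasure
  have hle := mutualInfo_le_capacity (σ := σ) (measurableSet_setOf_mul_mem (σ : ℝ)⁻¹ hD')
    (hμ'.map_mul_of_inv hσ)
  rw [mutualInfo_jointLaw_map hσ hD', ← hval, mutualInfo_jointLaw_eq_info_map hσ hD] at hle
  exact (ENNReal.ofReal_le_ofReal_iff
    (isSoftTest_hardTest hE).isSoftTest_response.info_nonneg).1 hle

lemma exists_support_and_moments (hσ : σ ≠ 0) (hP : 0 < P) (h : IsCapacityAchieving σ P μ) :
    ∃ S : Set ℝ, S.encard ≤ 3 ∧ (∀ᵐ x ∂μ, x ∈ S) ∧ ∫ x, x ∂μ = 0 ∧ ∫ x, x ^ 2 ∂μ = P := by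
  have h0 : (σ : ℝ) ≠ 0 := NNReal.coe_ne_zero.2 hσ
  have hP' : 0 < (σ : ℝ)⁻¹ ^ 2 * P := by positivity
  obtain ⟨E, hE⟩ := h.exists_isOptimal hσ
  obtain ⟨S, hS, hmem⟩ := hE.exists_support hP'
  have hmean := hE.integral_id hP'
  have hpower := hE.integral_sq hP'
  rw [integral_map (by fun_prop) (by fun_prop)] at hmean hpower
  simp only [mul_pow] at hpower
  rw [integral_const_mul] at hmean hpower
  refine ⟨((σ : ℝ) * ·) '' S, (encard_image_le _ _).trans hS, ?_,
    (mul_eq_zero.1 hmean).resolve_left (inv_ne_zero h0),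
    mul_left_cancel₀ (pow_ne_zero 2 (inv_ne_zero h0)) hpower⟩
  filter_upwards [ae_of_ae_map (by fun_prop) hmem] with x hx
  exact ⟨_, hx, mul_inv_cancel_left₀ h0 x⟩

end IsCapacityAchieving

lemma IsAdmissibleInput.integral_sq_eq_zero (h : IsAdmissibleInput 0 μ) : ∫ x, x ^ 2 ∂μ = 0 :=
  le_antisymm (h.integral_sq_le le_rfl) (integral_nonneg fun x ↦ sq_nonneg x)

lemma IsAdmissibleInput.ae_eq_zero (h : IsAdmissibleInput 0 μ) : ∀ᵐ x ∂μ, x = 0 := by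
  filter_upwards [(integral_eq_zero_iff_of_nonneg (fun x ↦ sq_nonneg x) h.integrable_sq).1
    h.integral_sq_eq_zero] with x hx
  exact pow_eq_zero_iff two_ne_zero |>.1 hx

lemma IsCapacityAchieving.exists_three_points (hσ : σ ≠ 0) (hP : 0 ≤ P)
    (h : IsCapacityAchieving σ P μ) :
    ∃ p ξ : Fin 3 → ℝ, (∀ l, 0 ≤ p l ∧ p l ≤ 1) ∧ ∑ l, p l = 1 ∧
      μ = ∑ l, ENNReal.ofReal (p l) • Measure.dirac (ξ l) ∧
      ∑ l, p l * ξ l = 0 ∧ ∑ l, p l * ξ l ^ 2 = P := by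
  have := h.1.isProbabilityMeasure
  obtain ⟨S, hS, hmem, hmean, hpower⟩ : ∃ S : Set ℝ, S.encard ≤ 3 ∧ (∀ᵐ x ∂μ, x ∈ S) ∧
      ∫ x, x ∂μ = 0 ∧ ∫ x, x ^ 2 ∂μ = P := by
    rcases hP.eq_or_lt with rfl | hP
    · exact ⟨{0}, by simp, h.1.ae_eq_zero, integral_eq_zero_of_ae h.1.ae_eq_zero,
        h.1.integral_sq_eq_zero⟩
    · exact h.exists_support_and_moments hσ hP
  simpa only [hmean, hpower] using exists_eq_sum_dirac_and_moments (n := 3) hS hmem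

end Scaling

end

end OneBitChannel

theorem proposition1 (σ : ℝ≥0) (hσ : 0 < σ) (P : ℝ) (hP : 0 ≤ P) :
    (∃ μ : Measure ℝ, OneBitChannel.IsCapacityAchieving σ P μ) ∧
      ∀ μ : Measure ℝ, OneBitChannel.IsCapacityAchieving σ P μ →
        ∃ p ξ : Fin 3 → ℝ,
          (∀ l, 0 ≤ p l ∧ p l ≤ 1) ∧ ∑ l, p l = 1 ∧
          μ = ∑ l, ENNReal.ofReal (p l) • Measure.dirac (ξ l) ∧
          ∑ l, p l * ξ l = 0 ∧ ∑ l, p l * ξ l ^ 2 = P := by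
  refine ⟨?_, fun μ hμ ↦ hμ.exists_three_points hσ.ne' hP⟩
  obtain ⟨μ, D, h⟩ := OneBitChannel.exists_isOptimal ((σ : ℝ)⁻¹ ^ 2 * P)
  exact ⟨_, h.isCapacityAchieving hσ.ne'⟩
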